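/- Let $\{p_k\}_{k\ge 0}$ be a probability distribution on $\{0,1,2,\dots\}$ with mean $m=\sum_{k\ge0}kp_k\in(0,1)$ and let $X$ be a real random variable. Consider the branching random walk with offspring law $\{p_k\}$ and step size $X$, started from one particle at the origin, in the following (jump-first) form: every particle $v$ carries a jump $X_v$ distributed as $X$ and an offspring number $N_v$ distributed according to $\{p_k\}$, all these variables being independent; the particle $v$, born at $V(v)$, jumps to $V(v)+X_v$ and there gives birth to $N_v$ children. The results below hold equally in the branch-first form, in which the $N_v$ children of $v$ are displaced from $V(v)$ by their own jumps, i.e. each child $w$ of $v$ has position $V(w)=V(v)+X_w$. Let $|v|$ be the generation of $v$ (the root has generation $0$ and position $0$), and $$M_n=\max_{|v|\le n}V(v),\qquad M=\sup_{n\ge0}M_n .$$ Assume that there is $\gamma>0$ with $\mathbb E[e^{\gamma X}]=1/m$, and that $\mathbb E[Xe^{\gamma X}]<\infty$ and $\sum_{k\ge1}(k\log k)\,p_k<\infty$. Put $c^*=m\,\mathbb E[Xe^{\gamma X}]$. Then: (i) for every $c\in(0,c^*)$, $\ \lim_{n\to\infty}\mathbb P(M_n\ge cn\mid M\ge cn)=1$;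 (ii) for every $c\in(c^*,\infty)$, $\ \lim_{n\to\infty}\mathbb P(M_n\ge cn\mid M\ge cn)=0$. Consequently there is a sharp transition for $e^{\gamma cn}\mathbb P(M_n\ge cn)$ at $c=c^*$, as conjectured by Neuman and Zheng: (iii) if there is no $h>0$ with $\mathbb P(X\in h\mathbb Z)=1$, then the limit $\kappa=\lim_{x\to\infty}e^{\gamma x}\mathbb P(M\ge x)$ exists in $(0,1]$, and $\lim_{n\to\infty}e^{\gamma cn}\mathbb P(M_n\ge cn)=\kappa$ for every $c\in(0,c^*)$; (iv) if $h>0$ is the largest number with $\mathbb P(X\in h\mathbb Z)=1$, then the limit $\kappa=\lim_{k\to\infty}e^{\gamma hk}\mathbb P(M\ge hk)$ ($k\in\mathbb N$) exists in $(0,1]$, and $\lim_{n\to\infty}e^{\gamma h\lceil cn/h\rceil}\mathbb P(M_n\ge cn)=\kappa$ for every $c\in(0,c^*)$; in particular $\lim_{n\to\infty}e^{\gamma cn}\mathbb P(M_n\ge cn)=\kappa$ whenever moreover $c\in h\mathbb N$; (v) for every $c\in(c^*,\infty)$, $\ \lim_{n\to\infty}e^{\gamma cn}\mathbb P(M_n\ge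 cn)=0$. -/

import Mathlib

open MeasureTheory ProbabilityTheory Filter Topology

/-!
Branching random walks, with particles labelled by finite words of natural numbers.  The root is
the empty word and `i :: v` is the child number `i` (counted from `0`) of `v`, so the head of a
word is its most recent letter and the length of a word is the generation of the particle.
-/

namespace BRW

/-- The two customary conventions for the displacements.  In `jumpFirst` a particle first jumps and
then produces its children at the place where it has landed; in `branchFirst` a particle first
produces its children, each of which then makes its own jump. -/
inductive Convention where
  | jumpFirst
  | branchFirst

/-- `InTree N v`: the word `v` belongs to the genealogical tree in which the particle `w` has
`N w` children. -/
def InTree (N : List ℕ → ℕ) : List ℕ → Prop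
  | [] => True
  | i :: v => i < N v ∧ InTree N v

/-- The position `V(v)` of a particle, where `X w` is the jump made by the particle `w`.
The root sits at the origin. -/
def position (o : Convention) (X : List ℕ → ℝ) : List ℕ → ℝ
  | [] => 0
  | i :: v =>
    match o with
    | Convention.jumpFirst => position o X v + X v
    | Convention.branchFirst => position o X v + X (i :: v)

/-- `M_n`, the largest position occupied by a particle up to generation `n`. -/
noncomputable def maxUpTo (o : Convention) (N : List ℕ → ℕ) (X : List ℕ → ℝ) (n : ℕ) : EReal :=
  ⨆ v ∈ {v : List ℕ | InTree N v ∧ v.length ≤ n}, ((position o X v : ℝ) : EReal)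

/-- `M = sup_n M_n`, the largest position ever occupied. -/
noncomputable def maxAll (o : Convention) (N : List ℕ → ℕ) (X : List ℕ → ℝ) : EReal :=
  ⨆ n : ℕ, maxUpTo o N X n

/-- On the probability space `(Ω, P)` the family `(N v, X v)`, indexed by all words `v`, is
independent, and for each `v` the offspring number `N v` has law `p`, the jump `X v` has law `μ`,
and the two are independent of each other. -/
structure IsReproduction {Ω : Type*} [MeasurableSpace Ω] (P : Measure Ω) (p : PMF ℕ)
    (μ : Measure ℝ) (N : List ℕ → Ω → ℕ) (X : List ℕ → Ω → ℝ) : Prop where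
  measurable_offspring : ∀ v, Measurable (N v)
  measurable_jump : ∀ v, Measurable (X v)
  law_offspring : ∀ v, P.map (N v) = p.toMeasure
  law_jump : ∀ v, P.map (X v) = μ
  indep_pair : ∀ v, IndepFun (N v) (X v) P
  indep_particles : iIndepFun (fun v ω => (N v ω, X v ω)) P

/-- The event `{M_n ≥ x}`. -/
def eventUpTo {Ω : Type*} (o : Convention) (N : List ℕ → Ω → ℕ) (X : List ℕ → Ω → ℝ)
    (n : ℕ) (x : ℝ) : Set Ω :=
  {ω | (x : EReal) ≤ maxUpTo o (fun v => N v ω) (fun v => X v ω) n}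

/-- The event `{M ≥ x}`. -/
def eventAll {Ω : Type*} (o : Convention) (N : List ℕ → Ω → ℕ) (X : List ℕ → Ω → ℝ)
    (x : ℝ) : Set Ω :=
  {ω | (x : EReal) ≤ maxAll o (fun v => N v ω) (fun v => X v ω)}

/-- The law `μ` is carried by the set `hℤ` of integer multiples of `h`. -/
def CarriedByMultiples (μ : Measure ℝ) (h : ℝ) : Prop :=
  ∀ᵐ x ∂μ, ∃ k : ℤ, x = k * h

/-- `μ` is not carried by `hℤ` for any `h > 0`. -/
def NonLattice (μ : Measure ℝ) : Prop :=
  ∀ h : ℝ, 0 < h → ¬ CarriedByMultiples μ h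

/-- `μ` is carried by `hℤ`, and `h > 0` is the largest number with this property. -/
def LatticeWithSpan (μ : Measure ℝ) (h : ℝ) : Prop :=
  0 < h ∧ CarriedByMultiples μ h ∧ ∀ h' : ℝ, 0 < h' → CarriedByMultiples μ h' → h' ≤ h

end BRW

/-! Decomposing the tree at the root shows that the tails `F_n(x) = P(M_n ≥ x)` satisfy a
deterministic recursion: `F_{n+1} = step F_n`, where `step` combines averaging over one jump with
the concave function `Phi`, whose slope at `0` is `m`. From then on everything is analysis of the
functions `tail` and their limit `tailLim`, which is the tail of `M`.

Multiply by `exp (γ x)` and tilt the jump law to `Q(dy) = m exp (γ y) μ(dy)`. This is a probability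
measure with mean `c*`, which is positive. Since `Phi t - Phi s ≤ m (t - s)`, differences of
solutions, weighted by `exp (γ x)`, are dominated by averages over a random walk `S` with step law
`Q`. Two comparisons follow: `exp (γ x) P(M_n < x ≤ M) ≤ P(S_n < x)` (`exp_mul_tailLim_sub_le`) and
`exp (γ x) P(M_n ≥ x) ≤ 2 P(S_n ≥ x - K)` (`exp_mul_tail_le`). At `x = c n` the law of large numbers
makes the first bound vanish for `c < c*` and the second for `c > c*`.

To divide by `P(M ≥ x)` one needs `exp (γ x) P(M ≥ x) ≥ ε` for `x ≥ 0`
(`exists_le_exp_mul_tailLim`). This is where `k log k` enters: it makes the deviation of `Phi` from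
linearity integrable along the drift, so that an explicit perturbation of `ε exp (-γ x)` is a
subsolution of the recursion, and every suitable subsolution lies below `tailLim`.

For the existence of `κ`, the function `u(x) = exp (γ x) P(M ≥ x)` is bounded and lies below its
`Q`-average on `(0, ∞)`. Its `backflow` is then nonincreasing there and converges, so the integrals
of `u` over windows of fixed length are Lipschitz and asymptotically harmonic. A limsup argument in
the style of Choquet and Deny gives asymptotic invariance under shifts by the support of `Q`, hence
under all of `ℝ` or, in the lattice case, under the span. The backflow is then asymptotic to a
multiple of the window integral, which therefore converges, and the monotonicity of the tail carries
the convergence over to `u`. -/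

namespace BRW

section Recursion

/-! ### Decomposition of the tree at the root -/

lemma inTree_append_singleton (N : List ℕ → ℕ) (i : ℕ) (v : List ℕ) :
    InTree N (v ++ [i]) ↔ i < N [] ∧ InTree (fun w => N (w ++ [i])) v := by
  induction v with
  | nil => simp [InTree]
  | cons j v ih =>
    simp only [List.cons_append, InTree, ih]
    tauto

lemma position_jumpFirst_append (X : List ℕ → ℝ) (i : ℕ) (v : List ℕ) :
    position .jumpFirst X (v ++ [i]) =
      X [] + position .jumpFirst (fun w => X (w ++ [i])) v := by
  induction v with
  | nil => simp [position]
  | cons j v ih => simp only [List.cons_append, position, ih]; ring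

lemma position_branchFirst_append (X : List ℕ → ℝ) (i : ℕ) (v : List ℕ) :
    position .branchFirst X (v ++ [i]) =
      X [i] + position .branchFirst (fun w => X (w ++ [i])) v := by
  induction v with
  | nil => simp [position]
  | cons j v ih => simp only [List.cons_append, position, ih]; ring

lemma le_maxUpTo_iff_zero (o : Convention) (N : List ℕ → ℕ) (X : List ℕ → ℝ) (x : ℝ) :
    (x : EReal) ≤ maxUpTo o N X 0 ↔ x ≤ 0 := by
  have : maxUpTo o N X 0 = 0 := by
    apply le_antisymm
    · refine iSup₂_le fun v hv => ?_
      have : v = [] := List.length_eq_zero_iff.1 (Nat.le_zero.1 hv.2)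
      subst this
      simp [position]
    · exact le_iSup₂_of_le [] ⟨trivial, le_rfl⟩ (by simp [position])
  rw [this]
  exact_mod_cast Iff.rfl

/-- The jump that moves a child of the root away from the origin. -/
def firstJump (o : Convention) (X : List ℕ → ℝ) (i : ℕ) : ℝ :=
  match o with
  | .jumpFirst => X []
  | .branchFirst => X [i]

lemma position_append (o : Convention) (X : List ℕ → ℝ) (i : ℕ) (v : List ℕ) :
    position o X (v ++ [i]) = firstJump o X i + position o (fun w => X (w ++ [i])) v := by
  cases o
  · exact position_jumpFirst_append X i v
  · exact position_branchFirst_append X i v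

lemma maxUpTo_succ (o : Convention) (N : List ℕ → ℕ) (X : List ℕ → ℝ) (n : ℕ) :
    maxUpTo o N X (n + 1) = max 0 ((Finset.range (N [])).sup fun i =>
      (firstJump o X i : EReal) +
        maxUpTo o (fun w => N (w ++ [i])) (fun w => X (w ++ [i])) n) := by
  apply le_antisymm
  · refine iSup₂_le fun v hv => ?_
    rcases List.eq_nil_or_concat v with rfl | ⟨w, i, rfl⟩
    · simp [position]
    · have h := hv.1
      have hl := hv.2
      rw [List.concat_eq_append] at h hl ⊢
      rw [inTree_append_singleton] at h
      refine le_max_of_le_right ((?_ : _ ≤ _).trans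
        (Finset.le_sup (f := fun i => (firstJump o X i : EReal) +
        maxUpTo o (fun w => N (w ++ [i])) (fun w => X (w ++ [i])) n) (Finset.mem_range.2 h.1)))
      rw [position_append, EReal.coe_add]
      gcongr
      refine le_iSup₂_of_le w ⟨h.2, ?_⟩ le_rfl
      simpa using hl
  · refine max_le (le_iSup₂_of_le [] ⟨trivial, by simp⟩ (by simp [position])) ?_
    refine Finset.sup_le fun i hi => ?_
    -- The jump is finite, so it can be moved across the inequality and the supremum bounded term by
    -- term.
    rw [add_comm, ← EReal.le_sub_iff_add_le (by simp) (by simp)]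
    refine iSup₂_le fun v hv => ?_
    rw [EReal.le_sub_iff_add_le (by simp) (by simp), ← EReal.coe_add, add_comm,
      ← position_append]
    refine le_iSup₂_of_le (v ++ [i]) ⟨?_, ?_⟩ le_rfl
    · rw [inTree_append_singleton]
      exact ⟨Finset.mem_range.1 hi, hv.1⟩
    · simpa using hv.2

/-- The root has finitely many children, so the maximum over their subtrees is attained; without
children it is `⊥`, which no real threshold meets. -/
lemma le_maxUpTo_succ_iff (o : Convention) (N : List ℕ → ℕ) (X : List ℕ → ℝ) (n : ℕ) (x : ℝ) :
    (x : EReal) ≤ maxUpTo o N X (n + 1) ↔ x ≤ 0 ∨ ∃ i < N [],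
      (x : EReal) ≤ (firstJump o X i : EReal) +
        maxUpTo o (fun w => N (w ++ [i])) (fun w => X (w ++ [i])) n := by
  rw [maxUpTo_succ, le_max_iff, Finset.le_sup_iff (EReal.bot_lt_coe x)]
  simp only [Finset.mem_range]
  exact_mod_cast Iff.rfl

lemma le_coe_add_iff (x y : ℝ) (z : EReal) :
    (x : EReal) ≤ (y : EReal) + z ↔ ((x - y : ℝ) : EReal) ≤ z := by
  rw [EReal.coe_sub, EReal.sub_le_iff_le_add (by simp) (by simp), add_comm]

/-! ### Measurability -/

lemma measurable_position {Ω : Type*} [MeasurableSpace Ω] (o : Convention)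
    {X : List ℕ → Ω → ℝ} (hX : ∀ v, Measurable (X v)) (v : List ℕ) :
    Measurable fun ω => position o (fun v => X v ω) v := by
  induction v with
  | nil => simp only [position]; exact measurable_const
  | cons i v ih =>
    cases o
    · simp only [position]; exact ih.add (hX _)
    · simp only [position]; exact ih.add (hX _)

lemma measurableSet_inTree {Ω : Type*} [MeasurableSpace Ω]
    {N : List ℕ → Ω → ℕ} (hN : ∀ v, Measurable (N v)) (v : List ℕ) :
    MeasurableSet {ω | InTree (fun v => N v ω) v} := by
  induction v with
  | nil => simp [InTree]
  | cons i v ih =>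
    simp only [InTree]
    exact (measurableSet_lt measurable_const (hN v)).inter ih

lemma measurable_maxUpTo {Ω : Type*} [MeasurableSpace Ω] (o : Convention)
    {N : List ℕ → Ω → ℕ} {X : List ℕ → Ω → ℝ} (hN : ∀ v, Measurable (N v))
    (hX : ∀ v, Measurable (X v)) (n : ℕ) :
    Measurable fun ω => maxUpTo o (fun v => N v ω) (fun v => X v ω) n := by
  classical
  unfold maxUpTo
  refine Measurable.iSup fun v => ?_
  have : (fun ω => ⨆ (_ : v ∈ {v : List ℕ | InTree (fun v => N v ω) v ∧ v.length ≤ n}),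
      ((position o (fun v => X v ω) v : ℝ) : EReal)) =
      fun ω => if InTree (fun v => N v ω) v ∧ v.length ≤ n then
        ((position o (fun v => X v ω) v : ℝ) : EReal) else ⊥ := by
    ext ω
    split_ifs with h <;> simp [h]
  rw [this]
  refine Measurable.ite ?_ (measurable_position o hX v).coe_real_ereal measurable_const
  exact (measurableSet_inTree hN v).inter (MeasurableSet.const _)

end Recursion

open scoped ENNReal

/-- `Phi p s = 1 - f (1 - s)`, where `f` is the generating function of the offspring law. -/
noncomputable def Phi (p : PMF ℕ) (s : ℝ) : ℝ := ∑' k, (p k).toReal * (1 - (1 - s) ^ k)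

/-! ### Independence of the subtrees, and the probability that some child succeeds. -/

section Independence

/-- Fubini for the product law of `(K, T)` and `η`: with the first σ-algebra frozen, only the
randomness of `η` is integrated out. -/
lemma lintegral_mul_indicator_lt {Ω : Type*} {m₁ m₂ mΩ : MeasurableSpace Ω} {P : Measure Ω}
    [IsProbabilityMeasure P] (h₁ : m₁ ≤ mΩ) (h₂ : m₂ ≤ mΩ)
    (hind : Indep m₁ m₂ P) {K : Ω → ℝ≥0∞} {T : Ω → ℝ} {η : Ω → EReal}
    (hK : Measurable[m₁] K) (hT : Measurable[m₁] T) (hη : Measurable[m₂] η) :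
    ∫⁻ ω, K ω * {ω | η ω < T ω}.indicator 1 ω ∂P =
      ∫⁻ ω, K ω * P {ω' | η ω' < T ω} ∂P := by
  have hZ : Measurable[m₁] fun ω => (K ω, T ω) := hK.prodMk hT
  have hi : IndepFun (fun ω => (K ω, T ω)) η P :=
    (IndepFun_iff_Indep _ _ _).2
      (indep_of_indep_of_le_left (indep_of_indep_of_le_right hind hη.comap_le) hZ.comap_le)
  have hZ' := hZ.mono h₁ le_rfl
  have hη' := hη.mono h₂ le_rfl
  have hprod := (indepFun_iff_map_prod_eq_prod_map_map hZ'.aemeasurable hη'.aemeasurable).1 hi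
  have hs : MeasurableSet {q : (ℝ≥0∞ × ℝ) × EReal | q.2 < (q.1.2 : EReal)} :=
    measurableSet_lt measurable_snd (measurable_snd.comp measurable_fst).coe_real_ereal
  have hF : Measurable fun q : (ℝ≥0∞ × ℝ) × EReal =>
      q.1.1 * {q : (ℝ≥0∞ × ℝ) × EReal | q.2 < (q.1.2 : EReal)}.indicator 1 q :=
    (measurable_fst.comp measurable_fst).mul (measurable_one.indicator hs)
  have e1 : ∫⁻ ω, K ω * {ω | η ω < T ω}.indicator 1 ω ∂P =
      ∫⁻ q, q.1.1 * {q : (ℝ≥0∞ × ℝ) × EReal | q.2 < (q.1.2 : EReal)}.indicator 1 q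
        ∂(P.map fun ω => ((K ω, T ω), η ω)) := by
    rw [lintegral_map hF (hZ'.prodMk hη')]
    rfl
  rw [e1, hprod]
  have : IsProbabilityMeasure (P.map η) := Measure.isProbabilityMeasure_map hη'.aemeasurable
  rw [lintegral_prod _ hF.aemeasurable, lintegral_map hF.lintegral_prod_right' hZ']
  refine lintegral_congr fun ω => ?_
  have hs' : MeasurableSet {e : EReal | e < (T ω : EReal)} := measurableSet_Iio
  have : ∀ e : EReal, {q : (ℝ≥0∞ × ℝ) × EReal | q.2 < (q.1.2 : EReal)}.indicator
      (1 : (ℝ≥0∞ × ℝ) × EReal → ℝ≥0∞) ((K ω, T ω), e) = {e : EReal | e < (T ω : EReal)}.indicator 1 e := by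
    intro e; simp [Set.indicator]
  simp_rw [this]
  rw [lintegral_const_mul _ (measurable_one.indicator hs'), lintegral_indicator_one hs', Measure.map_apply hη' hs']
  rfl

variable {Ω : Type*} [mΩ : MeasurableSpace Ω] {P : Measure Ω} {p : PMF ℕ} {μ : Measure ℝ}
  {N : List ℕ → Ω → ℕ} {X : List ℕ → Ω → ℝ}

lemma IsReproduction.subtree (h : IsReproduction P p μ N X) (i : ℕ) :
    IsReproduction P p μ (fun w => N (w ++ [i])) (fun w => X (w ++ [i])) where
  measurable_offspring _ := h.measurable_offspring _
  measurable_jump _ := h.measurable_jump _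
  law_offspring _ := h.law_offspring _
  law_jump _ := h.law_jump _
  indep_pair _ := h.indep_pair _
  indep_particles := h.indep_particles.precomp (g := fun w => w ++ [i])
    (List.append_left_injective [i])

/-- The information carried by the particles in a set of words. -/
@[reducible] def sigmaOf (N : List ℕ → Ω → ℕ) (X : List ℕ → Ω → ℝ) (S : Set (List ℕ)) :
    MeasurableSpace Ω :=
  ⨆ v ∈ S, MeasurableSpace.comap (fun ω => (N v ω, X v ω)) inferInstance

lemma IsReproduction.sigmaOf_le (h : IsReproduction P p μ N X) (S : Set (List ℕ)) :
    sigmaOf N X S ≤ mΩ :=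
  iSup₂_le fun v _ => ((h.measurable_offspring v).prodMk (h.measurable_jump v)).comap_le

lemma sigmaOf_mono {Ω : Type*} {N : List ℕ → Ω → ℕ} {X : List ℕ → Ω → ℝ} {S T : Set (List ℕ)} (hST : S ⊆ T) : sigmaOf N X S ≤ sigmaOf N X T :=
  biSup_mono hST

lemma measurable_pair_sigmaOf {Ω : Type*} {N : List ℕ → Ω → ℕ} {X : List ℕ → Ω → ℝ} {S : Set (List ℕ)} {v : List ℕ} (hv : v ∈ S) :
    Measurable[sigmaOf N X S] fun ω => (N v ω, X v ω) :=
  (comap_measurable _).mono (le_iSup₂ (f := fun v (_ : v ∈ S) =>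
    MeasurableSpace.comap (fun ω => (N v ω, X v ω)) inferInstance) v hv) le_rfl

lemma IsReproduction.indep_sigmaOf (h : IsReproduction P p μ N X) {S T : Set (List ℕ)}
    (hST : Disjoint S T) : Indep (sigmaOf N X S) (sigmaOf N X T) P :=
  indep_iSup_of_disjoint
    (fun v => ((h.measurable_offspring v).prodMk (h.measurable_jump v)).comap_le)
    ((iIndepFun_iff_iIndep _ _ _).1 h.indep_particles) hST

/-- The words of the descendants of the child `i` of the root. -/
def branch (i : ℕ) : Set (List ℕ) := Set.range fun w : List ℕ => w ++ [i]

lemma disjoint_branch {i j : ℕ} (hij : i ≠ j) : Disjoint (branch i) (branch j) := by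
  rw [Set.disjoint_left]
  rintro _ ⟨w, rfl⟩ ⟨w', h⟩
  exact hij (by simpa using (List.append_inj_right' h rfl).symm)

lemma nil_notMem_branch (i : ℕ) : [] ∉ branch i := by
  rintro ⟨w, h⟩
  simp at h

/-- The subtrees are integrated out one at a time, each being independent of the root and of the
earlier subtrees. The weight `H` is arbitrary so that the factor produced by each integration can be
absorbed into it. -/
lemma IsReproduction.lintegral_prod_children [IsProbabilityMeasure P]
    (h : IsReproduction P p μ N X)
    {η : ℕ → Ω → EReal} (hη : ∀ i, Measurable[sigmaOf N X (branch i)] (η i))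
    {g : ℝ → ℝ≥0∞} (hgm : Measurable g)
    (hg : ∀ i y, P {ω | η i ω < ((y : ℝ) : EReal)} = g y)
    {T : ℝ → ℝ} (hT : Measurable T) (j : ℕ) :
    ∀ {H : ℕ × ℝ → ℝ≥0∞}, Measurable H →
      ∫⁻ ω, H (N [] ω, X [] ω) *
        {ω | ∀ i < j, η i ω < (T (X [] ω) : EReal)}.indicator 1 ω ∂P =
      ∫⁻ ω, H (N [] ω, X [] ω) * g (T (X [] ω)) ^ j ∂P := by
  induction j with
  | zero => intro H _; simp
  | succ j ih =>
    intro H hH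
    set S : Set (List ℕ) := {[]} ∪ ⋃ i < j, branch i with hS
    have hdis : Disjoint S (branch j) := by
      rw [hS, Set.disjoint_union_left]
      refine ⟨Set.disjoint_singleton_left.2 (nil_notMem_branch j), ?_⟩
      simp only [Set.disjoint_iUnion_left]
      exact fun i hi => disjoint_branch hi.ne
    have hroot : Measurable[sigmaOf N X S] fun ω => (N [] ω, X [] ω) :=
      measurable_pair_sigmaOf (Or.inl rfl)
    have hTroot : Measurable[sigmaOf N X S] fun ω => T (X [] ω) :=
      (hT.comp measurable_snd).comp hroot
    have hset : MeasurableSet[sigmaOf N X S] {ω | ∀ i < j, η i ω < (T (X [] ω) : EReal)} := by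
      have : {ω | ∀ i < j, η i ω < (T (X [] ω) : EReal)} =
          ⋂ i, ⋂ (_ : i < j), {ω | η i ω < (T (X [] ω) : EReal)} := by ext; simp
      rw [this]
      refine MeasurableSet.iInter fun i => MeasurableSet.iInter fun hi => ?_
      refine measurableSet_lt (mδ := sigmaOf N X S) ?_ ?_
      · refine (hη i).mono (sigmaOf_mono ?_) le_rfl
        refine Set.Subset.trans ?_ Set.subset_union_right
        exact Set.subset_iUnion₂ (s := fun i (_ : i < j) => branch i) i hi
      · exact measurable_coe_real_ereal.comp hTroot
    have hK : Measurable[sigmaOf N X S] fun ω => H (N [] ω, X [] ω) *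
        {ω | ∀ i < j, η i ω < (T (X [] ω) : EReal)}.indicator 1 ω := by
      refine Measurable.mul (m := sigmaOf N X S) (hH.comp hroot) ?_
      exact Measurable.indicator (@measurable_const _ _ _ (sigmaOf N X S) _) hset
    have key := lintegral_mul_indicator_lt (h.sigmaOf_le S) (h.sigmaOf_le (branch j))
      (h.indep_sigmaOf hdis) hK hTroot (hη j)
    have e1 : ∀ ω, H (N [] ω, X [] ω) *
        {ω | ∀ i < j + 1, η i ω < (T (X [] ω) : EReal)}.indicator 1 ω =
        H (N [] ω, X [] ω) * {ω | ∀ i < j, η i ω < (T (X [] ω) : EReal)}.indicator 1 ω *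
          {ω | η j ω < (T (X [] ω) : EReal)}.indicator 1 ω := by
      intro ω
      rw [mul_assoc]
      congr 1
      have : {ω | ∀ i < j + 1, η i ω < (T (X [] ω) : EReal)} =
        {ω | ∀ i < j, η i ω < (T (X [] ω) : EReal)} ∩ {ω | η j ω < (T (X [] ω) : EReal)} := by
        ext ω
        simp only [Set.mem_ofPred_eq, Set.mem_inter_iff]
        exact Nat.forall_lt_succ_right
      rw [this, Set.inter_indicator_one]
      rfl
    simp_rw [e1]
    rw [key]
    -- The factor from subtree `j` depends on the root only, so it joins the weight.
    have := ih (H := fun q => H q * g (T q.2))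
      (hH.mul (hgm.comp (hT.comp measurable_snd)))
    simp only [hg]
    calc _ = ∫⁻ ω, H (N [] ω, X [] ω) * g (T (X [] ω)) *
        {ω | ∀ i < j, η i ω < (T (X [] ω) : EReal)}.indicator 1 ω ∂P :=
          lintegral_congr fun ω => by ring
      _ = _ := this
      _ = _ := lintegral_congr fun ω => by ring

lemma toReal_summable (p : PMF ℕ) : Summable fun k => (p k).toReal :=
  ENNReal.summable_toReal p.tsum_coe_ne_top

lemma tsum_toReal (p : PMF ℕ) : ∑' k, (p k).toReal = 1 := by
  rw [← ENNReal.tsum_toReal_eq (fun k => p.apply_ne_top k), p.tsum_coe, ENNReal.toReal_one]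

lemma summable_mul_pow (p : PMF ℕ) {s : ℝ} (h0 : 0 ≤ s) (h1 : s ≤ 1) :
    Summable fun k => (p k).toReal * s ^ k :=
  Summable.of_nonneg_of_le (fun k => by positivity)
    (fun k => mul_le_of_le_one_right ENNReal.toReal_nonneg (pow_le_one₀ h0 h1))
    (toReal_summable p)

lemma Phi_eq (p : PMF ℕ) {s : ℝ} (h0 : 0 ≤ s) (h1 : s ≤ 1) :
    Phi p s = 1 - ∑' k, (p k).toReal * (1 - s) ^ k := by
  have h := (toReal_summable p).tsum_sub
    (summable_mul_pow p (s := 1 - s) (by linarith) (by linarith))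
  rw [tsum_toReal p] at h
  rw [← h]
  exact tsum_congr fun k => by ring

/-- The probability that the root jumps into `A`, or has a child whose value `η` exceeds a
threshold depending on the jump of the root. -/
lemma IsReproduction.prob_root_or_child [IsProbabilityMeasure P]
    [IsProbabilityMeasure μ] (h : IsReproduction P p μ N X)
    {η : ℕ → Ω → EReal} (hη : ∀ i, Measurable[sigmaOf N X (branch i)] (η i))
    {G : ℝ → ℝ} (hG : ∀ i y, P.real {ω | ((y : ℝ) : EReal) ≤ η i ω} = G y)
    {T : ℝ → ℝ} (hT : Measurable T) {A : Set ℝ} (hA : MeasurableSet A) :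
    P.real {ω | X [] ω ∈ A ∨ ∃ i < N [] ω, (T (X [] ω) : EReal) ≤ η i ω} =
      ∫ y, (open Classical in if y ∈ A then 1 else Phi p (G (T y))) ∂μ := by
  classical
  have hηm : ∀ i, Measurable (η i) := fun i => (hη i).mono (h.sigmaOf_le _) le_rfl
  have hNm := h.measurable_offspring []
  have hXm := h.measurable_jump []
  have hG0 : ∀ y, 0 ≤ G y := fun y => by rw [← hG 0]; exact measureReal_nonneg
  have hG1 : ∀ y, G y ≤ 1 := fun y => by rw [← hG 0]; exact measureReal_le_one
  have hGanti : Antitone G := by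
    intro a b hab
    rw [← hG 0 a, ← hG 0 b]
    refine measureReal_mono fun ω hω => ?_
    exact (EReal.coe_le_coe_iff.2 hab).trans hω
  have hGm := hGanti.measurable
  set g : ℝ → ℝ≥0∞ := fun y => ENNReal.ofReal (1 - G y) with hgdef
  have hgm : Measurable g := (measurable_const.sub hGm).ennreal_ofReal
  have hg : ∀ i y, P {ω | η i ω < ((y : ℝ) : EReal)} = g y := by
    intro i y
    have hc : {ω | η i ω < ((y : ℝ) : EReal)} = {ω | ((y : ℝ) : EReal) ≤ η i ω}ᶜ := by
      ext; simp
    have hms : MeasurableSet {ω | ((y : ℝ) : EReal) ≤ η i ω} :=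
      measurableSet_le measurable_const (hηm i)
    simp only [hgdef]
    rw [hc, ← hG i y, ← probReal_compl_eq_one_sub hms, ofReal_measureReal]
  have hBm : ∀ i, MeasurableSet {ω | (T (X [] ω) : EReal) ≤ η i ω} := fun i =>
    measurableSet_le (hT.comp hXm).coe_real_ereal (hηm i)
  set E : Set Ω := {ω | X [] ω ∈ A ∨ ∃ i < N [] ω, (T (X [] ω) : EReal) ≤ η i ω} with hE
  -- The failure event is split by the number `k` of children; each piece contributes `p k` times
  -- the integral over `Aᶜ` of a `k`-th power, and summing over `k` yields the generating function.
  let D : ℕ → Set Ω := fun k => {ω | N [] ω = k ∧ X [] ω ∉ A} ∩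
    {ω | ∀ i < k, η i ω < (T (X [] ω) : EReal)}
  have hEc : Eᶜ = ⋃ k, D k := by
    ext ω
    simp only [hE, D, Set.mem_compl_iff, Set.mem_ofPred_eq, Set.mem_iUnion, Set.mem_inter_iff,
      not_or, not_exists, not_and, not_le]
    constructor
    · rintro ⟨h1, h2⟩
      exact ⟨_, ⟨rfl, h1⟩, h2⟩
    · rintro ⟨k, ⟨rfl, h1⟩, h2⟩
      exact ⟨h1, h2⟩
  have hJm : ∀ k, MeasurableSet {ω | ∀ i < k, η i ω < (T (X [] ω) : EReal)} := by
    intro k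
    have : {ω | ∀ i < k, η i ω < (T (X [] ω) : EReal)} =
        ⋂ i, ⋂ (_ : i < k), {ω | (T (X [] ω) : EReal) ≤ η i ω}ᶜ := by ext; simp
    rw [this]
    exact MeasurableSet.iInter fun i => MeasurableSet.iInter fun _ => (hBm i).compl
  have hRm : ∀ k, MeasurableSet {ω | N [] ω = k ∧ X [] ω ∉ A} := fun k =>
    (hNm (measurableSet_singleton k)).inter (hXm hA.compl)
  have hDm : ∀ k, MeasurableSet (D k) := fun k => (hRm k).inter (hJm k)
  have hEm : MeasurableSet E := by
    rw [← compl_compl E, hEc]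
    exact (MeasurableSet.iUnion hDm).compl
  have hDk : ∀ k, P (D k) = p k * ∫⁻ y, Aᶜ.indicator (fun y => g (T y) ^ k) y ∂μ := by
    intro k
    have hHm : Measurable fun q : ℕ × ℝ => ({k} ×ˢ Aᶜ : Set (ℕ × ℝ)).indicator
        (1 : ℕ × ℝ → ℝ≥0∞) q :=
      measurable_one.indicator ((measurableSet_singleton k).prod hA.compl)
    have h1 := h.lintegral_prod_children hη hgm hg hT k hHm
    have e1 : P (D k) = ∫⁻ ω, ({k} ×ˢ Aᶜ : Set (ℕ × ℝ)).indicator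
        (1 : ℕ × ℝ → ℝ≥0∞) (N [] ω, X [] ω) *
        {ω | ∀ i < k, η i ω < (T (X [] ω) : EReal)}.indicator 1 ω ∂P := by
      rw [← lintegral_indicator_one (hDm k)]
      refine lintegral_congr fun ω => ?_
      simp only [D, Set.inter_indicator_one]
      rfl
    have hgk : Measurable fun y => Aᶜ.indicator (fun y => g (T y) ^ k) y :=
      ((hgm.comp hT).pow_const k).indicator hA.compl
    have e2 : ∀ ω, ({k} ×ˢ Aᶜ : Set (ℕ × ℝ)).indicator
        (1 : ℕ × ℝ → ℝ≥0∞) (N [] ω, X [] ω) * g (T (X [] ω)) ^ k =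
        (((({k} : Set ℕ).indicator (1 : ℕ → ℝ≥0∞)) ∘ N []) *
          ((fun y => Aᶜ.indicator (fun y => g (T y) ^ k) y) ∘ X [])) ω := by
      intro ω
      simp only [Set.indicator, Pi.mul_apply, Function.comp, Set.mem_prod]
      by_cases h1 : N [] ω ∈ ({k} : Set ℕ) <;> by_cases h2 : X [] ω ∈ Aᶜ <;> simp [h1, h2]
    have hkm : Measurable (({k} : Set ℕ).indicator (1 : ℕ → ℝ≥0∞)) :=
      measurable_one.indicator (measurableSet_singleton k)
    rw [e1, h1]
    simp_rw [e2]
    rw [lintegral_mul_eq_lintegral_mul_lintegral_of_indepFun (hkm.comp hNm) (hgk.comp hXm)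
      ((h.indep_pair []).comp hkm hgk)]
    congr 1
    · have : ∫⁻ ω, ((({k} : Set ℕ).indicator (1 : ℕ → ℝ≥0∞)) ∘ N []) ω ∂P =
          ∫⁻ a, ({k} : Set ℕ).indicator (1 : ℕ → ℝ≥0∞) a ∂(P.map (N [])) :=
        (lintegral_map hkm hNm).symm
      rw [this, h.law_offspring, lintegral_indicator_one (measurableSet_singleton k),
        PMF.toMeasure_apply_singleton _ _ (measurableSet_singleton k)]
    · rw [← h.law_jump [], lintegral_map hgk hXm]
      rfl
  have hdisj : Pairwise (Function.onFun Disjoint D) := by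
    intro a b hab
    rw [Function.onFun, Set.disjoint_left]
    rintro ω ⟨⟨h1, -⟩, -⟩ ⟨⟨h2, -⟩, -⟩
    exact hab (h1.symm.trans h2)
  have hgT : Measurable fun y => g (T y) := hgm.comp hT
  have hsumm : Measurable fun y => Aᶜ.indicator (fun y => ∑' k, p k * g (T y) ^ k) y :=
    (Measurable.tsum fun k => (hgT.pow_const k).const_mul (p k)).indicator hA.compl
  have hPE : P Eᶜ = ∫⁻ y, Aᶜ.indicator (fun y => ∑' k, p k * g (T y) ^ k) y ∂μ := by
    rw [hEc, measure_iUnion hdisj hDm]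
    simp_rw [hDk]
    simp_rw [← lintegral_const_mul _ (((hgT.pow_const _).indicator hA.compl))]
    rw [← lintegral_tsum fun k =>
      (((hgT.pow_const k).indicator hA.compl).const_mul (p k)).aemeasurable]
    refine lintegral_congr fun y => ?_
    by_cases hy : y ∈ Aᶜ <;> simp [hy]
  have hpt : ∀ y, (Aᶜ.indicator (fun y => ∑' k, p k * g (T y) ^ k) y).toReal =
      1 - (if y ∈ A then 1 else Phi p (G (T y))) := by
    intro y
    by_cases hy : y ∈ A
    · simp [hy]
    · rw [if_neg hy, Set.indicator_of_mem (Set.mem_compl hy), Phi_eq p (hG0 _) (hG1 _),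
        sub_sub_cancel, ENNReal.tsum_toReal_eq]
      · refine tsum_congr fun k => ?_
        rw [ENNReal.toReal_mul, ENNReal.toReal_pow, hgdef,
          ENNReal.toReal_ofReal (sub_nonneg.2 (hG1 _))]
      · intro k
        exact ENNReal.mul_ne_top (p.apply_ne_top k) (ENNReal.pow_ne_top ENNReal.ofReal_ne_top)
  have hle1 : ∀ y, Aᶜ.indicator (fun y => ∑' k, p k * g (T y) ^ k) y ≤ 1 := by
    intro y
    refine Set.indicator_apply_le' (fun _ => ?_) (fun _ => zero_le_one)
    rw [← p.tsum_coe]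
    refine ENNReal.tsum_le_tsum fun k => mul_le_of_le_one_right' (pow_le_one' ?_ k)
    rw [hgdef]
    exact ENNReal.ofReal_le_one.2 (by linarith [hG0 (T y)])
  have hreal : P.real Eᶜ = ∫ y, (1 - (if y ∈ A then 1 else Phi p (G (T y)))) ∂μ := by
    rw [measureReal_def, hPE, ← integral_toReal hsumm.aemeasurable]
    · exact integral_congr_ae (ae_of_all _ hpt)
    · exact ae_of_all _ fun y => (hle1 y).trans_lt ENNReal.one_lt_top
  have hint : Integrable (fun y => 1 - (if y ∈ A then 1 else Phi p (G (T y)))) μ := by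
    simp_rw [← hpt]
    refine integrable_toReal_of_lintegral_ne_top hsumm.aemeasurable ?_
    rw [← hPE]
    exact measure_ne_top _ _
  have : P.real E = 1 - P.real Eᶜ := by
    rw [probReal_compl_eq_one_sub hEm]; ring
  rw [this, hreal]
  have h2 := integral_sub (integrable_const (1 : ℝ)) hint
  simp only [sub_sub_cancel, integral_const, probReal_univ, smul_eq_mul, mul_one] at h2
  rw [h2]

end Independence

/-- The recursion satisfied by the tails of `M_n`. -/
noncomputable def step (o : Convention) (p : PMF ℕ) (μ : Measure ℝ) (F : ℝ → ℝ) (x : ℝ) : ℝ :=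
  if x ≤ 0 then 1 else
    match o with
    | .jumpFirst => ∫ y, Phi p (F (x - y)) ∂μ
    | .branchFirst => Phi p (∫ y, F (x - y) ∂μ)

/-- The function `x ↦ P(M_n ≥ x)`, defined through its recursion. -/
noncomputable def tail (o : Convention) (p : PMF ℕ) (μ : Measure ℝ) : ℕ → ℝ → ℝ
  | 0 => fun x => if x ≤ 0 then 1 else 0
  | n + 1 => step o p μ (tail o p μ n)

/-! ### The recursion `tail` describes the law of `M_n`, and its limit the law of `M`. -/

section TailLaw

variable {Ω : Type*} [mΩ : MeasurableSpace Ω] {P : Measure Ω} {p : PMF ℕ} {μ : Measure ℝ}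
  {N : List ℕ → Ω → ℕ} {X : List ℕ → Ω → ℝ}

lemma measurable_maxUpTo_branch {Ω : Type*} {N : List ℕ → Ω → ℕ} {X : List ℕ → Ω → ℝ} 
    (o : Convention) (n i : ℕ) :
    Measurable[sigmaOf N X (branch i)] fun ω =>
      maxUpTo o (fun w => N (w ++ [i]) ω) (fun w => X (w ++ [i]) ω) n := by
  have hpair : ∀ w : List ℕ, Measurable[sigmaOf N X (branch i)]
      fun ω => (N (w ++ [i]) ω, X (w ++ [i]) ω) := fun w =>
    measurable_pair_sigmaOf ⟨w, rfl⟩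
  exact @measurable_maxUpTo Ω (sigmaOf N X (branch i)) o (fun w => N (w ++ [i]))
    (fun w => X (w ++ [i])) (fun w => measurable_fst.comp (hpair w))
    (fun w => measurable_snd.comp (hpair w)) n

lemma prob_eventUpTo_jumpFirst [IsProbabilityMeasure P] [IsProbabilityMeasure μ] (n : ℕ) :
    ∀ {N : List ℕ → Ω → ℕ} {X : List ℕ → Ω → ℝ}, IsReproduction P p μ N X → ∀ x : ℝ,
      P.real (eventUpTo .jumpFirst N X n x) = tail .jumpFirst p μ n x := by
  induction n with
  | zero =>
    intro N X h x
    simp only [eventUpTo, le_maxUpTo_iff_zero, tail]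
    split_ifs with hx <;> simp [hx]
  | succ n ih =>
    intro N X h x
    simp only [eventUpTo, le_maxUpTo_succ_iff, tail, step]
    split_ifs with hx
    · simp [hx]
    · have key := h.prob_root_or_child
        (η := fun i ω => maxUpTo .jumpFirst (fun w => N (w ++ [i]) ω) (fun w => X (w ++ [i]) ω) n)
        (measurable_maxUpTo_branch .jumpFirst n) (G := tail .jumpFirst p μ n)
        (fun i y => ih (h.subtree i) y) (T := fun y => x - y)
        (measurable_const.sub measurable_id) (A := ∅) MeasurableSet.empty
      simp only [Set.mem_empty_iff_false, false_or, if_false] at key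
      rw [← key]
      simp only [hx, false_or, firstJump, le_coe_add_iff]

/-- In the branch-first form the first displacement of a child belongs to the child's own subtree,
so the quantity that reproduces itself is the jump plus the maximum. The set `A` of the root lemma
accounts for a jump that passes `x` by itself. -/
lemma prob_jump_add_maxUpTo [IsProbabilityMeasure P] [IsProbabilityMeasure μ] (n : ℕ) :
    ∀ {N : List ℕ → Ω → ℕ} {X : List ℕ → Ω → ℝ}, IsReproduction P p μ N X → ∀ x : ℝ,
      P.real {ω | (x : EReal) ≤ (X [] ω : EReal) +
        maxUpTo .branchFirst (fun v => N v ω) (fun v => X v ω) n} =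
      ∫ y, tail .branchFirst p μ n (x - y) ∂μ := by
  induction n with
  | zero =>
    intro N X h x
    simp only [le_coe_add_iff, le_maxUpTo_iff_zero, tail]
    have h1 : MeasurableSet {y : ℝ | x - y ≤ 0} :=
      measurableSet_le (measurable_const.sub measurable_id) measurable_const
    have h2 : ∀ y : ℝ, (if x - y ≤ 0 then (1 : ℝ) else 0) =
      {y : ℝ | x - y ≤ 0}.indicator 1 y := by intro y; simp [Set.indicator]
    simp_rw [h2]
    rw [integral_indicator_one h1, ← h.law_jump [], map_measureReal_apply
      (h.measurable_jump []) h1]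
    rfl
  | succ n ih =>
    intro N X h x
    have hA : MeasurableSet {y : ℝ | x - y ≤ 0} :=
      measurableSet_le (measurable_const.sub measurable_id) measurable_const
    have hη : ∀ i, Measurable[sigmaOf N X (branch i)] fun ω => (X [i] ω : EReal) +
        maxUpTo .branchFirst (fun w => N (w ++ [i]) ω) (fun w => X (w ++ [i]) ω) n := by
      intro i
      have h1 := measurable_pair_sigmaOf (N := N) (X := X) (S := branch i) (v := [i]) ⟨[], rfl⟩
      exact Measurable.add (m := sigmaOf N X (branch i))
        (measurable_coe_real_ereal.comp (measurable_snd.comp h1))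
        (measurable_maxUpTo_branch .branchFirst n i)
    have key := h.prob_root_or_child hη (G := fun x => ∫ y, tail .branchFirst p μ n (x - y) ∂μ)
      (fun i y => ih (h.subtree i) y) (T := fun y => x - y)
      (measurable_const.sub measurable_id) hA
    simp only [le_coe_add_iff, le_maxUpTo_succ_iff, firstJump, tail, step]
    simp only [le_coe_add_iff] at key
    exact key

lemma prob_eventUpTo_branchFirst [IsProbabilityMeasure P] [IsProbabilityMeasure μ] (n : ℕ)
    (h : IsReproduction P p μ N X) (x : ℝ) :
    P.real (eventUpTo .branchFirst N X n x) = tail .branchFirst p μ n x := by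
  cases n with
  | zero =>
    simp only [eventUpTo, le_maxUpTo_iff_zero, tail]
    split_ifs with hx <;> simp [hx]
  | succ n =>
    simp only [eventUpTo, le_maxUpTo_succ_iff, tail, step]
    split_ifs with hx
    · simp [hx]
    · have hη : ∀ i, Measurable[sigmaOf N X (branch i)] fun ω => (X [i] ω : EReal) +
          maxUpTo .branchFirst (fun w => N (w ++ [i]) ω) (fun w => X (w ++ [i]) ω) n := by
        intro i
        have h1 := measurable_pair_sigmaOf (N := N) (X := X) (S := branch i) (v := [i]) ⟨[], rfl⟩
        exact Measurable.add (m := sigmaOf N X (branch i))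
          (measurable_coe_real_ereal.comp (measurable_snd.comp h1))
          (measurable_maxUpTo_branch .branchFirst n i)
      have key := h.prob_root_or_child hη
        (G := fun x => ∫ y, tail .branchFirst p μ n (x - y) ∂μ)
        (fun i y => prob_jump_add_maxUpTo n (h.subtree i) y) (T := fun _ => x)
        measurable_const (A := ∅) MeasurableSet.empty
      simp only [Set.mem_empty_iff_false, false_or, if_false, integral_const, probReal_univ,
        smul_eq_mul, one_mul] at key
      simp only [hx, false_or, firstJump]
      exact key

/-- The function `tail` is the tail of the law of `M_n`. -/
theorem prob_eventUpTo [IsProbabilityMeasure P] [IsProbabilityMeasure μ]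
    (h : IsReproduction P p μ N X) (o : Convention) (n : ℕ) (x : ℝ) :
    P.real (eventUpTo o N X n x) = tail o p μ n x := by
  cases o
  · exact prob_eventUpTo_jumpFirst n h x
  · exact prob_eventUpTo_branchFirst n h x

lemma measurableSet_eventUpTo (h : IsReproduction P p μ N X) (o : Convention) (n : ℕ) (x : ℝ) :
    MeasurableSet (eventUpTo o N X n x) :=
  measurableSet_le measurable_const
    (measurable_maxUpTo o h.measurable_offspring h.measurable_jump n)

lemma measurableSet_eventAll (h : IsReproduction P p μ N X) (o : Convention) (x : ℝ) :
    MeasurableSet (eventAll o N X x) :=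
  measurableSet_le measurable_const
    (Measurable.iSup fun n => measurable_maxUpTo o h.measurable_offspring h.measurable_jump n)

lemma tendsto_sub_one_div (x : ℝ) :
    Tendsto (fun k : ℕ => x - 1 / ((k : ℝ) + 1)) atTop (𝓝 x) := by
  simpa using (tendsto_const_nhds (x := x)).sub (tendsto_one_div_add_atTop_nhds_zero_nat (𝕜 := ℝ))

lemma maxUpTo_mono (o : Convention) (N : List ℕ → ℕ) (X : List ℕ → ℝ) :
    Monotone (maxUpTo o N X) := by
  intro a b hab
  exact biSup_mono fun v hv => ⟨hv.1, hv.2.trans hab⟩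

lemma eventUpTo_mono {Ω : Type*} (o : Convention) (N : List ℕ → Ω → ℕ) (X : List ℕ → Ω → ℝ) (x : ℝ) :
    Monotone fun n => eventUpTo o N X n x := by
  intro a b hab ω hω
  exact le_trans (α := EReal) hω (maxUpTo_mono o _ _ hab)

lemma eventUpTo_anti {Ω : Type*} (o : Convention) (N : List ℕ → Ω → ℕ) (X : List ℕ → Ω → ℝ) (n : ℕ) :
    Antitone fun x => eventUpTo o N X n x := by
  intro a b hab ω hω
  exact le_trans (α := EReal) (EReal.coe_le_coe_iff.2 hab) hω

lemma eventUpTo_subset_eventAll {Ω : Type*} (o : Convention) (N : List ℕ → Ω → ℕ) (X : List ℕ → Ω → ℝ)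
    (n : ℕ) (x : ℝ) : eventUpTo o N X n x ⊆ eventAll o N X x := by
  intro ω hω
  exact le_trans (α := EReal) hω (le_iSup (fun n => maxUpTo o _ _ n) n)

/-- The supremum defining `M` may fail to be attained, so `M ≥ x` has to be approached through
thresholds strictly below `x`. This is why left-continuity of the limiting tail is needed
afterwards. -/
lemma eventAll_eq_iInter {Ω : Type*} (o : Convention) (N : List ℕ → Ω → ℕ) (X : List ℕ → Ω → ℝ) (x : ℝ) :
    eventAll o N X x = ⋂ k : ℕ, ⋃ n : ℕ, eventUpTo o N X n (x - 1 / ((k : ℝ) + 1)) := by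
  ext ω
  simp only [eventAll, eventUpTo, Set.mem_iInter, Set.mem_iUnion, Set.mem_ofPred_eq]
  constructor
  · intro h k
    have hlt : ((x - 1 / ((k : ℝ) + 1) : ℝ) : EReal) <
        maxAll o (fun v => N v ω) (fun v => X v ω) := by
      refine lt_of_lt_of_le (EReal.coe_lt_coe_iff.2 ?_) h
      have : 0 < 1 / ((k : ℝ) + 1) := by positivity
      linarith
    obtain ⟨n, hn⟩ := lt_iSup_iff.1 hlt
    exact ⟨n, hn.le⟩
  · intro h
    have hk : ∀ k : ℕ, ((x - 1 / ((k : ℝ) + 1) : ℝ) : EReal) ≤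
        maxAll o (fun v => N v ω) (fun v => X v ω) := fun k => by
      obtain ⟨n, hn⟩ := h k
      exact hn.trans (le_iSup (fun n => maxUpTo o _ _ n) n)
    refine le_of_tendsto' (x := atTop)
      (f := fun k : ℕ => ((x - 1 / ((k : ℝ) + 1) : ℝ) : EReal)) ?_ hk
    exact (continuous_coe_real_ereal.tendsto x).comp (tendsto_sub_one_div x)

/-- If the tails of `M_n` converge to a left-continuous function, then that function is the tail
of `M`. -/
theorem prob_eventAll [IsProbabilityMeasure P] [IsProbabilityMeasure μ]
    (h : IsReproduction P p μ N X) (o : Convention) {F : ℝ → ℝ}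
    (hF : ∀ x, Tendsto (fun n => tail o p μ n x) atTop (𝓝 (F x))) {x : ℝ}
    (hx : Tendsto F (𝓝[<] x) (𝓝 (F x))) :
    P.real (eventAll o N X x) = F x := by
  have hU : ∀ y, P.real (⋃ n, eventUpTo o N X n y) = F y := by
    intro y
    have h1 := tendsto_measure_iUnion_atTop (μ := P) (eventUpTo_mono o N X y)
    have h2 := (ENNReal.tendsto_toReal (measure_ne_top P _)).comp h1
    refine tendsto_nhds_unique h2 ?_
    refine (hF y).congr fun n => ?_
    rw [← prob_eventUpTo h o n y]
    rfl
  have hanti : Antitone fun k : ℕ => ⋃ n : ℕ, eventUpTo o N X n (x - 1 / ((k : ℝ) + 1)) := by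
    intro a b hab
    refine Set.iUnion_mono fun n => eventUpTo_anti o N X n ?_
    have : 1 / ((b : ℝ) + 1) ≤ 1 / ((a : ℝ) + 1) := by gcongr
    linarith
  have h1 := tendsto_measure_iInter_atTop (μ := P)
    (fun k : ℕ => (MeasurableSet.iUnion fun n => measurableSet_eventUpTo h o n
      (x - 1 / ((k : ℝ) + 1))).nullMeasurableSet) hanti ⟨0, measure_ne_top P _⟩
  have h2 := (ENNReal.tendsto_toReal (measure_ne_top P _)).comp h1
  rw [← eventAll_eq_iInter] at h2
  refine tendsto_nhds_unique h2 ?_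
  have h3 : Tendsto (fun k : ℕ => x - 1 / ((k : ℝ) + 1)) atTop (𝓝[<] x) := by
    refine tendsto_nhdsWithin_iff.2 ⟨tendsto_sub_one_div x, Eventually.of_forall fun k => ?_⟩
    have : 0 < 1 / ((k : ℝ) + 1) := by positivity
    simp only [Set.mem_Iio]
    linarith
  refine (hx.comp h3).congr fun k => ?_
  rw [Function.comp, ← hU]
  rfl

end TailLaw

/-! ### Monotonicity, Lipschitz bound and near-linearity of `Phi`. -/

section PhiProperties

variable {p : PMF ℕ} {m : ℝ}

lemma measurable_Phi (p : PMF ℕ) : Measurable (Phi p) := by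
  unfold Phi
  exact Measurable.tsum fun k => by fun_prop

lemma Phi_summable (p : PMF ℕ) {s : ℝ} (hs : s ∈ Set.Icc (0 : ℝ) 1) :
    Summable fun k => (p k).toReal * (1 - (1 - s) ^ k) := by
  have h := (toReal_summable p).sub
    (summable_mul_pow p (s := 1 - s) (by linarith [hs.2]) (by linarith [hs.1]))
  exact h.congr fun k => by ring

lemma Phi_zero (p : PMF ℕ) : Phi p 0 = 0 := by simp [Phi]

lemma Phi_monotoneOn (p : PMF ℕ) : MonotoneOn (Phi p) (Set.Icc 0 1) := by
  intro s hs t ht hst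
  refine (Phi_summable p hs).tsum_le_tsum (fun k => ?_) (Phi_summable p ht)
  have : (1 - t) ^ k ≤ (1 - s) ^ k := pow_le_pow_left₀ (by linarith [ht.2]) (by linarith) k
  exact mul_le_mul_of_nonneg_left (by linarith) ENNReal.toReal_nonneg

lemma Phi_nonneg (p : PMF ℕ) {s : ℝ} (hs : s ∈ Set.Icc (0 : ℝ) 1) : 0 ≤ Phi p s := by
  rw [← Phi_zero p]
  exact Phi_monotoneOn p (by simp) hs hs.1

lemma Phi_le_one (p : PMF ℕ) {s : ℝ} (hs : s ∈ Set.Icc (0 : ℝ) 1) : Phi p s ≤ 1 := by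
  rw [Phi_eq p hs.1 hs.2]
  have : 0 ≤ ∑' k, (p k).toReal * (1 - s) ^ k :=
    tsum_nonneg fun k => mul_nonneg ENNReal.toReal_nonneg (pow_nonneg (by linarith [hs.2]) k)
  linarith

lemma Phi_mem (p : PMF ℕ) {s : ℝ} (hs : s ∈ Set.Icc (0 : ℝ) 1) : Phi p s ∈ Set.Icc (0 : ℝ) 1 :=
  ⟨Phi_nonneg p hs, Phi_le_one p hs⟩

/-- Term by term, `|a ^ k - b ^ k| ≤ k |a - b|` on `[0, 1]`, and the weights `k p_k` sum to `m`.
This is the only nonlinear input of all upper bounds. -/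
lemma Phi_sub_le (hm : HasSum (fun k : ℕ => (k : ℝ) * (p k).toReal) m) {s t : ℝ}
    (hs : 0 ≤ s) (hst : s ≤ t) (ht : t ≤ 1) : Phi p t - Phi p s ≤ m * (t - s) := by
  have hs' : s ∈ Set.Icc (0 : ℝ) 1 := ⟨hs, hst.trans ht⟩
  have ht' : t ∈ Set.Icc (0 : ℝ) 1 := ⟨hs.trans hst, ht⟩
  rw [Phi, Phi, ← (Phi_summable p ht').tsum_sub (Phi_summable p hs'), ← hm.tsum_eq,
    ← tsum_mul_right]
  refine ((Phi_summable p ht').sub (Phi_summable p hs')).tsum_le_tsum (fun k => ?_)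
    (hm.summable.mul_right _)
  have h1 := abs_pow_sub_pow_le (1 - s) (1 - t) k
  have h2 : max |1 - s| |1 - t| ^ (k - 1) ≤ 1 := by
    refine pow_le_one₀ (by positivity) (max_le ?_ ?_)
    · rw [abs_le]; constructor <;> linarith
    · rw [abs_le]; constructor <;> linarith
  have h3 : |1 - s - (1 - t)| = t - s := by
    rw [abs_of_nonneg (by linarith)]; ring
  rw [h3] at h1
  have h4 : (1 - s) ^ k - (1 - t) ^ k ≤ (t - s) * k := by
    refine (le_abs_self _).trans (h1.trans ?_)
    exact mul_le_of_le_one_right (mul_nonneg (by linarith) (Nat.cast_nonneg k)) h2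
  calc _ = (p k).toReal * ((1 - s) ^ k - (1 - t) ^ k) := by ring
    _ ≤ (p k).toReal * ((t - s) * k) := mul_le_mul_of_nonneg_left h4 ENNReal.toReal_nonneg
    _ = _ := by ring

lemma Phi_continuousOn (hm : HasSum (fun k : ℕ => (k : ℝ) * (p k).toReal) m) (hm0 : 0 < m) :
    ContinuousOn (Phi p) (Set.Icc 0 1) := by
  have : LipschitzOnWith (Real.toNNReal m) (Phi p) (Set.Icc 0 1) := by
    refine LipschitzOnWith.of_dist_le_mul fun s hs t ht => ?_
    rw [Real.coe_toNNReal _ hm0.le, Real.dist_eq, Real.dist_eq]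
    rcases le_total s t with h | h
    · rw [abs_sub_comm, abs_of_nonneg (sub_nonneg.2 (Phi_monotoneOn p hs ht h)), abs_sub_comm,
        abs_of_nonneg (sub_nonneg.2 h)]
      exact Phi_sub_le hm hs.1 h ht.2
    · rw [abs_of_nonneg (sub_nonneg.2 (Phi_monotoneOn p ht hs h)), abs_of_nonneg (sub_nonneg.2 h)]
      exact Phi_sub_le hm ht.1 h hs.2
  exact this.continuousOn

/-- An upper bound for the defect of `Phi p s` from linearity. -/
noncomputable def defect (p : PMF ℕ) (s : ℝ) : ℝ :=
  ∑' k : ℕ, (k : ℝ) * (p k).toReal * min 1 (k * s)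

lemma defect_summable (hm : HasSum (fun k : ℕ => (k : ℝ) * (p k).toReal) m) {s : ℝ}
    (hs : 0 ≤ s) : Summable fun k : ℕ => (k : ℝ) * (p k).toReal * min 1 (k * s) :=
  Summable.of_nonneg_of_le (fun k => by positivity)
    (fun k => mul_le_of_le_one_right (by positivity) (min_le_left _ _)) hm.summable

lemma defect_nonneg {s : ℝ} (hs : 0 ≤ s) : 0 ≤ defect p s :=
  tsum_nonneg fun k => by positivity

lemma defect_le (hm : HasSum (fun k : ℕ => (k : ℝ) * (p k).toReal) m) {s : ℝ}
    (hs : 0 ≤ s) : defect p s ≤ m := by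
  rw [← hm.tsum_eq]
  exact (defect_summable hm hs).tsum_le_tsum
    (fun k => mul_le_of_le_one_right (by positivity) (min_le_left _ _)) hm.summable

lemma defect_mono (hm : HasSum (fun k : ℕ => (k : ℝ) * (p k).toReal) m) {s t : ℝ}
    (hs : 0 ≤ s) (hst : s ≤ t) : defect p s ≤ defect p t := by
  refine (defect_summable hm hs).tsum_le_tsum (fun k => ?_) (defect_summable hm (hs.trans hst))
  gcongr

lemma defect_eq_of_one_le (hm : HasSum (fun k : ℕ => (k : ℝ) * (p k).toReal) m) {s : ℝ}
    (hs : 1 ≤ s) : defect p s = m := by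
  rw [← hm.tsum_eq, defect]
  refine tsum_congr fun k => ?_
  rcases Nat.eq_zero_or_pos k with rfl | hk
  · simp
  · have : (1 : ℝ) ≤ k := by exact_mod_cast hk
    rw [min_eq_left (by nlinarith), mul_one]

lemma one_sub_pow_lower {s : ℝ} (h0 : 0 ≤ s) (h1 : s ≤ 1) (k : ℕ) :
    s * (k - k * min 1 (k * s)) ≤ 1 - (1 - s) ^ k := by
  rcases le_total 1 (k * s) with h | h
  · rw [min_eq_left h]
    have : (1 - s) ^ k ≤ 1 := pow_le_one₀ (by linarith) (by linarith)
    linarith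
  · rw [min_eq_right h]
    -- The quadratic bound holds for every `k`, so the case hypothesis is dropped to let the
    -- induction run; Bernoulli's inequality supplies the step.
    clear h
    induction k with
    | zero => simp
    | succ k ih =>
      have h2 : 1 + (k : ℝ) * (-s) ≤ (1 + -s) ^ k := one_add_mul_le_pow (by linarith) k
      have h3 : 1 - (1 - s) ^ (k + 1) = (1 - (1 - s) ^ k) + s * (1 - s) ^ k := by ring
      have h4 : 1 + (k : ℝ) * (-s) ≤ (1 - s) ^ k := by rw [sub_eq_add_neg]; exact h2
      have h5 := mul_le_mul_of_nonneg_left h4 h0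
      have hk : (0 : ℝ) ≤ k := Nat.cast_nonneg k
      rw [h3]
      push_cast
      nlinarith [mul_nonneg hk (mul_nonneg h0 h0), mul_nonneg h0 h0]

lemma Phi_lower (hm : HasSum (fun k : ℕ => (k : ℝ) * (p k).toReal) m) {s : ℝ}
    (hs : s ∈ Set.Icc (0 : ℝ) 1) : s * (m - defect p s) ≤ Phi p s := by
  rw [← hm.tsum_eq, defect, ← hm.summable.tsum_sub (defect_summable hm hs.1), ← tsum_mul_left]
  refine ((hm.summable.sub (defect_summable hm hs.1)).mul_left s).tsum_le_tsum (fun k => ?_)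
    (Phi_summable p hs)
  have := mul_le_mul_of_nonneg_left (one_sub_pow_lower hs.1 hs.2 k)
    (ENNReal.toReal_nonneg (a := p k))
  calc _ = (p k).toReal * (s * (k - k * min 1 (k * s))) := by ring
    _ ≤ _ := this

/-- A form of concavity between `0` and `1`, obtained from `(1 - s) ^ k ≤ 1 - s` for `k ≥ 1`. It
transfers the lower bound from one convention to the other. -/
lemma mul_Phi_one_le (p : PMF ℕ) {s : ℝ} (hs : s ∈ Set.Icc (0 : ℝ) 1) :
    s * Phi p 1 ≤ Phi p s := by
  have h1 := Phi_summable p (s := 1) (by simp)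
  rw [Phi, ← tsum_mul_left]
  refine (h1.mul_left s).tsum_le_tsum (fun k => ?_) (Phi_summable p hs)
  rw [mul_left_comm]
  refine mul_le_mul_of_nonneg_left ?_ ENNReal.toReal_nonneg
  rcases Nat.eq_zero_or_pos k with rfl | hk
  · simp
  · have : (1 - s) ^ k ≤ 1 - s :=
      pow_le_of_le_one (by linarith [hs.2]) (by linarith [hs.1]) hk.ne'
    simp only [sub_self, zero_pow hk.ne', sub_zero, mul_one]
    linarith

lemma Phi_one_pos (hm : HasSum (fun k : ℕ => (k : ℝ) * (p k).toReal) m) (hm0 : 0 < m) :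
    0 < Phi p 1 := by
  have hex : ∃ k : ℕ, 0 < (k : ℝ) * (p k).toReal := by
    by_contra! hcon
    have : m ≤ 0 := by
      rw [← hm.tsum_eq]
      exact tsum_nonpos hcon
    linarith
  obtain ⟨k, hk⟩ := hex
  have hk0 : k ≠ 0 := by rintro rfl; simp at hk
  have hpk : 0 < (p k).toReal := by
    by_contra! hcon
    have : (p k).toReal = 0 := le_antisymm hcon ENNReal.toReal_nonneg
    simp [this] at hk
  have hle := (Phi_summable p (s := 1) (by simp)).le_tsum k
    (fun j _ => mul_nonneg ENNReal.toReal_nonneg (by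
      rcases Nat.eq_zero_or_pos j with rfl | hj <;> simp [*, Nat.pos_iff_ne_zero.1]))
  refine lt_of_lt_of_le ?_ hle
  simpa [hk0] using hpk

end PhiProperties

/-! ### One step of the recursion: order, monotonicity, comparison and left-continuity. -/

section StepProperties

variable {p : PMF ℕ} {μ : Measure ℝ} {m : ℝ} {F G : ℝ → ℝ}

lemma integrable_of_mem_Icc {α : Type*} [MeasurableSpace α] {ν : Measure α} [IsFiniteMeasure ν]
    {f : α → ℝ} (hf : Measurable f) (h : ∀ x, f x ∈ Set.Icc (0 : ℝ) 1) : Integrable f ν :=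
  Integrable.of_bound hf.aestronglyMeasurable 1 (ae_of_all _ fun x => by
    rw [Real.norm_eq_abs, abs_of_nonneg (h x).1]; exact (h x).2)

lemma integral_mem_Icc {α : Type*} [MeasurableSpace α] {ν : Measure α} [IsProbabilityMeasure ν]
    {f : α → ℝ} (hf : Measurable f) (h : ∀ x, f x ∈ Set.Icc (0 : ℝ) 1) :
    ∫ x, f x ∂ν ∈ Set.Icc (0 : ℝ) 1 := by
  refine ⟨integral_nonneg fun x => (h x).1, ?_⟩
  have := integral_mono (integrable_of_mem_Icc (ν := ν) hf h) (integrable_const (1 : ℝ))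
    fun x => (h x).2
  simpa using this

lemma measurable_comp_sub (hF : Measurable F) (x : ℝ) : Measurable fun y => F (x - y) :=
  hF.comp (measurable_const.sub measurable_id)

lemma measurable_Phi_comp_sub (p : PMF ℕ) (hF : Measurable F) (x : ℝ) :
    Measurable fun y => Phi p (F (x - y)) :=
  (measurable_Phi p).comp (measurable_comp_sub hF x)

lemma step_zero_fun (o : Convention) {x : ℝ} (hx : 0 < x) :
    step o p μ (fun _ => 0) x = 0 := by
  cases o <;> simp [step, hx.not_ge, Phi_zero]

variable [IsProbabilityMeasure μ]

lemma step_of_nonpos (o : Convention) (p : PMF ℕ) (μ : Measure ℝ) (F : ℝ → ℝ) {x : ℝ}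
    (hx : x ≤ 0) : step o p μ F x = 1 := by simp [step, hx]

lemma step_mem (o : Convention) (hF : Measurable F) (h : ∀ x, F x ∈ Set.Icc (0 : ℝ) 1) (x : ℝ) :
    step o p μ F x ∈ Set.Icc (0 : ℝ) 1 := by
  unfold step
  split_ifs with hx
  · simp
  · cases o
    · exact integral_mem_Icc (measurable_Phi_comp_sub p hF x) fun y => Phi_mem p (h _)
    · exact Phi_mem p (integral_mem_Icc (measurable_comp_sub hF x) fun y => h _)

lemma step_mono (o : Convention) (hF : Measurable F) (h : ∀ x, F x ∈ Set.Icc (0 : ℝ) 1)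
    (hG : Measurable G) (h' : ∀ x, G x ∈ Set.Icc (0 : ℝ) 1) (hFG : ∀ x, F x ≤ G x) (x : ℝ) :
    step o p μ F x ≤ step o p μ G x := by
  unfold step
  split_ifs with hx
  · exact le_rfl
  · cases o
    · exact integral_mono
        (integrable_of_mem_Icc (measurable_Phi_comp_sub p hF x) fun y => Phi_mem p (h _))
        (integrable_of_mem_Icc (measurable_Phi_comp_sub p hG x) fun y => Phi_mem p (h' _))
        fun y => Phi_monotoneOn p (h _) (h' _) (hFG _)
    · exact Phi_monotoneOn p (integral_mem_Icc (measurable_comp_sub hF x) fun y => h _)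
        (integral_mem_Icc (measurable_comp_sub hG x) fun y => h' _)
        (integral_mono (integrable_of_mem_Icc (measurable_comp_sub hF x) fun y => h _)
          (integrable_of_mem_Icc (measurable_comp_sub hG x) fun y => h' _) fun y => hFG _)

lemma step_antitone (o : Convention) (hF : Antitone F) (h : ∀ x, F x ∈ Set.Icc (0 : ℝ) 1) :
    Antitone (step o p μ F) := by
  intro x x' hxx
  by_cases hx : x ≤ 0
  · rw [step_of_nonpos o p μ F hx]
    exact (step_mem o hF.measurable h x').2
  · have hx' : ¬ x' ≤ 0 := fun h => hx (hxx.trans h)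
    have hm := hF.measurable
    simp only [step, if_neg hx, if_neg hx']
    have hle : ∀ y, F (x' - y) ≤ F (x - y) := fun y => hF (by linarith)
    cases o
    · exact integral_mono
        (integrable_of_mem_Icc (measurable_Phi_comp_sub p hm x') fun y => Phi_mem p (h _))
        (integrable_of_mem_Icc (measurable_Phi_comp_sub p hm x) fun y => Phi_mem p (h _))
        fun y => Phi_monotoneOn p (h _) (h _) (hle _)
    · exact Phi_monotoneOn p (integral_mem_Icc (measurable_comp_sub hm x') fun y => h _)
        (integral_mem_Icc (measurable_comp_sub hm x) fun y => h _)
        (integral_mono (integrable_of_mem_Icc (measurable_comp_sub hm x') fun y => h _)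
          (integrable_of_mem_Icc (measurable_comp_sub hm x) fun y => h _) fun y => hle _)

/-- The two conventions apply `Phi` inside or outside the integral; the linear bound on increments
of `Phi` gives the same estimate for both, and later upper bounds need no case distinction. -/
lemma step_sub_le (o : Convention) (hm : HasSum (fun k : ℕ => (k : ℝ) * (p k).toReal) m)
    (hF : Measurable F) (h : ∀ x, F x ∈ Set.Icc (0 : ℝ) 1)
    (hG : Measurable G) (h' : ∀ x, G x ∈ Set.Icc (0 : ℝ) 1) (hFG : ∀ x, F x ≤ G x)
    {x : ℝ} (hx : 0 < x) :
    step o p μ G x - step o p μ F x ≤ m * ∫ y, (G (x - y) - F (x - y)) ∂μ := by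
  have iF := integrable_of_mem_Icc (ν := μ) (measurable_comp_sub hF x) fun y => h _
  have iG := integrable_of_mem_Icc (ν := μ) (measurable_comp_sub hG x) fun y => h' _
  simp only [step, if_neg hx.not_ge]
  cases o
  · have jF := integrable_of_mem_Icc (ν := μ) (measurable_Phi_comp_sub p hF x)
      fun y => Phi_mem p (h _)
    have jG := integrable_of_mem_Icc (ν := μ) (measurable_Phi_comp_sub p hG x)
      fun y => Phi_mem p (h' _)
    dsimp only
    rw [← integral_sub jG jF, ← integral_const_mul]
    exact integral_mono (jG.sub jF) ((iG.sub iF).const_mul m)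
      fun y => Phi_sub_le hm (h _).1 (hFG _) (h' _).2
  · dsimp only
    rw [integral_sub iG iF]
    exact Phi_sub_le hm (integral_nonneg fun y => (h _).1)
      (integral_mono iF iG fun y => hFG _)
      (integral_mem_Icc (measurable_comp_sub hG x) fun y => h' _).2

lemma step_le (o : Convention) (hm : HasSum (fun k : ℕ => (k : ℝ) * (p k).toReal) m)
    (hG : Measurable G) (h' : ∀ x, G x ∈ Set.Icc (0 : ℝ) 1) {x : ℝ} (hx : 0 < x) :
    step o p μ G x ≤ m * ∫ y, G (x - y) ∂μ := by
  have := step_sub_le (μ := μ) o hm (F := fun _ => 0) measurable_const (fun _ => by simp) hG h'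
    (fun x => (h' x).1) hx
  rw [step_zero_fun o hx] at this
  simpa using this

lemma step_leftCont (o : Convention) (hm : HasSum (fun k : ℕ => (k : ℝ) * (p k).toReal) m)
    (hm0 : 0 < m) (hF : Measurable F) (h : ∀ x, F x ∈ Set.Icc (0 : ℝ) 1)
    (hc : ∀ x, Tendsto F (𝓝[<] x) (𝓝 (F x))) (x : ℝ) :
    Tendsto (step o p μ F) (𝓝[<] x) (𝓝 (step o p μ F x)) := by
  rcases le_or_gt x 0 with hx | hx
  · rw [step_of_nonpos o p μ F hx]
    refine tendsto_const_nhds.congr' ?_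
    filter_upwards [self_mem_nhdsWithin] with y hy
    rw [step_of_nonpos o p μ F (le_of_lt (lt_of_lt_of_le hy hx))]
  · have hsub : ∀ y, Tendsto (fun x' => F (x' - y)) (𝓝[<] x) (𝓝 (F (x - y))) := by
      intro y
      refine (hc (x - y)).comp (tendsto_nhdsWithin_iff.2 ⟨?_, ?_⟩)
      · exact ((continuous_id.sub continuous_const).tendsto x).mono_left nhdsWithin_le_nhds
      · filter_upwards [self_mem_nhdsWithin] with z hz
        simp only [Set.mem_Iio] at hz ⊢
        linarith
    have hPhi : ∀ s ∈ Set.Icc (0 : ℝ) 1, ∀ g : ℝ → ℝ, (∀ z, g z ∈ Set.Icc (0 : ℝ) 1) →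
        Tendsto g (𝓝[<] x) (𝓝 s) → Tendsto (fun z => Phi p (g z)) (𝓝[<] x) (𝓝 (Phi p s)) := by
      intro s hs g hg hgs
      exact (Phi_continuousOn hm hm0 s hs).tendsto.comp
        (tendsto_nhdsWithin_iff.2 ⟨hgs, Eventually.of_forall hg⟩)
    have hev : ∀ᶠ z in 𝓝[<] x, 0 < z := nhdsWithin_le_nhds (lt_mem_nhds hx)
    cases o
    · have key : Tendsto (fun z => ∫ y, Phi p (F (z - y)) ∂μ) (𝓝[<] x)
          (𝓝 (∫ y, Phi p (F (x - y)) ∂μ)) := by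
        refine tendsto_integral_filter_of_dominated_convergence (fun _ => 1)
          (Eventually.of_forall fun z => (measurable_Phi_comp_sub p hF z).aestronglyMeasurable)
          (Eventually.of_forall fun z => ae_of_all _ fun y => ?_) (integrable_const 1)
          (ae_of_all _ fun y => hPhi _ (h _) _ (fun z => h _) (hsub y))
        rw [Real.norm_eq_abs, abs_of_nonneg (Phi_nonneg p (h _))]
        exact Phi_le_one p (h _)
      simp only [step, if_neg hx.not_ge]
      refine key.congr' ?_
      filter_upwards [hev] with z hz
      simp [step, hz.not_ge]
    · have key : Tendsto (fun z => ∫ y, F (z - y) ∂μ) (𝓝[<] x) (𝓝 (∫ y, F (x - y) ∂μ)) := by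
        refine tendsto_integral_filter_of_dominated_convergence (fun _ => 1)
          (Eventually.of_forall fun z => (measurable_comp_sub hF z).aestronglyMeasurable)
          (Eventually.of_forall fun z => ae_of_all _ fun y => ?_) (integrable_const 1)
          (ae_of_all _ fun y => hsub y)
        rw [Real.norm_eq_abs, abs_of_nonneg (h _).1]
        exact (h _).2
      simp only [step, if_neg hx.not_ge]
      refine (hPhi _ (integral_mem_Icc (measurable_comp_sub hF x) fun y => h _) _
        (fun z => integral_mem_Icc (measurable_comp_sub hF z) fun y => h _) key).congr' ?_
      filter_upwards [hev] with z hz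
      simp [step, hz.not_ge]

end StepProperties

/-! ### The iterated tails: monotonicity in both variables, comparison of the conventions, lattice
steps. -/

section TailProperties

variable {p : PMF ℕ} {μ : Measure ℝ} {m : ℝ}

lemma tail_of_nonpos (o : Convention) (p : PMF ℕ) (μ : Measure ℝ) (n : ℕ) {x : ℝ} (hx : x ≤ 0) :
    tail o p μ n x = 1 := by
  cases n with
  | zero => simp [tail, hx]
  | succ n => exact step_of_nonpos o p μ _ hx

lemma tail_zero_of_pos (o : Convention) (p : PMF ℕ) (μ : Measure ℝ) {x : ℝ} (hx : 0 < x) :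
    tail o p μ 0 x = 0 := by
  simp [tail, hx.not_ge]

lemma tail_antitone_mem (o : Convention) (p : PMF ℕ) (μ : Measure ℝ) [IsProbabilityMeasure μ]
    (n : ℕ) : Antitone (tail o p μ n) ∧ ∀ x, tail o p μ n x ∈ Set.Icc (0 : ℝ) 1 := by
  induction n with
  | zero =>
    constructor
    · intro x x' h
      simp only [tail]
      split_ifs with h1 h2 h2
      · exact le_rfl
      · exact absurd (h.trans h1) h2
      · exact zero_le_one
      · exact le_rfl
    · intro x
      simp only [tail]
      split_ifs <;> simp
  | succ n ih =>
    exact ⟨step_antitone o ih.1 ih.2, step_mem o ih.1.measurable ih.2⟩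

lemma tail_antitone (o : Convention) (p : PMF ℕ) (μ : Measure ℝ) [IsProbabilityMeasure μ]
    (n : ℕ) : Antitone (tail o p μ n) := (tail_antitone_mem o p μ n).1

lemma tail_mem (o : Convention) (p : PMF ℕ) (μ : Measure ℝ) [IsProbabilityMeasure μ]
    (n : ℕ) (x : ℝ) : tail o p μ n x ∈ Set.Icc (0 : ℝ) 1 := (tail_antitone_mem o p μ n).2 x

lemma tail_le_succ (o : Convention) (p : PMF ℕ) (μ : Measure ℝ) [IsProbabilityMeasure μ]
    (n : ℕ) : ∀ x, tail o p μ n x ≤ tail o p μ (n + 1) x := by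
  induction n with
  | zero =>
    intro x
    rcases le_or_gt x 0 with hx | hx
    · rw [tail_of_nonpos o p μ _ hx, tail_of_nonpos o p μ _ hx]
    · rw [tail_zero_of_pos o p μ hx]
      exact (tail_mem o p μ 1 x).1
  | succ n ih =>
    exact step_mono o (tail_antitone o p μ n).measurable (tail_mem o p μ n)
      (tail_antitone o p μ (n + 1)).measurable (tail_mem o p μ (n + 1)) ih

lemma tail_mono (o : Convention) (p : PMF ℕ) (μ : Measure ℝ) [IsProbabilityMeasure μ] (x : ℝ) :
    Monotone fun n => tail o p μ n x :=
  monotone_nat_of_le_succ fun n => tail_le_succ o p μ n x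

lemma tail_leftCont [IsProbabilityMeasure μ] (o : Convention) (hm : HasSum (fun k : ℕ => (k : ℝ) * (p k).toReal) m)
    (hm0 : 0 < m) (n : ℕ) :
    ∀ x, Tendsto (tail o p μ n) (𝓝[<] x) (𝓝 (tail o p μ n x)) := by
  induction n with
  | zero =>
    intro x
    refine tendsto_const_nhds.congr' ?_
    rcases le_or_gt x 0 with hx | hx
    · filter_upwards [self_mem_nhdsWithin] with y hy
      rw [tail_of_nonpos o p μ _ hx, tail_of_nonpos o p μ _ (le_of_lt (lt_of_lt_of_le hy hx))]
    · have hev : ∀ᶠ z in 𝓝[<] x, 0 < z := nhdsWithin_le_nhds (lt_mem_nhds hx)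
      filter_upwards [hev] with z hz
      rw [tail_zero_of_pos o p μ hx, tail_zero_of_pos o p μ hz]
  | succ n ih =>
    exact step_leftCont o hm hm0 (tail_antitone o p μ n).measurable (tail_mem o p μ n) ih

/-- On `(0, ∞)` the branch-first recursion is the jump-first one with `Phi` applied one level later,
so the induction just applies `Phi` to an integrated inequality. Only `x ≤ 0` needs the trivial
bound `Phi ≤ 1`. -/
lemma Phi_tail_jumpFirst_le (p : PMF ℕ) (μ : Measure ℝ) [IsProbabilityMeasure μ] (n : ℕ) :
    ∀ x, Phi p (tail .jumpFirst p μ n x) ≤ tail .branchFirst p μ n x := by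
  induction n with
  | zero =>
    intro x
    rcases le_or_gt x 0 with hx | hx
    · rw [tail_of_nonpos .branchFirst p μ _ hx]
      exact Phi_le_one p (tail_mem _ p μ _ x)
    · rw [tail_zero_of_pos _ p μ hx, tail_zero_of_pos _ p μ hx, Phi_zero]
  | succ n ih =>
    intro x
    rcases le_or_gt x 0 with hx | hx
    · rw [tail_of_nonpos .branchFirst p μ _ hx]
      exact Phi_le_one p (tail_mem _ p μ _ x)
    · have hJ := (tail_antitone .jumpFirst p μ n).measurable
      have hB := (tail_antitone .branchFirst p μ n).measurable
      simp only [tail, step, if_neg hx.not_ge]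
      refine Phi_monotoneOn p
        (integral_mem_Icc (measurable_Phi_comp_sub p hJ x) fun y => Phi_mem p (tail_mem _ p μ n _))
        (integral_mem_Icc (measurable_comp_sub hB x) fun y => tail_mem _ p μ n _) ?_
      exact integral_mono
        (integrable_of_mem_Icc (measurable_Phi_comp_sub p hJ x)
          fun y => Phi_mem p (tail_mem _ p μ n _))
        (integrable_of_mem_Icc (measurable_comp_sub hB x) fun y => tail_mem _ p μ n _)
        fun y => ih _

lemma ceil_sub_int_mul {h : ℝ} (hh : h ≠ 0) (x : ℝ) (k : ℤ) :
    h * (⌈(x - k * h) / h⌉ : ℤ) = h * (⌈x / h⌉ : ℤ) - k * h := by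
  rw [sub_div, mul_div_cancel_right₀ _ hh, Int.ceil_sub_intCast]
  push_cast
  ring

/-- Almost surely all positions lie in `hℤ`, so a threshold may be rounded up to the lattice. In the
recursion this reads: rounding commutes with subtracting a lattice jump. -/
lemma tail_ceil (o : Convention) (p : PMF ℕ) {h : ℝ} (hh : 0 < h) (hμ : CarriedByMultiples μ h)
    (n : ℕ) : ∀ x, tail o p μ n (h * (⌈x / h⌉ : ℤ)) = tail o p μ n x := by
  have hsign : ∀ x : ℝ, h * (⌈x / h⌉ : ℤ) ≤ 0 ↔ x ≤ 0 := by
    intro x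
    rw [← not_lt, ← not_lt, mul_pos_iff_of_pos_left hh, Int.cast_pos, Int.ceil_pos, div_pos_iff]
    simp [hh, hh.not_gt]
  induction n with
  | zero =>
    intro x
    simp only [tail, hsign]
  | succ n ih =>
    intro x
    have hae : ∀ᵐ y ∂μ, tail o p μ n (h * (⌈x / h⌉ : ℤ) - y) = tail o p μ n (x - y) := by
      filter_upwards [hμ] with y ⟨k, hk⟩
      rw [hk, ← ih (x - k * h), ceil_sub_int_mul hh.ne']
    simp only [tail, step, hsign]
    split_ifs with hx
    · rfl
    · cases o
      · exact integral_congr_ae (hae.mono fun y hy => by simp only [hy])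
      · exact congrArg (Phi p) (integral_congr_ae hae)

end TailProperties

/-! ### The exponentially tilted step law. -/

section Tilt

/-- The law of the steps of the random walk seen along a spine. -/
noncomputable def tilt (μ : Measure ℝ) (m γ : ℝ) : Measure ℝ :=
  μ.withDensity fun y => ENNReal.ofReal (m * Real.exp (γ * y))

variable {μ : Measure ℝ} {m γ : ℝ}

lemma measurable_tilt_density (m γ : ℝ) :
    Measurable fun y : ℝ => ENNReal.ofReal (m * Real.exp (γ * y)) := by fun_prop

lemma integral_tilt (hm0 : 0 < m) (f : ℝ → ℝ) :
    ∫ y, f y ∂(tilt μ m γ) = ∫ y, m * Real.exp (γ * y) * f y ∂μ := by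
  rw [tilt, integral_withDensity_eq_integral_toReal_smul (measurable_tilt_density m γ)
    (ae_of_all _ fun _ => ENNReal.ofReal_lt_top)]
  refine integral_congr_ae (ae_of_all _ fun y => ?_)
  dsimp only
  rw [ENNReal.toReal_ofReal (by positivity), smul_eq_mul]

lemma integrable_tilt_iff (hm0 : 0 < m) (f : ℝ → ℝ) :
    Integrable f (tilt μ m γ) ↔ Integrable (fun y => m * Real.exp (γ * y) * f y) μ := by
  rw [tilt, integrable_withDensity_iff_integrable_smul₀'
    (measurable_tilt_density m γ).aemeasurable (ae_of_all _ fun _ => ENNReal.ofReal_lt_top)]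
  refine integrable_congr (ae_of_all _ fun y => ?_)
  dsimp only
  rw [ENNReal.toReal_ofReal (by positivity), smul_eq_mul]

lemma isProbabilityMeasure_tilt (hm0 : 0 < m)
    (hint : Integrable (fun x : ℝ => Real.exp (γ * x)) μ)
    (hexp : ∫ x : ℝ, Real.exp (γ * x) ∂μ = 1 / m) : IsProbabilityMeasure (tilt μ m γ) := by
  constructor
  rw [tilt, withDensity_apply _ MeasurableSet.univ, setLIntegral_univ,
    ← ofReal_integral_eq_lintegral_ofReal (hint.const_mul m)
      (ae_of_all _ fun y => by positivity), integral_const_mul, hexp, mul_one_div_cancel hm0.ne',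
    ENNReal.ofReal_one]

/-- Splitting `exp (γ x) = exp (γ y) exp (γ (x - y))` turns the factor `m` and the weight into a
plain average under the tilted law. -/
lemma exp_mul_integral_comp_sub (hm0 : 0 < m) (f : ℝ → ℝ) (x : ℝ) :
    Real.exp (γ * x) * (m * ∫ y, f (x - y) ∂μ) =
      ∫ y, Real.exp (γ * (x - y)) * f (x - y) ∂(tilt μ m γ) := by
  rw [integral_tilt hm0, ← mul_assoc, ← integral_const_mul]
  refine integral_congr_ae (ae_of_all _ fun y => ?_)
  dsimp only
  rw [show γ * x = γ * y + γ * (x - y) by ring, Real.exp_add]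
  ring

lemma integrable_id_tilt (hm0 : 0 < m) (hX : Integrable (fun x : ℝ => x * Real.exp (γ * x)) μ) :
    Integrable (fun y : ℝ => y) (tilt μ m γ) := by
  rw [integrable_tilt_iff hm0]
  exact (hX.const_mul m).congr (ae_of_all _ fun y => by ring)

lemma integral_id_tilt (hm0 : 0 < m) :
    ∫ y, y ∂(tilt μ m γ) = m * ∫ x : ℝ, x * Real.exp (γ * x) ∂μ := by
  rw [integral_tilt hm0, ← integral_const_mul]
  exact integral_congr_ae (ae_of_all _ fun y => by ring)

lemma mean_tilt_pos [IsProbabilityMeasure μ] (hm0 : 0 < m) (hm1 : m < 1) (hγ : 0 < γ)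
    (hint : Integrable (fun x : ℝ => Real.exp (γ * x)) μ)
    (hexp : ∫ x : ℝ, Real.exp (γ * x) ∂μ = 1 / m)
    (hX : Integrable (fun x : ℝ => x * Real.exp (γ * x)) μ) :
    0 < ∫ y, y ∂(tilt μ m γ) := by
  rw [integral_id_tilt hm0]
  refine mul_pos hm0 ?_
  have h1 : ∫ x, (Real.exp (γ * x) - 1) ∂μ ≤ ∫ x, γ * (x * Real.exp (γ * x)) ∂μ := by
    refine integral_mono (hint.sub (integrable_const 1)) (hX.const_mul γ) fun x => ?_
    -- Multiplying `1 - γ x ≤ exp (-γ x)` by `exp (γ x)` gives `exp (γ x) - 1 ≤ γ x exp (γ x)`; its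
    -- left side integrates to `1 / m - 1 > 0`.
    have h := Real.add_one_le_exp (-(γ * x))
    have h2 := mul_le_mul_of_nonneg_right h (Real.exp_pos (γ * x)).le
    rw [← Real.exp_add, neg_add_cancel, Real.exp_zero] at h2
    simp only
    nlinarith
  rw [integral_sub hint (integrable_const 1), hexp, integral_const_mul] at h1
  simp only [integral_const, probReal_univ, smul_eq_mul, mul_one] at h1
  have h2 : 1 < 1 / m := (one_lt_div hm0).2 hm1
  by_contra! hcon
  nlinarith

/-- The density is strictly positive, so both laws have the same null sets and in particular the
same lattice structure. -/
lemma ae_tilt_iff (hm0 : 0 < m) {q : ℝ → Prop} :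
    (∀ᵐ y ∂(tilt μ m γ), q y) ↔ ∀ᵐ y ∂μ, q y := by
  constructor
  · intro h
    exact (withDensity_absolutelyContinuous' (μ := μ) (measurable_tilt_density m γ).aemeasurable
      (ae_of_all _ fun y => by
        rw [Ne, ENNReal.ofReal_eq_zero, not_le]; positivity)).ae_le h
  · intro h
    exact (withDensity_absolutelyContinuous μ _).ae_le h

end Tilt

/-! ### The random walk with tilted steps and its law of large numbers. -/

section Walk

variable (Q : Measure ℝ) [IsProbabilityMeasure Q]

/-- `P(S_n < x)` for the random walk `S` with step law `Q`. -/
noncomputable def walkCdf (n : ℕ) (x : ℝ) : ℝ :=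
  (Measure.infinitePi fun _ : ℕ => Q).real {ω | ∑ i ∈ Finset.range n, ω i < x}

lemma walkCdf_mem (n : ℕ) (x : ℝ) : walkCdf Q n x ∈ Set.Icc (0 : ℝ) 1 :=
  ⟨measureReal_nonneg, measureReal_le_one⟩

lemma walkCdf_mono (n : ℕ) : Monotone (walkCdf Q n) := fun _ _ h =>
  measureReal_mono fun _ hω => lt_of_lt_of_le hω h

lemma walkCdf_zero (x : ℝ) : walkCdf Q 0 x = if 0 < x then 1 else 0 := by
  simp only [walkCdf, Finset.range_zero, Finset.sum_empty]
  split_ifs with h <;> simp [h]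

lemma measurable_walk (n : ℕ) : Measurable fun ω : ℕ → ℝ => ∑ i ∈ Finset.range n, ω i := by
  fun_prop

lemma walkCdf_succ (n : ℕ) (x : ℝ) :
    walkCdf Q (n + 1) x = ∫ y, walkCdf Q n (x - y) ∂Q := by
  set PP := Measure.infinitePi fun _ : ℕ => Q with hPP
  have hind : iIndepFun (fun (i : ℕ) (ω : ℕ → ℝ) => ω i) PP :=
    iIndepFun_infinitePi (X := fun _ x => x) fun _ => measurable_id
  have h1 : IndepFun (fun ω : ℕ → ℝ => ∑ i ∈ Finset.range n, ω i) (fun ω => ω n) PP := by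
    have := hind.indepFun_finsetSum_of_notMem (fun i => measurable_pi_apply i)
      (s := Finset.range n) (i := n) (by simp)
    convert this using 1
    ext ω
    simp
  have h2 := (indepFun_iff_map_prod_eq_prod_map_map (measurable_walk n).aemeasurable
    (measurable_pi_apply n).aemeasurable).1 h1
  have hQ : PP.map (fun ω => ω n) = Q := Measure.infinitePi_map_eval _ n
  rw [hQ] at h2
  have hs : MeasurableSet {q : ℝ × ℝ | q.1 + q.2 < x} :=
    measurableSet_lt (by fun_prop) measurable_const
  have : IsProbabilityMeasure (PP.map fun ω : ℕ → ℝ => ∑ i ∈ Finset.range n, ω i) :=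
    Measure.isProbabilityMeasure_map (measurable_walk n).aemeasurable
  have h3 : PP {ω | ∑ i ∈ Finset.range (n + 1), ω i < x} =
      ∫⁻ y, PP {ω | ∑ i ∈ Finset.range n, ω i < x - y} ∂Q := by
    have e : {ω : ℕ → ℝ | ∑ i ∈ Finset.range (n + 1), ω i < x} =
        (fun ω : ℕ → ℝ => (∑ i ∈ Finset.range n, ω i, ω n)) ⁻¹' {q : ℝ × ℝ | q.1 + q.2 < x} := by
      ext ω
      simp [Finset.sum_range_succ]
    rw [e, ← Measure.map_apply ((measurable_walk n).prodMk (measurable_pi_apply n)) hs, h2,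
      Measure.prod_apply_symm hs]
    refine lintegral_congr fun y => ?_
    rw [Measure.map_apply (measurable_walk n) (measurable_prodMk_right hs)]
    congr 1
    ext ω
    simp [lt_sub_iff_add_lt]
  have hmeas : Measurable fun y => PP {ω | ∑ i ∈ Finset.range n, ω i < x - y} := by
    refine Antitone.measurable fun a b hab => measure_mono fun ω hω => ?_
    simp only [Set.mem_ofPred_eq] at hω ⊢
    linarith
  rw [walkCdf, measureReal_def, h3, ← integral_toReal hmeas.aemeasurable
    (ae_of_all _ fun y => measure_lt_top _ _)]
  rfl

lemma tendsto_walkCdf_atBot (n : ℕ) : Tendsto (walkCdf Q n) atBot (𝓝 0) := by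
  set PP := Measure.infinitePi fun _ : ℕ => Q with hPP
  have : IsProbabilityMeasure (PP.map fun ω : ℕ → ℝ => ∑ i ∈ Finset.range n, ω i) :=
    Measure.isProbabilityMeasure_map (measurable_walk n).aemeasurable
  refine squeeze_zero (fun x => (walkCdf_mem Q n x).1) (fun x => ?_)
    (tendsto_cdf_atBot (PP.map fun ω : ℕ → ℝ => ∑ i ∈ Finset.range n, ω i))
  rw [cdf_eq_real, map_measureReal_apply (measurable_walk n) measurableSet_Iic]
  exact measureReal_mono fun ω hω => Set.mem_Iic.2 (le_of_lt (Set.mem_ofPred_eq ▸ hω))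

lemma tendstoInMeasure_walk (hQ : Integrable (fun y : ℝ => y) Q) :
    TendstoInMeasure (Measure.infinitePi fun _ : ℕ => Q)
      (fun n (ω : ℕ → ℝ) => (∑ i ∈ Finset.range n, ω i) / (n : ℝ)) atTop
      fun _ => ∫ y, y ∂Q := by
  have hev : ∀ i : ℕ, (Measure.infinitePi fun _ : ℕ => Q).map (fun ω => ω i) = Q :=
    fun i => Measure.infinitePi_map_eval _ i
  have hind : iIndepFun (fun (i : ℕ) (ω : ℕ → ℝ) => ω i) (Measure.infinitePi fun _ : ℕ => Q) :=
    iIndepFun_infinitePi (X := fun _ x => x) fun _ => measurable_id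
  have hint : Integrable (fun ω : ℕ → ℝ => ω 0) (Measure.infinitePi fun _ : ℕ => Q) := by
    have h : Integrable (fun y : ℝ => y)
      ((Measure.infinitePi fun _ : ℕ => Q).map (fun ω => ω 0)) := by rwa [hev 0]
    exact h.comp_measurable (measurable_pi_apply 0)
  have hmean : ∫ ω : ℕ → ℝ, ω 0 ∂(Measure.infinitePi fun _ : ℕ => Q) = ∫ y, y ∂Q := by
    conv_rhs => rw [← hev 0]
    have hid : AEStronglyMeasurable (fun y : ℝ => y)
        ((Measure.infinitePi fun _ : ℕ => Q).map (fun ω => ω 0)) := by fun_prop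
    exact (integral_map (φ := fun ω : ℕ → ℝ => ω 0) (measurable_pi_apply 0).aemeasurable hid).symm
  have hlln := strong_law_ae_real (fun (i : ℕ) (ω : ℕ → ℝ) => ω i) hint
    (fun i j hij => hind.indepFun hij)
    (fun i => ⟨(measurable_pi_apply i).aemeasurable, (measurable_pi_apply 0).aemeasurable, by
      rw [hev, hev]⟩)
  rw [hmean] at hlln
  exact tendstoInMeasure_of_tendsto_ae
    (fun n => ((measurable_walk n).div_const _).aestronglyMeasurable) hlln

lemma tendsto_walk_deviation (hQ : Integrable (fun y : ℝ => y) Q) {ε : ℝ} (hε : 0 < ε) :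
    Tendsto (fun n : ℕ => (Measure.infinitePi fun _ : ℕ => Q).real
      {ω : ℕ → ℝ | ε ≤ dist ((∑ i ∈ Finset.range n, ω i) / (n : ℝ)) (∫ y, y ∂Q)}) atTop
      (𝓝 0) := by
  have := tendstoInMeasure_iff_dist.1 (tendstoInMeasure_walk Q hQ) ε hε
  exact (ENNReal.tendsto_toReal ENNReal.zero_ne_top).comp this

lemma tendsto_walkCdf_of_lt_mean (hQ : Integrable (fun y : ℝ => y) Q) {a : ℝ}
    (ha : a < ∫ y, y ∂Q) : Tendsto (fun n : ℕ => walkCdf Q n (a * n)) atTop (𝓝 0) := by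
  refine squeeze_zero' (Eventually.of_forall fun n => (walkCdf_mem Q n _).1) ?_
    (tendsto_walk_deviation Q hQ (sub_pos.2 ha))
  filter_upwards [eventually_gt_atTop 0] with n hn
  refine measureReal_mono fun ω hω => ?_
  have hn' : (0 : ℝ) < n := by exact_mod_cast hn
  simp only [Set.mem_ofPred_eq] at hω ⊢
  rw [← div_lt_iff₀ hn'] at hω
  rw [dist_comm, Real.dist_eq]
  exact le_trans (by linarith) (le_abs_self _)

lemma tendsto_walkCdf_of_mean_lt (hQ : Integrable (fun y : ℝ => y) Q) {a : ℝ}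
    (ha : ∫ y, y ∂Q < a) : Tendsto (fun n : ℕ => walkCdf Q n (a * n)) atTop (𝓝 1) := by
  have h : Tendsto (fun n : ℕ => 1 - walkCdf Q n (a * n)) atTop (𝓝 0) := by
    refine squeeze_zero' (Eventually.of_forall fun n => sub_nonneg.2 (walkCdf_mem Q n _).2) ?_
      (tendsto_walk_deviation Q hQ (sub_pos.2 ha))
    filter_upwards [eventually_gt_atTop 0] with n hn
    rw [walkCdf, ← probReal_compl_eq_one_sub
      (measurableSet_lt (measurable_walk n) measurable_const)]
    refine measureReal_mono fun ω hω => ?_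
    have hn' : (0 : ℝ) < n := by exact_mod_cast hn
    simp only [Set.mem_compl_iff, Set.mem_ofPred_eq, not_lt] at hω ⊢
    rw [← le_div_iff₀ hn'] at hω
    rw [Real.dist_eq]
    exact le_trans (by linarith) (le_abs_self _)
  simpa using h.const_sub 1

lemma tendsto_walkCdf_const (hQ : Integrable (fun y : ℝ => y) Q) (hc : 0 < ∫ y, y ∂Q) (x : ℝ) :
    Tendsto (fun n : ℕ => walkCdf Q n x) atTop (𝓝 0) := by
  have ha : (∫ y, y ∂Q) / 2 < ∫ y, y ∂Q := by linarith
  refine squeeze_zero' (Eventually.of_forall fun n => (walkCdf_mem Q n _).1) ?_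
    (tendsto_walkCdf_of_lt_mean Q hQ ha)
  have h : Tendsto (fun n : ℕ => (∫ y, y ∂Q) / 2 * (n : ℝ)) atTop atTop :=
    tendsto_natCast_atTop_atTop.const_mul_atTop (by linarith)
  filter_upwards [h.eventually_ge_atTop x] with n hn
  exact walkCdf_mono Q n hn

/-- Positive drift handles all large `n`, and the finitely many remaining distribution functions
vanish at `-∞`. -/
lemma exists_walkCdf_le_half (hQ : Integrable (fun y : ℝ => y) Q) (hc : 0 < ∫ y, y ∂Q) :
    ∃ K : ℝ, 0 ≤ K ∧ ∀ n, walkCdf Q n (-K) ≤ 1 / 2 := by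
  obtain ⟨n₀, hn₀⟩ := eventually_atTop.1
    ((tendsto_walkCdf_const Q hQ hc 0).eventually_le_const (by norm_num : (0 : ℝ) < 1 / 2))
  have hfin : ∀ᶠ x in atBot, ∀ n ∈ Finset.range n₀, walkCdf Q n x ≤ 1 / 2 := by
    rw [eventually_all_finset]
    exact fun n _ => (tendsto_walkCdf_atBot Q n).eventually_le_const (by norm_num)
  obtain ⟨x, hx, hx0⟩ := (hfin.and (eventually_le_atBot 0)).exists
  refine ⟨-x, by linarith, fun n => ?_⟩
  rw [neg_neg]
  by_cases hn : n < n₀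
  · exact hx n (Finset.mem_range.2 hn)
  · exact (walkCdf_mono Q n hx0).trans (hn₀ n (not_lt.1 hn))

end Walk

/-- Subcritical branching with `E[exp (γ X)] = 1 / m` and `E[X exp (γ X)]` finite. -/
structure Subcritical (p : PMF ℕ) (μ : Measure ℝ) (m γ : ℝ) : Prop where
  mean : HasSum (fun k : ℕ => (k : ℝ) * (p k).toReal) m
  mean_pos : 0 < m
  mean_lt : m < 1
  gamma_pos : 0 < γ
  integrable_exp : Integrable (fun x : ℝ => Real.exp (γ * x)) μ
  integral_exp : ∫ x : ℝ, Real.exp (γ * x) ∂μ = 1 / m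
  integrable_mul_exp : Integrable (fun x : ℝ => x * Real.exp (γ * x)) μ

/-! ### Comparison of the tails with the tilted random walk. -/

section Bounds

variable {p : PMF ℕ} {μ : Measure ℝ} {m γ : ℝ} {o : Convention}

lemma Subcritical.prob (h : Subcritical p μ m γ) : IsProbabilityMeasure (tilt μ m γ) :=
  isProbabilityMeasure_tilt h.mean_pos h.integrable_exp h.integral_exp

lemma Subcritical.integrable_id (h : Subcritical p μ m γ) :
    Integrable (fun y : ℝ => y) (tilt μ m γ) :=
  integrable_id_tilt h.mean_pos h.integrable_mul_exp

lemma exp_mul_le_one_of_nonpos (hγ : 0 < γ) {x : ℝ} (hx : x ≤ 0) : Real.exp (γ * x) ≤ 1 :=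
  Real.exp_le_one_iff.2 (mul_nonpos_of_nonneg_of_nonpos hγ.le hx)

variable [IsProbabilityMeasure μ]

lemma Subcritical.drift_pos (h : Subcritical p μ m γ) : 0 < ∫ y, y ∂(tilt μ m γ) :=
  mean_tilt_pos h.mean_pos h.mean_lt h.gamma_pos h.integrable_exp h.integral_exp
    h.integrable_mul_exp

lemma Subcritical.exp_mul_step_sub_le (h : Subcritical p μ m γ) (o : Convention) {F G : ℝ → ℝ}
    (hF : Measurable F) (hF' : ∀ x, F x ∈ Set.Icc (0 : ℝ) 1)
    (hG : Measurable G) (hG' : ∀ x, G x ∈ Set.Icc (0 : ℝ) 1) (hFG : ∀ x, F x ≤ G x)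
    {x : ℝ} (hx : 0 < x) :
    Real.exp (γ * x) * (step o p μ G x - step o p μ F x) ≤
      ∫ y, Real.exp (γ * (x - y)) * (G (x - y) - F (x - y)) ∂(tilt μ m γ) := by
  rw [← exp_mul_integral_comp_sub h.mean_pos (fun y => G y - F y)]
  exact mul_le_mul_of_nonneg_left (step_sub_le o h.mean hF hF' hG hG' hFG hx) (Real.exp_pos _).le

lemma Subcritical.exp_mul_step_le (h : Subcritical p μ m γ) (o : Convention) {G : ℝ → ℝ}
    (hG : Measurable G) (hG' : ∀ x, G x ∈ Set.Icc (0 : ℝ) 1) {x : ℝ} (hx : 0 < x) :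
    Real.exp (γ * x) * step o p μ G x ≤
      ∫ y, Real.exp (γ * (x - y)) * G (x - y) ∂(tilt μ m γ) := by
  rw [← exp_mul_integral_comp_sub h.mean_pos G]
  exact mul_le_mul_of_nonneg_left (step_le o h.mean hG hG' hx) (Real.exp_pos _).le

lemma measurable_exp_mul {F : ℝ → ℝ} (hF : Measurable F) :
    Measurable fun x => Real.exp (γ * x) * F x := by fun_prop

/-- The bound `1` is trivial for `x ≤ 0` and is preserved by averaging under the tilted law. It is
also the source of `κ ≤ 1`. -/
lemma Subcritical.exp_mul_tail_mem (h : Subcritical p μ m γ) (o : Convention) (n : ℕ) :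
    ∀ x, Real.exp (γ * x) * tail o p μ n x ∈ Set.Icc (0 : ℝ) 1 := by
  have := h.prob
  have h0 : ∀ n x, 0 ≤ Real.exp (γ * x) * tail o p μ n x :=
    fun n x => mul_nonneg (Real.exp_pos _).le (tail_mem o p μ n x).1
  refine fun x => ⟨h0 n x, ?_⟩
  induction n generalizing x with
  | zero =>
    rcases le_or_gt x 0 with hx | hx
    · rw [tail_of_nonpos o p μ _ hx, mul_one]
      exact exp_mul_le_one_of_nonpos h.gamma_pos hx
    · simp [tail_zero_of_pos o p μ hx]
  | succ n ih =>
    rcases le_or_gt x 0 with hx | hx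
    · rw [tail_of_nonpos o p μ _ hx, mul_one]
      exact exp_mul_le_one_of_nonpos h.gamma_pos hx
    · refine (h.exp_mul_step_le o (tail_antitone o p μ n).measurable (tail_mem o p μ n) hx).trans ?_
      exact (integral_mem_Icc (measurable_comp_sub
        (measurable_exp_mul (tail_antitone o p μ n).measurable) x) fun y => ⟨h0 n _, ih _⟩).2

/-- The weighted difference vanishes on `(-∞, 0]`, is at most `1` at time `0`, and is dominated by
its tilted average at each step, just as `P(S_n < x)` evolves. The strict inequality in `walkCdf`
matches the boundary: `P(S_0 < x)` is `1` exactly for `x > 0`. -/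
lemma Subcritical.exp_mul_tail_add_sub_le (h : Subcritical p μ m γ) (o : Convention) (k n : ℕ) :
    ∀ x, Real.exp (γ * x) * (tail o p μ (n + k) x - tail o p μ n x) ≤
      have := h.prob
      walkCdf (tilt μ m γ) n x := by
  have := h.prob
  induction n with
  | zero =>
    intro x
    rcases le_or_gt x 0 with hx | hx
    · rw [tail_of_nonpos o p μ _ hx, tail_of_nonpos o p μ _ hx, sub_self, mul_zero]
      exact (walkCdf_mem _ _ _).1
    · rw [tail_zero_of_pos o p μ hx, walkCdf_zero, if_pos hx, sub_zero]
      exact (h.exp_mul_tail_mem o _ x).2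
  | succ n ih =>
    intro x
    rcases le_or_gt x 0 with hx | hx
    · rw [tail_of_nonpos o p μ _ hx, tail_of_nonpos o p μ _ hx, sub_self, mul_zero]
      exact (walkCdf_mem _ _ _).1
    · have hle : ∀ x, tail o p μ n x ≤ tail o p μ (n + k) x :=
        fun x => tail_mono o p μ x (Nat.le_add_right n k)
      have e : n + 1 + k = n + k + 1 := by ring
      rw [e, walkCdf_succ]
      have mF := (tail_antitone o p μ n).measurable
      have mG := (tail_antitone o p μ (n + k)).measurable
      refine (h.exp_mul_step_sub_le o mF (tail_mem o p μ n) mG (tail_mem o p μ (n + k))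
        hle hx).trans ?_
      refine integral_mono (integrable_of_mem_Icc
        (measurable_comp_sub (measurable_exp_mul (mG.sub mF)) x) fun y => ⟨?_, ?_⟩)
        (integrable_of_mem_Icc (measurable_comp_sub (walkCdf_mono _ n).measurable x)
          fun y => walkCdf_mem _ _ _) fun y => ih _
      · exact mul_nonneg (Real.exp_pos _).le (sub_nonneg.2 (hle _))
      · exact (ih _).trans (walkCdf_mem _ _ _).2

/-- `2 P(S_n ≥ x - K)` obeys the linear recursion exactly. Where `tail` is reset to `1`, the choice
`P(S_n < -K) ≤ 1/2` makes this majorant at least `1`, uniformly in `n`. -/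
lemma Subcritical.exp_mul_tail_le (h : Subcritical p μ m γ) (o : Convention) :
    have := h.prob
    ∃ K : ℝ, ∀ n x, Real.exp (γ * x) * tail o p μ n x ≤
      2 * (1 - walkCdf (tilt μ m γ) n (x - K)) := by
  have := h.prob
  obtain ⟨K, -, hK⟩ := exists_walkCdf_le_half (tilt μ m γ) h.integrable_id h.drift_pos
  have hneg : ∀ n x, x ≤ 0 → Real.exp (γ * x) * tail o p μ n x ≤
      2 * (1 - walkCdf (tilt μ m γ) n (x - K)) := by
    intro n x hx
    rw [tail_of_nonpos o p μ _ hx, mul_one]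
    have h1 := exp_mul_le_one_of_nonpos h.gamma_pos hx
    have h2 := walkCdf_mono (tilt μ m γ) n (by linarith : x - K ≤ -K)
    linarith [hK n]
  refine ⟨K, fun n => ?_⟩
  induction n with
  | zero =>
    intro x
    rcases le_or_gt x 0 with hx | hx
    · exact hneg 0 x hx
    · rw [tail_zero_of_pos o p μ hx]
      linarith [(walkCdf_mem (tilt μ m γ) 0 (x - K)).2]
  | succ n ih =>
    intro x
    rcases le_or_gt x 0 with hx | hx
    · exact hneg _ x hx
    · have mF := (tail_antitone o p μ n).measurable
      have hw := integrable_of_mem_Icc (ν := tilt μ m γ)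
        (measurable_comp_sub (walkCdf_mono (tilt μ m γ) n).measurable (x - K))
          fun y => walkCdf_mem (tilt μ m γ) n _
      refine (h.exp_mul_step_le o mF (tail_mem o p μ n) hx).trans ?_
      rw [walkCdf_succ]
      have e : 2 * (1 - ∫ y, walkCdf (tilt μ m γ) n (x - K - y) ∂(tilt μ m γ)) =
          ∫ y, 2 * (1 - walkCdf (tilt μ m γ) n (x - K - y)) ∂(tilt μ m γ) := by
        rw [integral_const_mul, integral_sub (integrable_const 1) hw]
        simp
      rw [e]
      refine integral_mono (integrable_of_mem_Icc
        (measurable_comp_sub (measurable_exp_mul mF) x) fun y => h.exp_mul_tail_mem o n _)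
        (((integrable_const 1).sub hw).const_mul 2) fun y => ?_
      rw [sub_right_comm]
      exact ih _

/-- The tail of `M`, as the limit of the tails of `M_n`. -/
noncomputable def tailLim (o : Convention) (p : PMF ℕ) (μ : Measure ℝ) (x : ℝ) : ℝ :=
  ⨆ n, tail o p μ n x

lemma bddAbove_tail (o : Convention) (p : PMF ℕ) (μ : Measure ℝ) [IsProbabilityMeasure μ]
    (x : ℝ) : BddAbove (Set.range fun n => tail o p μ n x) :=
  ⟨1, by rintro _ ⟨n, rfl⟩; exact (tail_mem o p μ n x).2⟩

lemma tendsto_tail (o : Convention) (p : PMF ℕ) (μ : Measure ℝ) [IsProbabilityMeasure μ]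
    (x : ℝ) : Tendsto (fun n => tail o p μ n x) atTop (𝓝 (tailLim o p μ x)) :=
  tendsto_atTop_ciSup (tail_mono o p μ x) (bddAbove_tail o p μ x)

lemma tail_le_tailLim (o : Convention) (p : PMF ℕ) (μ : Measure ℝ) [IsProbabilityMeasure μ]
    (n : ℕ) (x : ℝ) : tail o p μ n x ≤ tailLim o p μ x :=
  le_ciSup (bddAbove_tail o p μ x) n

lemma tailLim_antitone (o : Convention) (p : PMF ℕ) (μ : Measure ℝ) [IsProbabilityMeasure μ] :
    Antitone (tailLim o p μ) := fun _ _ hxy =>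
  ciSup_mono (bddAbove_tail o p μ _) fun n => tail_antitone o p μ n hxy

lemma Subcritical.exp_mul_tailLim_mem (h : Subcritical p μ m γ) (o : Convention) (x : ℝ) :
    Real.exp (γ * x) * tailLim o p μ x ∈ Set.Icc (0 : ℝ) 1 :=
  isClosed_Icc.mem_of_tendsto ((tendsto_tail o p μ x).const_mul _) (Eventually.of_forall fun n =>
    h.exp_mul_tail_mem o n x)

lemma Subcritical.exp_mul_tailLim_sub_le (h : Subcritical p μ m γ) (o : Convention) (n : ℕ)
    (x : ℝ) : Real.exp (γ * x) * (tailLim o p μ x - tail o p μ n x) ≤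
      have := h.prob
      walkCdf (tilt μ m γ) n x := by
  have := h.prob
  refine le_of_tendsto' (x := atTop) (f := fun k => Real.exp (γ * x) *
    (tail o p μ (n + k) x - tail o p μ n x)) ?_ fun k => h.exp_mul_tail_add_sub_le o k n x
  refine Tendsto.const_mul _ (Tendsto.sub_const ?_ _)
  simpa [add_comm] using (tendsto_add_atTop_iff_nat n).2 (tendsto_tail o p μ x)

lemma Subcritical.exp_mul_tailLim_le (h : Subcritical p μ m γ) (o : Convention) {x : ℝ}
    (hx : 0 < x) : Real.exp (γ * x) * tailLim o p μ x ≤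
      ∫ y, Real.exp (γ * (x - y)) * tailLim o p μ (x - y) ∂(tilt μ m γ) := by
  have := h.prob
  refine le_of_tendsto' (x := atTop) (f := fun n => Real.exp (γ * x) * tail o p μ (n + 1) x)
    (((tendsto_add_atTop_iff_nat 1).2 (tendsto_tail o p μ x)).const_mul _) fun n => ?_
  have mF := (tail_antitone o p μ n).measurable
  refine (h.exp_mul_step_le o mF (tail_mem o p μ n) hx).trans ?_
  refine integral_mono (integrable_of_mem_Icc
    (measurable_comp_sub (measurable_exp_mul mF) x) fun y => h.exp_mul_tail_mem o n _)
    (integrable_of_mem_Icc (measurable_comp_sub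
      (measurable_exp_mul (tailLim_antitone o p μ).measurable) x)
      fun y => h.exp_mul_tailLim_mem o _) fun y => ?_
  exact mul_le_mul_of_nonneg_left (tail_le_tailLim o p μ n _) (Real.exp_pos _).le

/-- Each `tail` is left-continuous, and the walk bound makes the convergence to `tailLim` uniform on
`[x - 1, x]`, since `P(S_n < x)` tends to `0`. -/
lemma Subcritical.tailLim_leftCont (h : Subcritical p μ m γ) (o : Convention) (x : ℝ) :
    Tendsto (tailLim o p μ) (𝓝[<] x) (𝓝 (tailLim o p μ x)) := by
  have := h.prob
  rw [tendsto_order]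
  constructor
  · intro a ha
    filter_upwards [self_mem_nhdsWithin] with z hz
    exact ha.trans_le (tailLim_antitone o p μ (le_of_lt hz))
  · intro a ha
    have h1 : Tendsto (fun n => tailLim o p μ x +
        Real.exp (-(γ * (x - 1))) * walkCdf (tilt μ m γ) n x) atTop (𝓝 (tailLim o p μ x)) := by
      simpa using ((tendsto_walkCdf_const (tilt μ m γ) h.integrable_id h.drift_pos x).const_mul
        (Real.exp (-(γ * (x - 1))))).const_add (tailLim o p μ x)
    obtain ⟨n, hn⟩ := (h1.eventually_lt_const ha).exists
    have h2 := tail_leftCont o h.mean h.mean_pos (μ := μ) n x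
    have h3 : tail o p μ n x < a - Real.exp (-(γ * (x - 1))) * walkCdf (tilt μ m γ) n x := by
      have := tail_le_tailLim o p μ n x
      linarith
    filter_upwards [h2.eventually_lt_const h3, self_mem_nhdsWithin,
      nhdsWithin_le_nhds (lt_mem_nhds (sub_one_lt x))] with z hz hzx hz1
    have h4 := h.exp_mul_tailLim_sub_le o n z
    have h5 : tailLim o p μ z - tail o p μ n z ≤
        Real.exp (-(γ * z)) * walkCdf (tilt μ m γ) n z := by
      have := mul_le_mul_of_nonneg_left h4 (Real.exp_pos (-(γ * z))).le
      rwa [← mul_assoc, ← Real.exp_add, neg_add_cancel, Real.exp_zero, one_mul] at this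
    have h6 : Real.exp (-(γ * z)) * walkCdf (tilt μ m γ) n z ≤
        Real.exp (-(γ * (x - 1))) * walkCdf (tilt μ m γ) n x := by
      refine mul_le_mul (Real.exp_le_exp.2 ?_) (walkCdf_mono _ n (le_of_lt hzx))
        (walkCdf_mem _ _ _).1 (Real.exp_pos _).le
      have := h.gamma_pos
      nlinarith
    linarith

/-- A subsolution of the recursion lies below the tail of `M`. -/
lemma Subcritical.le_tailLim_of_le_step (h : Subcritical p μ m γ) (o : Convention) {W : ℝ → ℝ}
    (hW : Measurable W) (hW' : ∀ x, W x ∈ Set.Icc (0 : ℝ) 1)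
    (hexp : ∀ x, Real.exp (γ * x) * W x ≤ 1)
    (hstep : ∀ x, 0 < x → W x ≤ step o p μ W x) (x : ℝ) : W x ≤ tailLim o p μ x := by
  have := h.prob
  have key : ∀ n x, Real.exp (γ * x) * (W x - tail o p μ n x) ≤ walkCdf (tilt μ m γ) n x := by
    have hneg : ∀ n x, x ≤ 0 →
        Real.exp (γ * x) * (W x - tail o p μ n x) ≤ walkCdf (tilt μ m γ) n x := by
      intro n x hx
      rw [tail_of_nonpos o p μ _ hx]
      exact (mul_nonpos_of_nonneg_of_nonpos (Real.exp_pos _).le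
        (sub_nonpos.2 (hW' x).2)).trans (walkCdf_mem _ _ _).1
    intro n
    induction n with
    | zero =>
      intro x
      rcases le_or_gt x 0 with hx | hx
      · exact hneg 0 x hx
      · rw [tail_zero_of_pos o p μ hx, walkCdf_zero, if_pos hx, sub_zero]
        exact hexp x
    | succ n ih =>
      intro x
      rcases le_or_gt x 0 with hx | hx
      · exact hneg _ x hx
      · have mF := (tail_antitone o p μ n).measurable
        -- `W` and `tail` need not be ordered, while the comparison of steps needs ordered
        -- functions; `max (W, tail)` lies above both, and its excess over `tail` is the positive
        -- part of `W - tail`.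
        have mG : Measurable fun x => max (W x) (tail o p μ n x) := hW.max mF
        have hG' : ∀ x, max (W x) (tail o p μ n x) ∈ Set.Icc (0 : ℝ) 1 := fun x =>
          ⟨le_max_of_le_left (hW' x).1, max_le (hW' x).2 (tail_mem o p μ n x).2⟩
        have h1 : W x ≤ step o p μ (fun x => max (W x) (tail o p μ n x)) x :=
          (hstep x hx).trans (step_mono o hW hW' mG hG' (fun x => le_max_left _ _) x)
        have h2 := h.exp_mul_step_sub_le o mF (tail_mem o p μ n) mG hG'
          (fun x => le_max_right _ _) hx
        have h3 : Real.exp (γ * x) * (W x - tail o p μ (n + 1) x) ≤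
            Real.exp (γ * x) * (step o p μ (fun x => max (W x) (tail o p μ n x)) x -
              step o p μ (tail o p μ n) x) :=
          mul_le_mul_of_nonneg_left (sub_le_sub_right h1 _) (Real.exp_pos _).le
        refine (h3.trans h2).trans ?_
        have hb : ∀ y, Real.exp (γ * (x - y)) * (max (W (x - y)) (tail o p μ n (x - y)) -
            tail o p μ n (x - y)) ≤ walkCdf (tilt μ m γ) n (x - y) := by
          intro y
          rcases le_total (W (x - y)) (tail o p μ n (x - y)) with hle | hle
          · rw [max_eq_right hle, sub_self, mul_zero]
            exact (walkCdf_mem _ _ _).1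
          · rw [max_eq_left hle]
            exact ih _
        rw [walkCdf_succ]
        refine integral_mono (integrable_of_mem_Icc
          (measurable_comp_sub (measurable_exp_mul (mG.sub mF)) x) fun y => ⟨?_, ?_⟩)
          (integrable_of_mem_Icc (measurable_comp_sub (walkCdf_mono _ n).measurable x)
            fun y => walkCdf_mem _ _ _) hb
        · exact mul_nonneg (Real.exp_pos _).le (sub_nonneg.2 (le_max_right _ _))
        · exact (hb y).trans (walkCdf_mem _ _ _).2
  have hlim : Real.exp (γ * x) * (W x - tailLim o p μ x) ≤ 0 := by
    refine le_of_tendsto_of_tendsto' (((tendsto_tail o p μ x).const_sub (W x)).const_mul _)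
      (tendsto_walkCdf_const (tilt μ m γ) h.integrable_id h.drift_pos x) fun n => key n x
  have := nonpos_of_mul_nonpos_right hlim (Real.exp_pos _)
  linarith

end Bounds

/-! ### Integrals of antitone functions. -/

section AntitoneIntegral

lemma mul_sub_le_integral_of_antitone {R : ℝ → ℝ} (hR : Antitone R) (a b : ℝ) :
    R b * (b - a) ≤ ∫ t in a..b, R t := by
  rcases le_total a b with h | h
  · have h1 : ∫ _ in a..b, R b ≤ ∫ t in a..b, R t :=
      intervalIntegral.integral_mono_on h (by simp) hR.intervalIntegrable fun t ht => hR ht.2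
    simpa [mul_comm] using h1
  · have h1 : ∫ t in b..a, R t ≤ ∫ _ in b..a, R b :=
      intervalIntegral.integral_mono_on h hR.intervalIntegrable (by simp) fun t ht => hR ht.1
    rw [intervalIntegral.integral_symm]
    simp only [intervalIntegral.integral_const, smul_eq_mul] at h1
    linarith

/-- An antitone function with bounded integrals over `[0, z]` has small integrals far out, also
when it is frozen below a large threshold. -/
lemma exists_frozen_integral_le {G : ℝ → ℝ} (hG : Antitone G) (hG0 : ∀ x, 0 ≤ G x) {C : ℝ}
    (hC : ∀ z, 0 ≤ z → ∫ t in (0 : ℝ)..z, G t ≤ C) {δ : ℝ} (hδ : 0 < δ) :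
    ∀ᶠ K in atTop, ∀ z, 0 ≤ z → ∫ t in (0 : ℝ)..z, G (max t K) ≤ δ := by
  set g : ℝ → ℝ := fun z => ∫ t in (0 : ℝ)..(max z 0), G t with hg
  have hadd : ∀ a b, ∫ t in (0 : ℝ)..b, G t = (∫ t in (0 : ℝ)..a, G t) + ∫ t in a..b, G t :=
    fun a b => (intervalIntegral.integral_add_adjacent_intervals hG.intervalIntegrable
      hG.intervalIntegrable).symm
  have hmono : Monotone g := by
    intro a b hab
    simp only [hg]
    rw [hadd (max a 0) (max b 0)]
    have : 0 ≤ ∫ t in (max a 0)..(max b 0), G t :=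
      intervalIntegral.integral_nonneg (max_le_max_right 0 hab) fun t _ => hG0 t
    linarith
  have hbdd : BddAbove (Set.range g) := ⟨C, by
    rintro _ ⟨z, rfl⟩
    exact hC _ (le_max_right _ _)⟩
  have hlim := tendsto_atTop_ciSup hmono hbdd
  set I := ⨆ z, g z with hI
  -- The frozen part contributes at most `K G(K) ≤ 2 ∫ G` over `[K/2, K]`, and the rest at most the
  -- tail `I - g K`.
  have h1 : Tendsto (fun K => 2 * (g K - g (K / 2)) + (I - g K)) atTop (𝓝 0) := by
    have h2 : Tendsto (fun K : ℝ => g (K / 2)) atTop (𝓝 I) :=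
      hlim.comp (tendsto_id.atTop_div_const (by norm_num))
    simpa using ((hlim.sub h2).const_mul 2).add (hlim.const_sub I)
  filter_upwards [h1.eventually_le_const hδ, eventually_ge_atTop 0] with K hK hK0 z hz
  have hanti : Antitone fun t => G (max t K) := fun a b hab => hG (max_le_max_right K hab)
  have hKG : K * G K ≤ 2 * (g K - g (K / 2)) := by
    have e := hadd (K / 2) K
    have h3 := mul_sub_le_integral_of_antitone hG (K / 2) K
    simp only [hg, max_eq_left hK0, max_eq_left (by linarith : (0 : ℝ) ≤ K / 2)]
    rw [e]
    linarith
  have hpos : 0 ≤ I - g K := sub_nonneg.2 (le_ciSup hbdd K)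
  refine le_trans ?_ hK
  have hfirst : ∀ y, 0 ≤ y → y ≤ K → ∫ t in (0 : ℝ)..y, G (max t K) = y * G K := by
    intro y hy0 hy
    have : ∫ t in (0 : ℝ)..y, G (max t K) = ∫ _ in (0 : ℝ)..y, G K := by
      refine intervalIntegral.integral_congr fun t ht => ?_
      rw [Set.uIcc_of_le hy0] at ht
      simp only [max_eq_right (ht.2.trans hy)]
    rw [this]
    simp
  rcases le_total z K with hzK | hzK
  · rw [hfirst z hz hzK]
    have := mul_le_mul_of_nonneg_right hzK (hG0 K)
    linarith
  · rw [← intervalIntegral.integral_add_adjacent_intervals (b := K) hanti.intervalIntegrable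
      hanti.intervalIntegrable, hfirst K hK0 le_rfl]
    have e2 : ∫ t in K..z, G (max t K) = ∫ t in K..z, G t := by
      refine intervalIntegral.integral_congr fun t ht => ?_
      rw [Set.uIcc_of_le hzK] at ht
      simp only [max_eq_left ht.1]
    have e3 := hadd K z
    have e4 : g z ≤ I := le_ciSup hbdd z
    simp only [hg, max_eq_left hz, max_eq_left hK0] at e4 hKG ⊢
    rw [e2]
    linarith

end AntitoneIntegral

/-! ### Integrability of the nonlinearity under the `k log k` condition. -/

section Defect

variable {p : PMF ℕ} {μ : Measure ℝ} {m γ : ℝ}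

lemma measurable_defect (p : PMF ℕ) : Measurable (defect p) := by
  unfold defect
  exact Measurable.tsum fun k => by fun_prop

/-- The relative defect at the level `exp (-γ y)`. -/
noncomputable def relDefect (p : PMF ℕ) (m γ y : ℝ) : ℝ := defect p (Real.exp (-(γ * y))) / m

lemma Subcritical.relDefect_mem (h : Subcritical p μ m γ) (y : ℝ) :
    relDefect p m γ y ∈ Set.Icc (0 : ℝ) 1 :=
  ⟨div_nonneg (defect_nonneg (Real.exp_pos _).le) h.mean_pos.le,
    (div_le_one h.mean_pos).2 (defect_le h.mean (Real.exp_pos _).le)⟩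

lemma Subcritical.relDefect_antitone (h : Subcritical p μ m γ) :
    Antitone (relDefect p m γ) := by
  intro a b hab
  refine div_le_div_of_nonneg_right (defect_mono h.mean (Real.exp_pos _).le
    (Real.exp_le_exp.2 ?_)) h.mean_pos.le
  have := h.gamma_pos
  nlinarith

lemma Subcritical.relDefect_of_nonpos (h : Subcritical p μ m γ) {y : ℝ} (hy : y ≤ 0) :
    relDefect p m γ y = 1 := by
  rw [relDefect, defect_eq_of_one_le h.mean, div_self h.mean_pos.ne']
  rw [Real.one_le_exp_iff]
  have := h.gamma_pos
  nlinarith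

/-- The bound `min 1 a ≤ 2 a / (1 + a)` replaces the minimum by a function with an explicit
logarithmic antiderivative. The resulting `log (1 + k)` is where the `k log k` moment comes from. -/
lemma integral_min_one_exp_le (hγ : 0 < γ) {z : ℝ} (hz : 0 ≤ z) (k : ℕ) :
    ∫ t in (0 : ℝ)..z, min 1 (k * Real.exp (-(γ * t))) ≤ 2 / γ * Real.log (1 + k) := by
  have hk : (0 : ℝ) ≤ k := Nat.cast_nonneg k
  have hpos : ∀ t, 0 < 1 + k * Real.exp (-(γ * t)) := fun t => by positivity
  have hderiv : ∀ t ∈ Set.uIcc 0 z, HasDerivAt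
      (fun t => -(2 / γ) * Real.log (1 + k * Real.exp (-(γ * t))))
      (2 * (k * Real.exp (-(γ * t))) / (1 + k * Real.exp (-(γ * t)))) t := by
    intro t _
    have h1 : HasDerivAt (fun t => 1 + k * Real.exp (-(γ * t)))
        (k * (Real.exp (-(γ * t)) * -(γ * 1))) t :=
      (((((hasDerivAt_id t).const_mul γ).neg).exp).const_mul (k : ℝ)).const_add 1
    have h2 := (h1.log (hpos t).ne').const_mul (-(2 / γ))
    refine h2.congr_deriv ?_
    have h3 := (hpos t).ne'
    field_simp
  have hcont : Continuous fun t => 2 * (k * Real.exp (-(γ * t))) / (1 + k * Real.exp (-(γ * t))) :=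
    Continuous.div (by fun_prop) (by fun_prop) fun t => (hpos t).ne'
  have hle : ∫ t in (0 : ℝ)..z, min 1 (k * Real.exp (-(γ * t))) ≤
      ∫ t in (0 : ℝ)..z, 2 * (k * Real.exp (-(γ * t))) / (1 + k * Real.exp (-(γ * t))) := by
    refine intervalIntegral.integral_mono_on hz
      (Continuous.intervalIntegrable (by fun_prop) _ _) (hcont.intervalIntegrable _ _)
      fun t _ => ?_
    rw [le_div_iff₀ (hpos t)]
    have ha : 0 ≤ k * Real.exp (-(γ * t)) := by positivity
    rcases le_total 1 (k * Real.exp (-(γ * t))) with h | h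
    · rw [min_eq_left h]; linarith
    · rw [min_eq_right h]; nlinarith
  refine hle.trans ?_
  rw [intervalIntegral.integral_eq_sub_of_hasDerivAt hderiv (hcont.intervalIntegrable _ _)]
  have hlog : 0 ≤ Real.log (1 + k * Real.exp (-(γ * z))) :=
    Real.log_nonneg (by have : 0 ≤ k * Real.exp (-(γ * z)) := by positivity
                        linarith)
  have : 0 ≤ 2 / γ * Real.log (1 + k * Real.exp (-(γ * z))) := by positivity
  simp only [mul_zero, neg_zero, Real.exp_zero, mul_one]
  linarith

lemma summable_mul_log_one_add (hm : HasSum (fun k : ℕ => (k : ℝ) * (p k).toReal) m)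
    (hlog : Summable (fun k : ℕ => (k : ℝ) * Real.log k * (p k).toReal)) :
    Summable fun k : ℕ => (k : ℝ) * (p k).toReal * Real.log (1 + k) := by
  refine Summable.of_nonneg_of_le (fun k => ?_) (fun k => ?_)
    ((hm.summable.mul_right (Real.log 2)).add hlog)
  · have : 0 ≤ Real.log (1 + k) := Real.log_nonneg (by linarith [Nat.cast_nonneg (α := ℝ) k])
    positivity
  · rcases Nat.eq_zero_or_pos k with rfl | hk
    · simp
    · have hk1 : (1 : ℝ) ≤ k := by exact_mod_cast hk
      have h1 : Real.log (1 + k) ≤ Real.log 2 + Real.log k := by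
        rw [← Real.log_mul (by norm_num) (by linarith)]
        exact Real.log_le_log (by linarith) (by linarith)
      have h2 : 0 ≤ (k : ℝ) * (p k).toReal := by positivity
      calc _ ≤ (k : ℝ) * (p k).toReal * (Real.log 2 + Real.log k) :=
            mul_le_mul_of_nonneg_left h1 h2
        _ = _ := by ring

lemma Subcritical.integral_relDefect_le (h : Subcritical p μ m γ)
    (hlog : Summable (fun k : ℕ => (k : ℝ) * Real.log k * (p k).toReal)) :
    ∃ C, ∀ z, 0 ≤ z → ∫ t in (0 : ℝ)..z, relDefect p m γ t ≤ C := by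
  have hs := summable_mul_log_one_add h.mean hlog
  refine ⟨(∑' k : ℕ, (k : ℝ) * (p k).toReal * Real.log (1 + k) * (2 / γ)) / m, fun z hz => ?_⟩
  simp only [relDefect, defect]
  rw [intervalIntegral.integral_div]
  refine div_le_div_of_nonneg_right ?_ h.mean_pos.le
  have hsum := intervalIntegral.hasSum_integral_of_dominated_convergence
    (μ := volume) (a := 0) (b := z)
    (F := fun (k : ℕ) t => (k : ℝ) * (p k).toReal * min 1 (k * Real.exp (-(γ * t))))
    (f := fun t => ∑' k : ℕ, (k : ℝ) * (p k).toReal * min 1 (k * Real.exp (-(γ * t))))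
    (fun k _ => (k : ℝ) * (p k).toReal)
    (fun k => by
      have : Continuous fun t => (k : ℝ) * (p k).toReal * min 1 (k * Real.exp (-(γ * t))) := by
        fun_prop
      exact this.aestronglyMeasurable)
    (fun k => ae_of_all _ fun t _ => by
      rw [Real.norm_eq_abs, abs_of_nonneg (by positivity)]
      exact mul_le_of_le_one_right (by positivity) (min_le_left _ _))
    (ae_of_all _ fun t _ => h.mean.summable) (by simp)
    (ae_of_all _ fun t _ => (defect_summable h.mean (Real.exp_pos _).le).hasSum)
  rw [← hsum.tsum_eq]
  refine hsum.summable.tsum_le_tsum (fun k => ?_) (hs.mul_right _)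
  rw [intervalIntegral.integral_const_mul, mul_assoc _ _ (2 / γ), mul_comm _ (2 / γ)]
  exact mul_le_mul_of_nonneg_left (integral_min_one_exp_le h.gamma_pos hz k) (by positivity)

/-- The mean relative defect one step of the tilted walk ahead. -/
noncomputable def meanDefect (p : PMF ℕ) (μ : Measure ℝ) (m γ z : ℝ) : ℝ :=
  ∫ y, relDefect p m γ (z - y) ∂(tilt μ m γ)

lemma Subcritical.integrable_relDefect_sub (h : Subcritical p μ m γ) (z : ℝ) :
    Integrable (fun y => relDefect p m γ (z - y)) (tilt μ m γ) := by
  have := h.prob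
  exact integrable_of_mem_Icc (measurable_comp_sub h.relDefect_antitone.measurable z)
    fun y => h.relDefect_mem _

lemma Subcritical.meanDefect_nonneg (h : Subcritical p μ m γ) (z : ℝ) :
    0 ≤ meanDefect p μ m γ z := integral_nonneg fun _ => (h.relDefect_mem _).1

lemma Subcritical.meanDefect_antitone (h : Subcritical p μ m γ) :
    Antitone (meanDefect p μ m γ) := fun a b hab =>
  integral_mono (h.integrable_relDefect_sub b) (h.integrable_relDefect_sub a)
    fun _ => h.relDefect_antitone (by linarith)

lemma Subcritical.integral_meanDefect_le (h : Subcritical p μ m γ)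
    (hlog : Summable (fun k : ℕ => (k : ℝ) * Real.log k * (p k).toReal)) :
    ∃ C, ∀ z, 0 ≤ z → ∫ t in (0 : ℝ)..z, meanDefect p μ m γ t ≤ C := by
  have := h.prob
  obtain ⟨C, hC⟩ := h.integral_relDefect_le hlog
  have hC0 : 0 ≤ C := by simpa using hC 0 le_rfl
  have hanti := h.relDefect_antitone
  -- After Fubini, the shift by `y` adds at most an interval of length `|y|`, on which the relative
  -- defect is at most `1`.
  refine ⟨∫ y, (|y| + C) ∂(tilt μ m γ), fun z hz => ?_⟩
  have hpt : ∀ y, ∫ t in (0 : ℝ)..z, relDefect p m γ (t - y) ≤ |y| + C := by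
    intro y
    rw [intervalIntegral.integral_comp_sub_right (fun t => relDefect p m γ t) y, zero_sub]
    have hii : ∀ a b, IntervalIntegrable (relDefect p m γ) volume a b :=
      fun a b => hanti.intervalIntegrable
    have h1 : ∫ t in (-y)..(0 : ℝ), relDefect p m γ t ≤ |y| := by
      have := intervalIntegral.norm_integral_le_of_norm_le_const (a := -y) (b := (0 : ℝ)) (C := 1)
        (f := relDefect p m γ) fun t _ => by
          rw [Real.norm_eq_abs, abs_of_nonneg (h.relDefect_mem t).1]
          exact (h.relDefect_mem t).2
      simp only [sub_neg_eq_add, zero_add, one_mul] at this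
      exact (le_abs_self _).trans this
    have h2 : ∫ t in (0 : ℝ)..(z - y), relDefect p m γ t ≤ C := by
      rcases le_total 0 (z - y) with hzy | hzy
      · exact hC _ hzy
      · rw [intervalIntegral.integral_symm]
        have := intervalIntegral.integral_nonneg (f := relDefect p m γ) (μ := volume) hzy
          fun t _ => (h.relDefect_mem t).1
        linarith
    rw [← intervalIntegral.integral_add_adjacent_intervals (hii _ 0) (hii 0 _)]
    linarith
  have hswap : ∫ t in (0 : ℝ)..z, meanDefect p μ m γ t =
      ∫ y, (∫ t in (0 : ℝ)..z, relDefect p m γ (t - y)) ∂(tilt μ m γ) := by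
    simp only [meanDefect]
    refine intervalIntegral_integral_swap ?_
    have : IsFiniteMeasure (volume.restrict (Set.uIoc 0 z)) := by
      rw [Set.uIoc_of_le hz]
      infer_instance
    refine Integrable.of_bound (C := 1) ?_ (ae_of_all _ fun q => ?_)
    · exact (hanti.measurable.comp (measurable_fst.sub measurable_snd)).aestronglyMeasurable
    · rw [Function.uncurry, Real.norm_eq_abs, abs_of_nonneg (h.relDefect_mem _).1]
      exact (h.relDefect_mem _).2
  rw [hswap]
  refine integral_mono_of_nonneg (ae_of_all _ fun y => ?_)
    (h.integrable_id.abs.add (integrable_const C)) (ae_of_all _ hpt)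
  exact intervalIntegral.integral_nonneg hz fun t _ => (h.relDefect_mem _).1

lemma Subcritical.tendsto_integral_min (h : Subcritical p μ m γ) :
    Tendsto (fun K : ℝ => ∫ y, min y K ∂(tilt μ m γ)) atTop (𝓝 (∫ y, y ∂(tilt μ m γ))) := by
  have := h.prob
  refine tendsto_integral_filter_of_dominated_convergence (fun y => |y|)
    (Eventually.of_forall fun K => (measurable_id.min measurable_const).aestronglyMeasurable)
    ?_ h.integrable_id.abs (ae_of_all _ fun y => ?_)
  · filter_upwards [eventually_ge_atTop 0] with K hK
    refine ae_of_all _ fun y => ?_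
    rw [Real.norm_eq_abs]
    rcases le_total y K with hy | hy
    · rw [min_eq_left hy]
    · rw [min_eq_right hy, abs_of_nonneg hK, abs_of_nonneg (hK.trans hy)]
      exact hy
  · refine tendsto_const_nhds.congr' ?_
    filter_upwards [eventually_ge_atTop y] with K hK
    rw [min_eq_left hK]

end Defect

/-! ### A subsolution of order `exp (-γ x)`. -/

section LowerBound

variable {p : PMF ℕ} {μ : Measure ℝ} {m γ : ℝ} [IsProbabilityMeasure μ]

/-- The tail of `M` is at least of order `exp (-γ x)`, in the jump-first form. -/
lemma Subcritical.exists_le_exp_mul_tailLim_jumpFirst (h : Subcritical p μ m γ)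
    (hlog : Summable (fun k : ℕ => (k : ℝ) * Real.log k * (p k).toReal)) :
    ∃ ε, 0 < ε ∧ ∀ x, 0 ≤ x → ε ≤ Real.exp (γ * x) * tailLim .jumpFirst p μ x := by
  have := h.prob
  have hγ := h.gamma_pos
  obtain ⟨C, hC⟩ := h.integral_meanDefect_le hlog
  set c := ∫ y, y ∂(tilt μ m γ) with hc
  have hc0 : 0 < c := h.drift_pos
  set G := meanDefect p μ m γ with hG
  have hGanti : Antitone G := h.meanDefect_antitone
  have hG0 : ∀ x, 0 ≤ G x := h.meanDefect_nonneg
  -- `K` is large enough that the total decrease of `ψ` below is at most `1` and that the step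
  -- truncated at `K` keeps at least half of its drift.
  obtain ⟨K, hKint, hKmin, hK0⟩ := ((exists_frozen_integral_le hGanti hG0 hC
    (by positivity : 0 < c / 4)).and ((h.tendsto_integral_min.eventually_const_le
      (by linarith : c / 2 < c)).and (eventually_ge_atTop 0))).exists
  set R : ℝ → ℝ := fun z => 4 / c * G (max z K) with hR
  have hR0 : ∀ z, 0 ≤ R z := fun z => mul_nonneg (by positivity) (hG0 _)
  have hRanti : Antitone R := fun a b hab =>
    mul_le_mul_of_nonneg_left (hGanti (max_le_max_right K hab)) (by positivity)
  -- `ψ` decreases from `1` but stays nonnegative on `[0, ∞)`, and is convex with slope `-R`. A step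
  -- of drift at least `c / 2` therefore gains at least `R c / 2 = 2 G` on average, which is what
  -- the nonlinearity can cost.
  set ψ : ℝ → ℝ := fun z => 1 - ∫ t in (0 : ℝ)..z, R t with hψ
  have hψ1 : ∀ z, 0 ≤ z → ψ z ≤ 1 := fun z hz =>
    sub_le_self _ (intervalIntegral.integral_nonneg hz fun t _ => hR0 t)
  have hψ0 : ∀ z, 0 ≤ z → 0 ≤ ψ z := by
    intro z hz
    have : ∫ t in (0 : ℝ)..z, R t ≤ 1 := by
      simp only [hR]
      rw [intervalIntegral.integral_const_mul]
      calc _ ≤ 4 / c * (c / 4) := mul_le_mul_of_nonneg_left (hKint z hz) (by positivity)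
        _ = 1 := by field_simp
    simp only [hψ]
    linarith
  have hψconv : ∀ a b, ψ b + R b * (b - a) ≤ ψ a := by
    intro a b
    have h1 := mul_sub_le_integral_of_antitone hRanti a b
    have h2 := intervalIntegral.integral_add_adjacent_intervals
      (hRanti.intervalIntegrable (μ := volume) (a := 0) (b := a))
      (hRanti.intervalIntegrable (μ := volume) (a := a) (b := b))
    simp only [hψ]
    linarith
  have hψm : Measurable ψ := by
    have : Continuous fun z => ∫ t in (0 : ℝ)..z, R t :=
      intervalIntegral.continuous_primitive (fun a b => hRanti.intervalIntegrable) 0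
    exact (continuous_const.sub this).measurable
  -- With this `ε` and `w ≤ 2 ε`, the candidate `W` is at most `exp (-γ (x + K))`, so its defect is
  -- controlled by `relDefect` at `x + K`.
  set ε := Real.exp (-(γ * K)) / 2 with hε
  have hε0 : 0 < ε := by positivity
  have hεle : 2 * ε ≤ 1 := by
    rw [hε, mul_div_cancel₀ _ two_ne_zero, Real.exp_le_one_iff]
    nlinarith
  set w : ℝ → ℝ := fun x => if -K ≤ x then ε * (1 + ψ (x + K)) else 0 with hw
  have hw0 : ∀ x, 0 ≤ w x := by
    intro x
    simp only [hw]
    split_ifs with hx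
    · exact mul_nonneg hε0.le (by linarith [hψ0 (x + K) (by linarith)])
    · exact le_rfl
  have hw2 : ∀ x, w x ≤ 2 * ε := by
    intro x
    simp only [hw]
    split_ifs with hx
    · nlinarith [hψ1 (x + K) (by linarith)]
    · positivity
  have hwm : Measurable w :=
    Measurable.ite (measurableSet_le measurable_const measurable_id)
      (measurable_const.mul (measurable_const.add
        (hψm.comp (measurable_id.add measurable_const)))) measurable_const
  set W : ℝ → ℝ := fun x => Real.exp (-(γ * x)) * w x with hWdef
  have hWexp : ∀ x, Real.exp (γ * x) * W x = w x := by
    intro x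
    simp only [hWdef]
    rw [← mul_assoc, ← Real.exp_add, add_neg_cancel, Real.exp_zero, one_mul]
  have hWm : Measurable W := by fun_prop
  have hW0 : ∀ x, 0 ≤ W x := fun x => mul_nonneg (Real.exp_pos _).le (hw0 x)
  have hWle : ∀ x, W x ≤ Real.exp (-(γ * (x + K))) := by
    intro x
    calc W x ≤ Real.exp (-(γ * x)) * (2 * ε) :=
          mul_le_mul_of_nonneg_left (hw2 x) (Real.exp_pos _).le
      _ = Real.exp (-(γ * (x + K))) := by
          rw [hε, mul_div_cancel₀ _ two_ne_zero, ← Real.exp_add]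
          congr 1
          ring
  have hWmem : ∀ x, W x ∈ Set.Icc (0 : ℝ) 1 := by
    intro x
    refine ⟨hW0 x, ?_⟩
    by_cases hx : -K ≤ x
    · refine (hWle x).trans (Real.exp_le_one_iff.2 ?_)
      nlinarith
    · simp [hWdef, hw, hx]
  -- Pointwise form of the subsolution property: gain from convexity minus loss from the defect. If
  -- the step leads below `-K`, then `w` vanishes but the relative defect is `1`; the loss term `2
  -- ε` then covers everything, because `min y K ≤ x + K` and convexity gives `ψ (x + K) + R (x + K)
  -- (x + K) ≤ ψ 0`.
  have hpt : ∀ x y, 0 < x →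
      ε * (1 + ψ (x + K)) + ε * R (x + K) * min y K - 2 * ε * relDefect p m γ (x + K - y) ≤
        w (x - y) * (1 - defect p (W (x - y)) / m) := by
    intro x y hx
    have hρ := h.relDefect_mem (x + K - y)
    by_cases hxy : -K ≤ x - y
    · have h1 : defect p (W (x - y)) / m ≤ relDefect p m γ (x + K - y) := by
        refine div_le_div_of_nonneg_right (defect_mono h.mean (hW0 _) ((hWle _).trans_eq ?_))
          h.mean_pos.le
        congr 3
        ring
      have h2 : w (x - y) * (defect p (W (x - y)) / m) ≤ 2 * ε * relDefect p m γ (x + K - y) :=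
        mul_le_mul (hw2 _) h1 (div_nonneg (defect_nonneg (hW0 _)) h.mean_pos.le) (by positivity)
      have h3 := hψconv (x - y + K) (x + K)
      have h4 : R (x + K) * min y K ≤ R (x + K) * y :=
        mul_le_mul_of_nonneg_left (min_le_left _ _) (hR0 _)
      have h5 : w (x - y) = ε * (1 + ψ (x - y + K)) := by simp only [hw, if_pos hxy]
      have h6 : ε * (1 + ψ (x + K)) + ε * R (x + K) * min y K ≤ w (x - y) := by
        rw [h5]
        have : 1 + ψ (x + K) + R (x + K) * min y K ≤ 1 + ψ (x - y + K) := by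
          have e : x + K - (x - y + K) = y := by ring
          rw [e] at h3
          linarith
        calc _ = ε * (1 + ψ (x + K) + R (x + K) * min y K) := by ring
          _ ≤ _ := mul_le_mul_of_nonneg_left this hε0.le
      linarith
    · have h1 : w (x - y) = 0 := by simp only [hw, if_neg hxy]
      rw [h1, zero_mul, h.relDefect_of_nonpos (by linarith)]
      have h3 : R (x + K) * (x + K - 0) + ψ (x + K) ≤ ψ 0 := by linarith [hψconv 0 (x + K)]
      have h4 : ψ 0 ≤ 1 := hψ1 0 le_rfl
      have h5 : R (x + K) * min y K ≤ R (x + K) * (x + K - 0) :=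
        mul_le_mul_of_nonneg_left ((min_le_right _ _).trans (by linarith)) (hR0 _)
      have h6 : 1 + ψ (x + K) + R (x + K) * min y K ≤ 2 := by linarith
      nlinarith [mul_le_mul_of_nonneg_left h6 hε0.le]
  have hstep : ∀ x, 0 < x → W x ≤ step .jumpFirst p μ W x := by
    intro x hx
    have hdefm : Measurable fun y => W y * (1 - defect p (W y) / m) :=
      hWm.mul (measurable_const.sub (((measurable_defect p).comp hWm).div_const m))
    have hdef01 : ∀ y, W y * (1 - defect p (W y) / m) ∈ Set.Icc (0 : ℝ) 1 := by
      intro y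
      have h1 : defect p (W y) / m ≤ 1 :=
        (div_le_one h.mean_pos).2 (defect_le h.mean (hW0 y))
      have h2 : 0 ≤ defect p (W y) / m := div_nonneg (defect_nonneg (hW0 y)) h.mean_pos.le
      exact ⟨mul_nonneg (hW0 y) (by linarith), mul_le_one₀ (hWmem y).2 (by linarith)
        (by linarith)⟩
    have h1 : m * ∫ y, W (x - y) * (1 - defect p (W (x - y)) / m) ∂μ ≤
        step .jumpFirst p μ W x := by
      simp only [step, if_neg hx.not_ge]
      rw [← integral_const_mul]
      refine integral_mono ((integrable_of_mem_Icc (measurable_comp_sub hdefm x)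
        fun y => hdef01 _).const_mul m) (integrable_of_mem_Icc
          (measurable_Phi_comp_sub p hWm x) fun y => Phi_mem p (hWmem _)) fun y => ?_
      refine le_trans (le_of_eq ?_) (Phi_lower h.mean (hWmem (x - y)))
      have := h.mean_pos.ne'
      field_simp
    have h2 : w x ≤ Real.exp (γ * x) *
        (m * ∫ y, W (x - y) * (1 - defect p (W (x - y)) / m) ∂μ) := by
      rw [exp_mul_integral_comp_sub h.mean_pos (fun y => W y * (1 - defect p (W y) / m))]
      simp only [← mul_assoc, hWexp]
      have hmin : Integrable (fun y => min y K) (tilt μ m γ) :=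
        h.integrable_id.inf (integrable_const K)
      have hi1 : Integrable (fun y => ε * (1 + ψ (x + K)) + ε * R (x + K) * min y K)
          (tilt μ m γ) := (integrable_const _).add (hmin.const_mul _)
      have hi2 := (h.integrable_relDefect_sub (x + K)).const_mul (2 * ε)
      have hi3 : Integrable (fun y => w (x - y) * (1 - defect p (W (x - y)) / m))
          (tilt μ m γ) := by
        refine integrable_of_mem_Icc ?_ fun y => ⟨?_, ?_⟩
        · exact measurable_comp_sub (F := fun y => w y * (1 - defect p (W y) / m))
            (hwm.mul (measurable_const.sub (((measurable_defect p).comp hWm).div_const m))) x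
        · exact mul_nonneg (hw0 _) (sub_nonneg.2
            ((div_le_one h.mean_pos).2 (defect_le h.mean (hW0 _))))
        · exact mul_le_one₀ ((hw2 _).trans hεle) (sub_nonneg.2
            ((div_le_one h.mean_pos).2 (defect_le h.mean (hW0 _)))) (sub_le_self _
              (div_nonneg (defect_nonneg (hW0 _)) h.mean_pos.le))
      refine le_trans ?_ (integral_mono (hi1.sub hi2) hi3 fun y => hpt x y hx)
      have e1 : ∫ y, (ε * (1 + ψ (x + K)) + ε * R (x + K) * min y K -
          2 * ε * relDefect p m γ (x + K - y)) ∂(tilt μ m γ) =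
          ε * (1 + ψ (x + K)) + ε * R (x + K) * ∫ y, min y K ∂(tilt μ m γ) -
          2 * ε * G (x + K) := by
        rw [integral_sub hi1 hi2, integral_add (integrable_const _) (hmin.const_mul _)]
        simp [hG, meanDefect, integral_const_mul]
      simp only [Pi.sub_apply]
      rw [e1]
      have hwx : w x = ε * (1 + ψ (x + K)) := by
        simp only [hw, if_pos (by linarith : -K ≤ x)]
      -- For `x > 0` the argument exceeds `K`, so the freezing is inactive and the factor `4 / c`
      -- makes gain and loss cancel exactly.
      have hRx : R (x + K) * (c / 2) = 2 * G (x + K) := by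
        simp only [hR, max_eq_left (by linarith : K ≤ x + K)]
        field_simp
        ring
      have h6 := mul_le_mul_of_nonneg_left hKmin (mul_nonneg hε0.le (hR0 (x + K)))
      have h7 : ε * R (x + K) * (c / 2) = 2 * ε * G (x + K) := by
        rw [mul_assoc, hRx]; ring
      rw [hwx]
      linarith
    have h3 := mul_le_mul_of_nonneg_left h1 (Real.exp_pos (γ * x)).le
    have h4 : Real.exp (γ * x) * W x ≤ Real.exp (γ * x) * step .jumpFirst p μ W x := by
      rw [hWexp]
      exact h2.trans h3
    exact le_of_mul_le_mul_left h4 (Real.exp_pos _)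
  have hfinal := h.le_tailLim_of_le_step .jumpFirst hWm hWmem
    (fun x => by rw [hWexp]; exact (hw2 x).trans hεle) hstep
  refine ⟨ε, hε0, fun x hx => ?_⟩
  calc ε ≤ w x := by
        simp only [hw, if_pos (by linarith : -K ≤ x)]
        nlinarith [hψ0 (x + K) (by linarith)]
    _ = Real.exp (γ * x) * W x := (hWexp x).symm
    _ ≤ _ := mul_le_mul_of_nonneg_left (hfinal x) (Real.exp_pos _).le

lemma Phi_one_mul_tailLim_le (p : PMF ℕ) (μ : Measure ℝ) [IsProbabilityMeasure μ] (x : ℝ) :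
    tailLim .jumpFirst p μ x * Phi p 1 ≤ tailLim .branchFirst p μ x :=
  le_of_tendsto_of_tendsto' ((tendsto_tail .jumpFirst p μ x).mul_const _)
    (tendsto_tail .branchFirst p μ x) fun n =>
      (mul_Phi_one_le p (tail_mem _ p μ n x)).trans (Phi_tail_jumpFirst_le p μ n x)

/-- The tail of `M` is at least of order `exp (-γ x)`. -/
theorem Subcritical.exists_le_exp_mul_tailLim (h : Subcritical p μ m γ)
    (hlog : Summable (fun k : ℕ => (k : ℝ) * Real.log k * (p k).toReal)) (o : Convention) :
    ∃ ε, 0 < ε ∧ ∀ x, 0 ≤ x → ε ≤ Real.exp (γ * x) * tailLim o p μ x := by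
  obtain ⟨ε, hε, hle⟩ := h.exists_le_exp_mul_tailLim_jumpFirst hlog
  cases o
  · exact ⟨ε, hε, hle⟩
  · have hpos := Phi_one_pos h.mean h.mean_pos
    refine ⟨ε * Phi p 1, mul_pos hε hpos, fun x hx => ?_⟩
    calc ε * Phi p 1 ≤ Real.exp (γ * x) * tailLim .jumpFirst p μ x * Phi p 1 :=
          mul_le_mul_of_nonneg_right (hle x hx) hpos.le
      _ = Real.exp (γ * x) * (tailLim .jumpFirst p μ x * Phi p 1) := by ring
      _ ≤ _ := mul_le_mul_of_nonneg_left (Phi_one_mul_tailLim_le p μ x) (Real.exp_pos _).le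

end LowerBound

/-- A nonnegative bounded function lying below its mean over a step of law `Q` on `(0, ∞)`. -/
structure IsSubharmonic (Q : Measure ℝ) (u : ℝ → ℝ) (B : ℝ) : Prop where
  meas : Measurable u
  mem : ∀ x, u x ∈ Set.Icc (0 : ℝ) B
  le : ∀ x, 0 < x → u x ≤ ∫ y, u (x - y) ∂Q

/-- The mean of the integral of `u` over the interval between `x - y` and `x`. -/
noncomputable def backflow (Q : Measure ℝ) (u : ℝ → ℝ) (x : ℝ) : ℝ :=
  ∫ y, (∫ t in (x - y)..x, u t) ∂Q

/-- The integral of `u` over a window of length `δ`. -/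
noncomputable def window (u : ℝ → ℝ) (δ x : ℝ) : ℝ := ∫ t in x..(x + δ), u t

/-! ### Window integrals of bounded functions. -/

section BoundedFunctions

variable {u : ℝ → ℝ} {B : ℝ}

lemma integrable_of_mem_Icc' {α : Type*} [MeasurableSpace α] {ν : Measure α} [IsFiniteMeasure ν]
    {f : α → ℝ} (hf : Measurable f) (h : ∀ x, f x ∈ Set.Icc (0 : ℝ) B) : Integrable f ν :=
  Integrable.of_bound hf.aestronglyMeasurable B (ae_of_all _ fun x => by
    rw [Real.norm_eq_abs, abs_of_nonneg (h x).1]; exact (h x).2)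

lemma intervalIntegrable_of_mem_Icc (hu : Measurable u) (h : ∀ x, u x ∈ Set.Icc (0 : ℝ) B)
    (a b : ℝ) : IntervalIntegrable u volume a b :=
  ⟨integrable_of_mem_Icc' hu h, integrable_of_mem_Icc' hu h⟩

lemma abs_integral_le_of_mem_Icc (h : ∀ x, u x ∈ Set.Icc (0 : ℝ) B) (a b : ℝ) :
    |∫ t in a..b, u t| ≤ B * |b - a| :=
  intervalIntegral.norm_integral_le_of_norm_le_const fun t _ => by
    rw [Real.norm_eq_abs, abs_of_nonneg (h t).1]
    exact (h t).2

/-- Integration over a window smooths a possibly discontinuous `u`; moving the window changes it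
only near its two ends, hence the factor `2`. -/
lemma abs_window_sub_le (hu : Measurable u) (h : ∀ x, u x ∈ Set.Icc (0 : ℝ) B) (δ x y : ℝ) :
    |window u δ x - window u δ y| ≤ 2 * B * |x - y| := by
  have hii := intervalIntegrable_of_mem_Icc hu h
  have e : window u δ x - window u δ y = (∫ t in (y + δ)..(x + δ), u t) - ∫ t in y..x, u t := by
    have h1 := intervalIntegral.integral_add_adjacent_intervals (hii y x) (hii x (x + δ))
    have h2 := intervalIntegral.integral_add_adjacent_intervals (hii y (y + δ))
      (hii (y + δ) (x + δ))
    simp only [window]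
    linarith
  have h1 := abs_integral_le_of_mem_Icc h (y + δ) (x + δ)
  have h2 := abs_integral_le_of_mem_Icc h y x
  rw [e]
  rw [add_sub_add_right_eq_sub] at h1
  have := abs_sub (∫ t in (y + δ)..(x + δ), u t) (∫ t in y..x, u t)
  linarith

lemma measurable_window (hu : Measurable u) (h : ∀ x, u x ∈ Set.Icc (0 : ℝ) B) (δ : ℝ) :
    Measurable (window u δ) := by
  have hc : Continuous fun x => ∫ t in (0 : ℝ)..x, u t :=
    intervalIntegral.continuous_primitive (intervalIntegrable_of_mem_Icc hu h) 0
  have e : window u δ = fun x => (∫ t in (0 : ℝ)..(x + δ), u t) - ∫ t in (0 : ℝ)..x, u t := by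
    ext x
    rw [intervalIntegral.integral_interval_sub_left (intervalIntegrable_of_mem_Icc hu h _ _)
      (intervalIntegrable_of_mem_Icc hu h _ _)]
    rfl
  rw [e]
  exact ((hc.comp (continuous_id.add continuous_const)).sub hc).measurable

lemma window_mem (h : ∀ x, u x ∈ Set.Icc (0 : ℝ) B) {δ : ℝ} (hδ : 0 ≤ δ) (x : ℝ) :
    window u δ x ∈ Set.Icc (0 : ℝ) (B * δ) := by
  constructor
  · exact intervalIntegral.integral_nonneg (by linarith) fun t _ => (h t).1
  · have := abs_integral_le_of_mem_Icc h x (x + δ)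
    rw [add_sub_cancel_left, abs_of_nonneg hδ] at this
    exact (le_abs_self _).trans this

end BoundedFunctions

/-! ### The backflow as a monotone quantity. -/

section Backflow

variable {Q : Measure ℝ} {u : ℝ → ℝ} {B : ℝ}

lemma measurable_integral_sub (hu : Measurable u) (h : ∀ x, u x ∈ Set.Icc (0 : ℝ) B) (x : ℝ) :
    Measurable fun y => ∫ t in (x - y)..x, u t := by
  have hc : Continuous fun x => ∫ t in (0 : ℝ)..x, u t :=
    intervalIntegral.continuous_primitive (intervalIntegrable_of_mem_Icc hu h) 0
  have e : (fun y => ∫ t in (x - y)..x, u t) =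
      fun y => (∫ t in (0 : ℝ)..x, u t) - ∫ t in (0 : ℝ)..(x - y), u t := by
    ext y
    rw [intervalIntegral.integral_interval_sub_left (intervalIntegrable_of_mem_Icc hu h _ _)
      (intervalIntegrable_of_mem_Icc hu h _ _)]
  rw [e]
  exact (continuous_const.sub (hc.comp (continuous_const.sub continuous_id))).measurable

lemma integrable_integral_sub (hQ : Integrable (fun y : ℝ => y) Q) (hu : Measurable u)
    (h : ∀ x, u x ∈ Set.Icc (0 : ℝ) B) (x : ℝ) :
    Integrable (fun y => ∫ t in (x - y)..x, u t) Q := by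
  refine (hQ.abs.const_mul B).mono' (measurable_integral_sub hu h x).aestronglyMeasurable
    (ae_of_all _ fun y => ?_)
  have := abs_integral_le_of_mem_Icc h (x - y) x
  rwa [sub_sub_cancel] at this

variable [IsProbabilityMeasure Q]

lemma measurable_integral_comp_sub (hu : Measurable u) :
    Measurable fun t => ∫ y, u (t - y) ∂Q := by
  have : StronglyMeasurable (Function.uncurry fun t y : ℝ => u (t - y)) :=
    (hu.comp (measurable_fst.sub measurable_snd)).stronglyMeasurable
  exact this.integral_prod_right.measurable

lemma integral_comp_sub_mem (hu : Measurable u) (h : ∀ x, u x ∈ Set.Icc (0 : ℝ) B) (t : ℝ) :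
    ∫ y, u (t - y) ∂Q ∈ Set.Icc (0 : ℝ) B := by
  refine ⟨integral_nonneg fun y => (h _).1, ?_⟩
  have := integral_mono (integrable_of_mem_Icc' (ν := Q) (measurable_comp_sub hu t)
    fun y => h _) (integrable_const B) fun y => (h _).2
  simpa using this

lemma integral_window_eq (hu : Measurable u) (h : ∀ x, u x ∈ Set.Icc (0 : ℝ) B) (a b : ℝ) :
    ∫ t in a..b, (∫ y, u (t - y) ∂Q) = ∫ y, (∫ t in (a - y)..(b - y), u t) ∂Q := by
  have : IsFiniteMeasure (volume.restrict (Set.uIoc a b)) :=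
    ⟨by rw [Measure.restrict_apply_univ, Set.uIoc]; exact measure_Ioc_lt_top⟩
  rw [intervalIntegral_integral_swap]
  · refine integral_congr_ae (ae_of_all _ fun y => ?_)
    exact intervalIntegral.integral_comp_sub_right (fun t => u t) y
  · exact integrable_of_mem_Icc' (hu.comp (measurable_fst.sub measurable_snd)) fun q => h _

/-- Integrated form of the statement that the backflow has derivative `u` minus its `Q`-average. For
a subharmonic `u` it is thus nonincreasing on `[0, ∞)`; being bounded below by `-B E|Y|`, it
converges. -/
lemma backflow_sub (hQ : Integrable (fun y : ℝ => y) Q) (hu : Measurable u)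
    (h : ∀ x, u x ∈ Set.Icc (0 : ℝ) B) (a b : ℝ) :
    backflow Q u b - backflow Q u a = ∫ t in a..b, (u t - ∫ y, u (t - y) ∂Q) := by
  have hii := intervalIntegrable_of_mem_Icc hu h
  have hshift : Integrable (fun y => ∫ t in (a - y)..(b - y), u t) Q := by
    refine (((integrable_integral_sub hQ hu h a).sub (integrable_integral_sub hQ hu h b)).add
      (integrable_const (∫ t in a..b, u t))).congr (ae_of_all _ fun y => ?_)
    have h1 := intervalIntegral.integral_add_adjacent_intervals (hii (a - y) a) (hii a b)
    have h2 := intervalIntegral.integral_add_adjacent_intervals (hii (a - y) (b - y))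
      (hii (b - y) b)
    simp only [Pi.add_apply, Pi.sub_apply]
    linarith
  rw [intervalIntegral.integral_sub (hii a b) (intervalIntegrable_of_mem_Icc
    (measurable_integral_comp_sub hu) (integral_comp_sub_mem hu h) a b), integral_window_eq hu h,
    backflow, backflow, ← integral_sub (integrable_integral_sub hQ hu h b)
      (integrable_integral_sub hQ hu h a)]
  have e : ∫ t in a..b, u t = ∫ _, (∫ t in a..b, u t) ∂Q := by simp
  rw [e, ← integral_sub (integrable_const _) hshift]
  refine integral_congr_ae (ae_of_all _ fun y => ?_)
  have h1 := intervalIntegral.integral_add_adjacent_intervals (hii (a - y) a) (hii a b)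
  have h2 := intervalIntegral.integral_add_adjacent_intervals (hii (a - y) (b - y)) (hii (b - y) b)
  dsimp only
  linarith

/-- The harmonic defect of a window integral is an increment of the backflow. Monotonicity of the
backflow makes windows subharmonic, and its convergence makes them asymptotically harmonic. -/
lemma window_sub_integral_eq (hQ : Integrable (fun y : ℝ => y) Q) (hu : Measurable u)
    (h : ∀ x, u x ∈ Set.Icc (0 : ℝ) B) (δ x : ℝ) :
    window u δ x - ∫ y, window u δ (x - y) ∂Q =
      backflow Q u (x + δ) - backflow Q u x := by
  rw [backflow_sub hQ hu h, intervalIntegral.integral_sub (intervalIntegrable_of_mem_Icc hu h _ _)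
    (intervalIntegrable_of_mem_Icc (measurable_integral_comp_sub hu)
      (integral_comp_sub_mem hu h) _ _), integral_window_eq hu h]
  simp only [window, sub_add_eq_add_sub]

lemma IsSubharmonic.backflow_antitone (hQ : Integrable (fun y : ℝ => y) Q)
    (h : IsSubharmonic Q u B) {a b : ℝ} (ha : 0 ≤ a) (hab : a ≤ b) :
    backflow Q u b ≤ backflow Q u a := by
  have h1 := backflow_sub hQ h.meas h.mem a b
  have h2 : ∫ t in a..b, (u t - ∫ y, u (t - y) ∂Q) ≤ 0 := by
    rw [intervalIntegral.integral_of_le hab]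
    refine setIntegral_nonpos measurableSet_Ioc fun t ht => sub_nonpos.2 (h.le t ?_)
    exact lt_of_le_of_lt ha ht.1
  linarith

lemma IsSubharmonic.exists_tendsto_backflow (hQ : Integrable (fun y : ℝ => y) Q)
    (h : IsSubharmonic Q u B) : ∃ L, Tendsto (backflow Q u) atTop (𝓝 L) := by
  have hanti : Antitone fun x => backflow Q u (max x 0) := fun a b hab =>
    h.backflow_antitone hQ (le_max_right _ _) (max_le_max_right 0 hab)
  have hbdd : BddBelow (Set.range fun x => backflow Q u (max x 0)) := by
    refine ⟨-∫ y, B * |y| ∂Q, ?_⟩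
    rintro _ ⟨x, rfl⟩
    rw [← integral_neg]
    refine integral_mono (hQ.abs.const_mul B).neg (integrable_integral_sub hQ h.meas h.mem _)
      fun y => ?_
    have := abs_integral_le_of_mem_Icc h.mem (max x 0 - y) (max x 0)
    rw [sub_sub_cancel] at this
    exact (abs_le.1 this).1
  refine ⟨_, (tendsto_atTop_ciInf hanti hbdd).congr' ?_⟩
  filter_upwards [eventually_ge_atTop 0] with x hx
  rw [max_eq_left hx]

lemma IsSubharmonic.window (hQ : Integrable (fun y : ℝ => y) Q) (h : IsSubharmonic Q u B)
    {δ : ℝ} (hδ : 0 ≤ δ) : IsSubharmonic Q (window u δ) (B * δ) where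
  meas := measurable_window h.meas h.mem δ
  mem := window_mem h.mem hδ
  le x hx := by
    have h1 := window_sub_integral_eq hQ h.meas h.mem δ x
    have h2 := h.backflow_antitone hQ hx.le (by linarith : x ≤ x + δ)
    linarith

lemma IsSubharmonic.tendsto_window_sub (hQ : Integrable (fun y : ℝ => y) Q)
    (h : IsSubharmonic Q u B) (δ : ℝ) :
    Tendsto (fun x => BRW.window u δ x - ∫ y, BRW.window u δ (x - y) ∂Q) atTop (𝓝 0) := by
  obtain ⟨L, hL⟩ := h.exists_tendsto_backflow hQ
  simp only [window_sub_integral_eq hQ h.meas h.mem]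
  simpa using (hL.comp (tendsto_atTop_add_const_right atTop δ tendsto_id)).sub hL

end Backflow

/-! ### Asymptotically harmonic functions are asymptotically invariant under the support. -/

section ShiftInvariance

variable {Q : Measure ℝ} [IsProbabilityMeasure Q] {v : ℝ → ℝ} {B C : ℝ}

/-- An asymptotically harmonic bounded function that is asymptotically below `α`, and close to `α`
along a filter, stays close to `α` after a shift by a point of the support. -/
lemma tendsto_shift_of_tendsto {d : ℝ → ℝ} (hd : Measurable d) (hB : ∀ x, |d x| ≤ B)
    (hlip : ∀ x y, |d x - d y| ≤ C * |x - y|)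
    (hharm : Tendsto (fun x => d x - ∫ y, d (x - y) ∂Q) atTop (𝓝 0)) {α : ℝ}
    (hα : ∀ ε, 0 < ε → ∀ᶠ x in atTop, d x < α + ε) {s : ℝ} (hs : s ∈ Q.support)
    {F : Filter ℝ} (hF : F ≤ atTop) (hFα : Tendsto d F (𝓝 α)) :
    Tendsto (fun x => d (x - s)) F (𝓝 α) := by
  have hC : 0 ≤ C := by
    have := (abs_nonneg _).trans (hlip 1 0)
    simpa using this
  have hsub : ∀ y, Tendsto (fun x : ℝ => x - y) atTop atTop :=
    fun y => tendsto_atTop_add_const_right atTop (-y) tendsto_id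
  have hdi : ∀ x, Integrable (fun y => d (x - y)) Q := fun x =>
    Integrable.of_bound (measurable_comp_sub hd x).aestronglyMeasurable B
      (ae_of_all _ fun y => hB _)
  -- The average of `d (x - y)` tends to `α` along `F`, and its positive excess over `α` vanishes by
  -- dominated convergence, so the deficit in `hneg` vanishes too.
  have hpos : Tendsto (fun x => ∫ y, max (d (x - y) - α) 0 ∂Q) atTop (𝓝 0) := by
    rw [show 𝓝 (0 : ℝ) = 𝓝 (∫ _, (0 : ℝ) ∂Q) by simp]
    refine tendsto_integral_filter_of_dominated_convergence (fun _ => B + |α|)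
      (Eventually.of_forall fun x => (((measurable_comp_sub hd x).sub_const α).max
        measurable_const).aestronglyMeasurable)
      (Eventually.of_forall fun x => ae_of_all _ fun y => ?_) (integrable_const _)
      (ae_of_all _ fun y => ?_)
    · rw [Real.norm_eq_abs, abs_of_nonneg (le_max_right _ _)]
      have h1 := abs_le.1 (hB (x - y))
      have h2 := neg_abs_le α
      refine max_le (by linarith) (by linarith [abs_nonneg (d (x - y)), hB (x - y), abs_nonneg α])
    · rw [Metric.tendsto_nhds]
      intro ε hε
      filter_upwards [(hsub y).eventually (hα ε hε)] with x hx
      rw [Real.dist_eq, sub_zero, abs_of_nonneg (le_max_right _ _)]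
      exact max_lt (by linarith) hε
  have hneg : Tendsto (fun x => ∫ y, max (α - d (x - y)) 0 ∂Q) F (𝓝 0) := by
    have h1 : Tendsto (fun x => (∫ y, max (d (x - y) - α) 0 ∂Q) - (d x - α) +
        (d x - ∫ y, d (x - y) ∂Q)) F (𝓝 0) := by
      simpa using ((hpos.mono_left hF).sub (hFα.sub_const α)).add (hharm.mono_left hF)
    refine h1.congr fun x => ?_
    have e : ∀ y, max (α - d (x - y)) 0 = max (d (x - y) - α) 0 - (d (x - y) - α) := by
      intro y
      rcases le_total (d (x - y)) α with h | h
      · rw [max_eq_left (by linarith), max_eq_right (by linarith)]; ring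
      · rw [max_eq_right (by linarith), max_eq_left (by linarith)]; ring
    simp_rw [e]
    have i1 : Integrable (fun y => d (x - y) - α) Q := (hdi x).sub (integrable_const α)
    rw [integral_sub i1.pos_part i1, integral_sub (hdi x) (integrable_const α)]
    simp only [integral_const, probReal_univ, smul_eq_mul, one_mul]
    ring
  rw [tendsto_order]
  constructor
  · intro a ha
    set ε := α - a with hε
    have hε0 : 0 < ε := sub_pos.2 ha
    set r := ε / (2 * (C + 1)) with hr
    have hr0 : 0 < r := by positivity
    have hq : 0 < Q.real (Metric.ball s r) := by
      rw [measureReal_def, ENNReal.toReal_pos_iff]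
      exact ⟨(Measure.mem_support_iff_forall _).1 hs _ (Metric.ball_mem_nhds s hr0),
        measure_lt_top _ _⟩
    -- A deficit of `ε` at `x - s` persists, by the Lipschitz bound, as a deficit of `ε / 2` over a
    -- ball around `s` of positive `Q`-mass; Markov's inequality then contradicts the vanishing mean
    -- deficit.
    filter_upwards [hneg.eventually_lt_const (mul_pos (half_pos hε0) hq)] with x hx
    by_contra! hcon
    have hsubset : Metric.ball s r ⊆ {y | ε / 2 ≤ max (α - d (x - y)) 0} := by
      intro y hy
      refine Set.mem_ofPred_eq ▸ le_max_of_le_left ?_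
      have h1 := hlip (x - y) (x - s)
      have h2 : |x - y - (x - s)| < r := by
        rw [Metric.mem_ball, Real.dist_eq, abs_sub_comm] at hy
        rwa [show x - y - (x - s) = s - y by ring]
      have h3 : C * |x - y - (x - s)| ≤ ε / 2 := by
        calc C * |x - y - (x - s)| ≤ (C + 1) * r :=
              mul_le_mul (by linarith) h2.le (abs_nonneg _) (by linarith)
          _ = ε / 2 := by rw [hr]; field_simp
      have h4 := (le_abs_self _).trans (h1.trans h3)
      linarith
    have i1 : Integrable (fun y => α - d (x - y)) Q := (integrable_const α).sub (hdi x)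
    have hmarkov := mul_meas_ge_le_integral_of_nonneg (μ := Q)
      (f := fun y => max (α - d (x - y)) 0) (ae_of_all _ fun y => le_max_right _ _)
      i1.pos_part (ε / 2)
    have h5 : ε / 2 * Q.real (Metric.ball s r) ≤ _ :=
      (mul_le_mul_of_nonneg_left (measureReal_mono hsubset) (half_pos hε0).le).trans hmarkov
    linarith
  · intro a ha
    filter_upwards [hF ((hsub s).eventually (hα (a - α) (by linarith)))] with x hx
    linarith

/-- Let `α` be the limsup of `d x = v x - v (x - s)`. Along an ultrafilter on which `d` tends to
`α`, so do all its shifts by multiples of `s`; summing `k` of them telescopes to a difference of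
values of `v`, so `k α ≤ 2 B` for every `k` and `α ≤ 0`. -/
lemma eventually_sub_shift_lt (hv : Measurable v) (hB : ∀ x, |v x| ≤ B)
    (hlip : ∀ x y, |v x - v y| ≤ C * |x - y|)
    (hharm : Tendsto (fun x => v x - ∫ y, v (x - y) ∂Q) atTop (𝓝 0)) {s : ℝ}
    (hs : s ∈ Q.support) {ε : ℝ} (hε : 0 < ε) : ∀ᶠ x in atTop, v x - v (x - s) < ε := by
  set d : ℝ → ℝ := fun x => v x - v (x - s) with hd
  have hsub : ∀ y, Tendsto (fun x : ℝ => x - y) atTop atTop :=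
    fun y => tendsto_atTop_add_const_right atTop (-y) tendsto_id
  have hdm : Measurable d := hv.sub (hv.comp (measurable_id.sub_const s))
  have hdB : ∀ x, |d x| ≤ 2 * B := fun x => by
    have h1 := abs_sub (v x) (v (x - s))
    have h2 := hB x
    have h3 := hB (x - s)
    simp only [hd]
    linarith
  have hdlip : ∀ x y, |d x - d y| ≤ 2 * C * |x - y| := fun x y => by
    have h1 := abs_sub (v x - v y) (v (x - s) - v (y - s))
    have h2 := hlip x y
    have h3 := hlip (x - s) (y - s)
    rw [sub_sub_sub_cancel_right] at h3
    simp only [hd]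
    rw [sub_sub_sub_comm]
    linarith
  have hvi : ∀ x, Integrable (fun y => v (x - y)) Q := fun x =>
    Integrable.of_bound (measurable_comp_sub hv x).aestronglyMeasurable B
      (ae_of_all _ fun y => hB _)
  have hdharm : Tendsto (fun x => d x - ∫ y, d (x - y) ∂Q) atTop (𝓝 0) := by
    have h1 := hharm.sub (hharm.comp (hsub s))
    rw [sub_zero] at h1
    refine h1.congr fun x => ?_
    have e : ∫ y, d (x - y) ∂Q = (∫ y, v (x - y) ∂Q) - ∫ y, v (x - s - y) ∂Q := by
      rw [← integral_sub (hvi x) (hvi (x - s))]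
      refine integral_congr_ae (ae_of_all _ fun y => ?_)
      simp only [hd, sub_right_comm]
    rw [e]
    simp only [hd, Function.comp]
    ring
  have hbddA : IsBoundedUnder (· ≤ ·) atTop d :=
    isBoundedUnder_of ⟨2 * B, fun x => (abs_le.1 (hdB x)).2⟩
  have hbddB : IsBoundedUnder (· ≥ ·) atTop d :=
    isBoundedUnder_of ⟨-(2 * B), fun x => (abs_le.1 (hdB x)).1⟩
  set α := limsup d atTop with hαdef
  have hα : ∀ ε, 0 < ε → ∀ᶠ x in atTop, d x < α + ε := fun ε hε =>
    eventually_lt_of_limsup_lt (by linarith) hbddA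
  have hclus : MapClusterPt α atTop d := by
    rw [mapClusterPt_iff_frequently]
    intro U hU
    obtain ⟨η, hη, hball⟩ := Metric.mem_nhds_iff.1 hU
    have h1 : ∃ᶠ x in atTop, α - η < d x :=
      frequently_lt_of_lt_limsup hbddB.isCoboundedUnder_flip (by linarith)
    refine (h1.and_eventually (hα η hη)).mono fun x hx => hball ?_
    rw [Metric.mem_ball, Real.dist_eq, abs_lt]
    constructor <;> linarith [hx.1, hx.2]
  obtain ⟨F, hF, hFα⟩ := mapClusterPt_iff_ultrafilter.1 hclus
  have hiter : ∀ j : ℕ, Tendsto (fun x => d (x - j * s)) F (𝓝 α) := by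
    intro j
    induction j with
    | zero => simpa using hFα
    | succ j ih =>
      -- The shift result is applied along the image of the ultrafilter, which still tends to
      -- infinity.
      have h1 : map (fun x : ℝ => x - j * s) (F : Filter ℝ) ≤ atTop :=
        (hsub (j * s)).mono_left hF
      have h2 := tendsto_shift_of_tendsto hdm hdB hdlip hdharm hα hs h1 (tendsto_map'_iff.2 ih)
      refine (tendsto_map'_iff.1 h2).congr fun x => ?_
      simp only [Function.comp]
      congr 1
      push_cast
      ring
  have htele : ∀ k : ℕ, (k : ℝ) * α ≤ 2 * B := by
    intro k
    have h1 : Tendsto (fun x => ∑ j ∈ Finset.range k, d (x - j * s)) F (𝓝 (k * α)) := by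
      have := tendsto_finsetSum (Finset.range k) fun j _ => hiter j
      simpa using this
    refine le_of_tendsto' h1 fun x => ?_
    have e : ∑ j ∈ Finset.range k, d (x - j * s) = v x - v (x - k * s) := by
      have h2 := Finset.sum_range_sub' (fun j : ℕ => v (x - j * s)) k
      simp only [Nat.cast_zero, zero_mul, sub_zero] at h2
      rw [← h2]
      refine Finset.sum_congr rfl fun j _ => ?_
      simp only [hd]
      congr 2
      push_cast
      ring
    rw [e]
    have h1 := abs_le.1 (hB x)
    have h2 := abs_le.1 (hB (x - k * s))
    linarith [h1.2, h2.1]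
  have hα0 : α ≤ 0 := by
    by_contra! hpos
    obtain ⟨k, hk⟩ := exists_nat_gt (2 * B / α)
    rw [div_lt_iff₀ hpos] at hk
    linarith [htele k]
  filter_upwards [hα ε hε] with x hx
  linarith

lemma tendsto_sub_shift (hv : Measurable v) (hB : ∀ x, |v x| ≤ B)
    (hlip : ∀ x y, |v x - v y| ≤ C * |x - y|)
    (hharm : Tendsto (fun x => v x - ∫ y, v (x - y) ∂Q) atTop (𝓝 0)) {s : ℝ}
    (hs : s ∈ Q.support) : Tendsto (fun x => v x - v (x - s)) atTop (𝓝 0) := by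
  rw [tendsto_order]
  constructor
  · intro a ha
    have h1 := eventually_sub_shift_lt (Q := Q) (v := fun x => -v x) (B := B) (C := C) hv.neg
      (fun x => by rw [abs_neg]; exact hB x)
      (fun x y => by rw [neg_sub_neg, abs_sub_comm]; exact hlip x y)
      (by
        have := hharm.neg
        rw [neg_zero] at this
        refine this.congr fun x => ?_
        rw [integral_neg]
        ring) hs (neg_pos.2 ha)
    filter_upwards [h1] with x hx
    linarith
  · intro a ha
    exact eventually_sub_shift_lt hv hB hlip hharm hs ha

/-- The asymptotic periods of a function. -/
def asympPeriods (v : ℝ → ℝ) : AddSubgroup ℝ where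
  carrier := {s | Tendsto (fun x => v x - v (x - s)) atTop (𝓝 0)}
  zero_mem' := by simp
  add_mem' := by
    intro a b ha hb
    have hb' : Tendsto (fun x => v (x - a) - v (x - a - b)) atTop (𝓝 0) :=
      Tendsto.comp hb (tendsto_atTop_add_const_right atTop (-a) tendsto_id)
    have h := Tendsto.add ha hb'
    rw [add_zero] at h
    refine h.congr fun x => ?_
    rw [sub_add_sub_cancel, sub_sub]
  neg_mem' := by
    intro a ha
    have h : Tendsto (fun x => v (x + a) - v (x + a - a)) atTop (𝓝 0) :=
      Tendsto.comp ha (tendsto_atTop_add_const_right atTop a tendsto_id)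
    have h' := h.neg
    rw [neg_zero] at h'
    refine h'.congr fun x => ?_
    rw [add_sub_cancel_right, sub_neg_eq_add]
    ring

lemma mem_asympPeriods {s : ℝ} :
    s ∈ asympPeriods v ↔ Tendsto (fun x => v x - v (x - s)) atTop (𝓝 0) := Iff.rfl

lemma isClosed_asympPeriods (hC : 0 ≤ C) (hlip : ∀ x y, |v x - v y| ≤ C * |x - y|) :
    IsClosed (asympPeriods v : Set ℝ) := by
  refine isClosed_of_closure_subset fun s hs => ?_
  rw [SetLike.mem_coe, mem_asympPeriods, Metric.tendsto_nhds]
  intro ε hε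
  obtain ⟨t, ht, hst⟩ := Metric.mem_closure_iff.1 hs (ε / (2 * (C + 1))) (by positivity)
  filter_upwards [(Metric.tendsto_nhds.1 (mem_asympPeriods.1 ht)) (ε / 2) (half_pos hε)] with x hx
  rw [Real.dist_eq, sub_zero] at hx ⊢
  have h1 := hlip (x - t) (x - s)
  have h2 : C * |x - t - (x - s)| ≤ ε / 2 := by
    rw [show x - t - (x - s) = s - t by ring]
    rw [Real.dist_eq] at hst
    calc C * |s - t| ≤ (C + 1) * (ε / (2 * (C + 1))) :=
          mul_le_mul (by linarith) hst.le (abs_nonneg _) (by linarith)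
      _ = ε / 2 := by field_simp
  calc |v x - v (x - s)| = |(v x - v (x - t)) + (v (x - t) - v (x - s))| := by ring_nf
    _ ≤ |v x - v (x - t)| + |v (x - t) - v (x - s)| := abs_add_le _ _
    _ < ε := by linarith

lemma ae_mem_asympPeriods_window {u : ℝ → ℝ} (hQ : Integrable (fun y : ℝ => y) Q)
    (h : IsSubharmonic Q u B) {δ : ℝ} (hδ : 0 ≤ δ) :
    ∀ᵐ y ∂Q, y ∈ asympPeriods (window u δ) := by
  filter_upwards [Measure.support_mem_ae (μ := Q)] with s hs
  refine tendsto_sub_shift (measurable_window h.meas h.mem δ) (B := B * δ) (fun x => ?_)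
    (abs_window_sub_le h.meas h.mem δ) (h.tendsto_window_sub hQ δ) hs
  have := window_mem h.mem hδ x
  rw [abs_of_nonneg this.1]
  exact this.2

end ShiftInvariance

/-! ### Subgroups carrying the step law. -/

section Lattice

variable {μ : Measure ℝ}

lemma eq_top_of_nonLattice (hμ : NonLattice μ) {H : AddSubgroup ℝ} (hH : IsClosed (H : Set ℝ))
    (hae : ∀ᵐ y ∂μ, y ∈ H) : H = ⊤ := by
  rcases H.dense_or_cyclic with hd | ⟨a, ha⟩
  · rw [← SetLike.coe_set_eq, ← hH.closure_eq, hd.closure_eq]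
    rfl
  · exfalso
    have hmem : ∀ y ∈ H, ∃ k : ℤ, y = k * a := by
      intro y hy
      rw [ha, AddSubgroup.mem_closure_singleton] at hy
      obtain ⟨k, hk⟩ := hy
      exact ⟨k, by rw [← hk, zsmul_eq_mul]⟩
    rcases eq_or_ne a 0 with rfl | ha0
    -- A law concentrated at `0` is carried by every lattice, in particular by `ℤ`.
    · refine hμ 1 one_pos (hae.mono fun y hy => ?_)
      obtain ⟨k, hk⟩ := hmem y hy
      exact ⟨0, by simp [hk]⟩
    · refine hμ |a| (abs_pos.2 ha0) (hae.mono fun y hy => ?_)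
      obtain ⟨k, hk⟩ := hmem y hy
      rcases abs_choice a with h | h
      · exact ⟨k, by rw [h, hk]⟩
      · exact ⟨-k, by rw [h, hk]; push_cast; ring⟩

/-- The integers `k` with `k h ∈ H` form a subgroup `aℤ`, and `μ` is carried by multiples of `a h`.
Maximality of `h` forces `a = ±1`; the case `a = 0` is excluded because then even `2 h` would carry
`μ`. -/
lemma span_mem_of_latticeWithSpan {h : ℝ} (hμ : LatticeWithSpan μ h) {H : AddSubgroup ℝ}
    (hae : ∀ᵐ y ∂μ, y ∈ H) : h ∈ H := by
  obtain ⟨hh, hcar, hmax⟩ := hμ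
  obtain ⟨a, ha⟩ := Int.subgroup_cyclic (H.comap (zmultiplesHom ℝ h))
  have hmem : ∀ k : ℤ, (k : ℝ) * h ∈ H ↔ ∃ j : ℤ, j * a = k := by
    intro k
    have h1 : (k : ℝ) * h ∈ H ↔ k ∈ H.comap (zmultiplesHom ℝ h) := by
      simp [AddSubgroup.mem_comap, zsmul_eq_mul]
    rw [h1, ha, AddSubgroup.mem_closure_singleton]
    simp
  have hcar' : ∀ᵐ y ∂μ, ∃ j : ℤ, y = j * (a * h) := by
    filter_upwards [hae, hcar] with y hy ⟨k, hk⟩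
    rw [hk] at hy
    obtain ⟨j, hj⟩ := (hmem k).1 hy
    exact ⟨j, by rw [hk, ← hj]; push_cast; ring⟩
  rcases eq_or_ne a 0 with rfl | ha0
  · have := hmax (2 * h) (by linarith) (hcar'.mono fun y ⟨j, hj⟩ => ⟨0, by simp [hj]⟩)
    linarith
  · have habs : CarriedByMultiples μ (((|a| : ℤ) : ℝ) * h) := by
      refine hcar'.mono fun y ⟨j, hj⟩ => ?_
      rcases abs_choice a with e | e
      · exact ⟨j, by rw [e, hj]⟩
      · exact ⟨-j, by rw [e, hj]; push_cast; ring⟩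
    have hpos : (0 : ℝ) < ((|a| : ℤ) : ℝ) := by exact_mod_cast abs_pos.2 ha0
    have h1 := hmax _ (mul_pos hpos hh) habs
    have h2 : ((|a| : ℤ) : ℝ) ≤ 1 := by
      by_contra! hcon
      nlinarith
    have h3 : |a| ≤ 1 := by exact_mod_cast h2
    have h4 : a = 1 ∨ a = -1 := by
      have := abs_pos.2 ha0
      rcases abs_choice a with e | e <;> omega
    have h5 := (hmem 1).2 (by rcases h4 with rfl | rfl <;> [exact ⟨1, by simp⟩; exact ⟨-1, by simp⟩])
    simpa using h5

end Lattice

/-! ### From asymptotic periods to convergence of window integrals. -/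

section Convergence

variable {Q : Measure ℝ} [IsProbabilityMeasure Q] {u : ℝ → ℝ} {B δ : ℝ}

lemma tendsto_integral_sub_mul_of_periods_eq_top {v : ℝ → ℝ} {C : ℝ} (hv : Measurable v)
    (hC : ∀ x, v x ∈ Set.Icc (0 : ℝ) C) (htop : asympPeriods v = ⊤) (y : ℝ) :
    Tendsto (fun x => (∫ t in (x - y)..x, v t) - y * v x) atTop (𝓝 0) := by
  have h1 : ∀ x, (∫ t in (x - y)..x, v t) - y * v x =
      ∫ t in (0 : ℝ)..y, (v (x - t) - v x) := by
    intro x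
    have hm : Measurable fun t => v (x - t) := measurable_comp_sub hv x
    rw [intervalIntegral.integral_sub (intervalIntegrable_of_mem_Icc hm (fun t => hC _) _ _)
      (by simp), intervalIntegral.integral_comp_sub_left (fun t => v t) x]
    simp
  simp only [h1]
  have h2 : Tendsto (fun x => ∫ t in (0 : ℝ)..y, (v (x - t) - v x)) atTop
      (𝓝 (∫ _ in (0 : ℝ)..y, (0 : ℝ))) := by
    refine intervalIntegral.tendsto_integral_filter_of_dominated_convergence (fun _ => C)
      (Eventually.of_forall fun x =>
        ((measurable_comp_sub hv x).sub_const _).aestronglyMeasurable)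
      (Eventually.of_forall fun x => ae_of_all _ fun t _ => ?_) (by simp)
      (ae_of_all _ fun t _ => ?_)
    · rw [Real.norm_eq_abs, abs_le]
      have a1 := hC (x - t)
      have a2 := hC x
      constructor <;> linarith [a1.1, a1.2, a2.1, a2.2]
    · have ht : t ∈ asympPeriods v := by rw [htop]; trivial
      have := (mem_asympPeriods.1 ht).neg
      rw [neg_zero] at this
      exact this.congr fun x => by ring
  simpa using h2

/-- If the mass flowing back over one step is asymptotic to `y * v x` for almost every step `y`,
then `v` converges. -/
lemma IsSubharmonic.tendsto_of_integral_sub (hQ : Integrable (fun y : ℝ => y) Q)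
    (hc : 0 < ∫ y, y ∂Q) (h : IsSubharmonic Q u B) {v : ℝ → ℝ} {C : ℝ}
    (hC : ∀ x, v x ∈ Set.Icc (0 : ℝ) C)
    (hlim : ∀ᵐ y ∂Q, Tendsto (fun x => (∫ t in (x - y)..x, u t) - y * v x) atTop (𝓝 0)) :
    ∃ L, Tendsto v atTop (𝓝 L) := by
  obtain ⟨L, hL⟩ := h.exists_tendsto_backflow hQ
  -- Integrated over `y`, the hypothesis says that the backflow minus `v` times the drift tends to
  -- `0`; since the backflow converges and the drift is positive, `v` converges.
  have h1 : Tendsto (fun x => ∫ y, ((∫ t in (x - y)..x, u t) - y * v x) ∂Q) atTop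
      (𝓝 (∫ _, (0 : ℝ) ∂Q)) := by
    refine tendsto_integral_filter_of_dominated_convergence (fun y => (B + C) * |y|)
      (Eventually.of_forall fun x => ((measurable_integral_sub h.meas h.mem x).sub
        (measurable_id.mul_const _)).aestronglyMeasurable)
      (Eventually.of_forall fun x => ae_of_all _ fun y => ?_) (hQ.abs.const_mul _) hlim
    have a1 := abs_integral_le_of_mem_Icc h.mem (x - y) x
    rw [sub_sub_cancel] at a1
    have a2 : |y * v x| ≤ C * |y| := by
      rw [abs_mul, abs_of_nonneg (hC x).1, mul_comm]
      exact mul_le_mul_of_nonneg_right (hC x).2 (abs_nonneg y)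
    rw [Real.norm_eq_abs]
    have a3 := abs_sub (∫ t in (x - y)..x, u t) (y * v x)
    linarith
  have h2 : ∀ x, ∫ y, ((∫ t in (x - y)..x, u t) - y * v x) ∂Q =
      backflow Q u x - (∫ y, y ∂Q) * v x := by
    intro x
    rw [integral_sub (integrable_integral_sub hQ h.meas h.mem x) (hQ.mul_const _),
      integral_mul_const]
    rfl
  simp only [h2, integral_zero] at h1
  refine ⟨(L - 0) / ∫ y, y ∂Q, ((hL.sub h1).div_const (∫ y, y ∂Q)).congr fun x => ?_⟩
  have := hc.ne'
  field_simp
  ring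

/-- An interval of length `k δ` splits into `k` windows, each a shift of the one at `x` by a
multiple of the asymptotic period `δ`. Negative `k` occur as well, with oriented integrals, since
steps may be negative. -/
lemma tendsto_integral_sub_mul_window (hu : Measurable u) (hB : ∀ x, u x ∈ Set.Icc (0 : ℝ) B)
    (hper : δ ∈ asympPeriods (window u δ)) (k : ℤ) :
    Tendsto (fun x => (∫ t in (x - k * δ)..x, u t) - k * window u δ x) atTop (𝓝 0) := by
  have hii := intervalIntegrable_of_mem_Icc hu hB
  have hstep : ∀ k : ℤ, Tendsto (fun x => window u δ (x - (k + 1) * δ) - window u δ x)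
      atTop (𝓝 0) := by
    intro k
    have hmem : ((k + 1 : ℤ) : ℝ) * δ ∈ asympPeriods (window u δ) := by
      rw [← zsmul_eq_mul]
      exact AddSubgroup.zsmul_mem _ hper _
    have := (mem_asympPeriods.1 hmem).neg
    rw [neg_zero] at this
    refine this.congr fun x => ?_
    push_cast
    ring
  have hsucc : ∀ (k : ℤ) (x : ℝ), (∫ t in (x - ((k + 1 : ℤ) : ℝ) * δ)..x, u t) -
      ((k + 1 : ℤ) : ℝ) * window u δ x = ((∫ t in (x - k * δ)..x, u t) - k * window u δ x) +
      (window u δ (x - (k + 1) * δ) - window u δ x) := by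
    intro k x
    rw [← intervalIntegral.integral_add_adjacent_intervals (hii _ (x - k * δ)) (hii (x - k * δ) x)]
    have e : window u δ (x - (k + 1) * δ) =
        ∫ t in (x - ((k + 1 : ℤ) : ℝ) * δ)..(x - k * δ), u t := by
      rw [window]
      push_cast
      congr 1
      ring
    rw [e]
    push_cast
    ring
  induction k using Int.induction_on with
  | zero => simp
  | succ k ih =>
    have h := ih.add (hstep k)
    rw [add_zero] at h
    exact h.congr fun x => (hsucc k x).symm
  | pred k ih =>
    have h := ih.sub (hstep (-k - 1))
    rw [sub_zero] at h
    refine h.congr fun x => ?_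
    have := hsucc (-k - 1) x
    rw [sub_add_cancel] at this
    rw [this]
    ring

end Convergence

/-! ### Existence of the limit of `exp (γ x) P(M ≥ x)`. -/

section TailAsymptotics

variable {p : PMF ℕ} {μ : Measure ℝ} {m γ : ℝ}

lemma tailLim_ceil (o : Convention) (p : PMF ℕ) {h : ℝ} (hh : 0 < h)
    (hμ : CarriedByMultiples μ h) (x : ℝ) :
    tailLim o p μ (h * (⌈x / h⌉ : ℤ)) = tailLim o p μ x := by
  simp only [tailLim, tail_ceil o p hh hμ]

variable [IsProbabilityMeasure μ]

lemma Subcritical.isSubharmonic (h : Subcritical p μ m γ) (o : Convention) :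
    IsSubharmonic (tilt μ m γ) (fun x => Real.exp (γ * x) * tailLim o p μ x) 1 where
  meas := measurable_exp_mul (tailLim_antitone o p μ).measurable
  mem := h.exp_mul_tailLim_mem o
  le _ hx := h.exp_mul_tailLim_le o hx

/-- A bounded function that cannot jump upwards abruptly converges as soon as all its window
integrals do. -/
lemma tendsto_of_tendsto_window {F : ℝ → ℝ} (hF : Antitone F)
    (hγ : 0 < γ) (hB : ∀ x, Real.exp (γ * x) * F x ∈ Set.Icc (0 : ℝ) 1)
    (hw : ∀ δ, 0 < δ → ∃ L,
      Tendsto (window (fun x => Real.exp (γ * x) * F x) δ) atTop (𝓝 L)) :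
    ∃ κ, Tendsto (fun x => Real.exp (γ * x) * F x) atTop (𝓝 κ) := by
  set u : ℝ → ℝ := fun x => Real.exp (γ * x) * F x with hu
  have hum : Measurable u := measurable_exp_mul hF.measurable
  have hii := intervalIntegrable_of_mem_Icc hum hB
  -- As `F` is antitone, `u` grows at most exponentially. A window of length `δ` thus pins `u` at
  -- both ends up to factors `exp (γ δ)`, so limsup and liminf differ by at most `exp (2 γ δ)`, and
  -- `δ → 0` closes the gap.
  have hgrow : ∀ s t, s ≤ t → u t ≤ Real.exp (γ * (t - s)) * u s := by
    intro s t hst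
    have : u t ≤ Real.exp (γ * t) * F s := mul_le_mul_of_nonneg_left (hF hst) (Real.exp_pos _).le
    refine this.trans_eq ?_
    simp only [hu]
    rw [← mul_assoc, ← Real.exp_add]
    congr 2
    ring
  have hupper : ∀ δ, 0 < δ → ∀ x, window u δ x ≤ δ * (Real.exp (γ * δ) * u x) := by
    intro δ hδ x
    have h1 : ∫ t in x..(x + δ), u t ≤ ∫ _ in x..(x + δ), Real.exp (γ * δ) * u x := by
      refine intervalIntegral.integral_mono_on (by linarith) (hii _ _) (by simp) fun t ht => ?_
      refine (hgrow x t ht.1).trans (mul_le_mul_of_nonneg_right (Real.exp_le_exp.2 ?_) (hB x).1)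
      exact mul_le_mul_of_nonneg_left (by linarith [ht.2]) hγ.le
    rw [intervalIntegral.integral_const, smul_eq_mul, add_sub_cancel_left] at h1
    exact h1
  have hlower : ∀ δ, 0 < δ → ∀ x, δ * u (x + δ) ≤ Real.exp (γ * δ) * window u δ x := by
    intro δ hδ x
    have h1 : ∫ _ in x..(x + δ), u (x + δ) ≤ ∫ t in x..(x + δ), Real.exp (γ * δ) * u t := by
      refine intervalIntegral.integral_mono_on (by linarith) (by simp)
        ((hii _ _).const_mul _) fun t ht => ?_
      refine (hgrow t (x + δ) ht.2).trans
        (mul_le_mul_of_nonneg_right (Real.exp_le_exp.2 ?_) (hB t).1)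
      exact mul_le_mul_of_nonneg_left (by linarith [ht.1]) hγ.le
    rw [intervalIntegral.integral_const, smul_eq_mul, add_sub_cancel_left,
      intervalIntegral.integral_const_mul] at h1
    exact h1
  have hbA : IsBoundedUnder (· ≤ ·) atTop u := isBoundedUnder_of ⟨1, fun x => (hB x).2⟩
  have hbB : IsBoundedUnder (· ≥ ·) atTop u := isBoundedUnder_of ⟨0, fun x => (hB x).1⟩
  have hcomp : ∀ δ, 0 < δ →
      limsup u atTop ≤ Real.exp (γ * δ) * (Real.exp (γ * δ) * liminf u atTop) := by
    intro δ hδ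
    obtain ⟨L, hL⟩ := hw δ hδ
    have h1 : limsup u atTop ≤ Real.exp (γ * δ) * L / δ := by
      have ht : Tendsto (fun x => Real.exp (γ * δ) * window u δ (x - δ) / δ) atTop
          (𝓝 (Real.exp (γ * δ) * L / δ)) :=
        ((hL.comp (tendsto_atTop_add_const_right atTop (-δ) tendsto_id)).const_mul _).div_const δ
      rw [← ht.limsup_eq]
      refine limsup_le_limsup (Eventually.of_forall fun x => ?_) hbB.isCoboundedUnder_flip
        ht.isBoundedUnder_le
      rw [le_div_iff₀ hδ, mul_comm]
      have := hlower δ hδ (x - δ)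
      rwa [sub_add_cancel] at this
    have h2 : L / (δ * Real.exp (γ * δ)) ≤ liminf u atTop := by
      have ht : Tendsto (fun x => window u δ x / (δ * Real.exp (γ * δ))) atTop
          (𝓝 (L / (δ * Real.exp (γ * δ)))) := hL.div_const _
      rw [← ht.liminf_eq]
      refine liminf_le_liminf (Eventually.of_forall fun x => ?_) ht.isBoundedUnder_ge
        hbA.isCoboundedUnder_flip
      rw [div_le_iff₀ (by positivity)]
      refine (hupper δ hδ x).trans_eq ?_
      ring
    rw [div_le_iff₀ (by positivity)] at h2
    refine h1.trans ?_
    rw [div_le_iff₀ hδ, mul_assoc]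
    refine mul_le_mul_of_nonneg_left (h2.trans_eq ?_) (Real.exp_pos _).le
    ring
  have hle : limsup u atTop ≤ liminf u atTop := by
    have ht : Tendsto (fun δ => Real.exp (γ * δ) * (Real.exp (γ * δ) * liminf u atTop))
        (𝓝[>] 0) (𝓝 (liminf u atTop)) := by
      have hc : Continuous fun δ => Real.exp (γ * δ) * (Real.exp (γ * δ) * liminf u atTop) := by
        fun_prop
      have := hc.tendsto 0
      simp only [mul_zero, Real.exp_zero, one_mul] at this
      exact this.mono_left nhdsWithin_le_nhds
    refine ge_of_tendsto ht ?_
    filter_upwards [self_mem_nhdsWithin] with δ hδ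
    exact hcomp δ hδ
  exact ⟨_, tendsto_of_le_liminf_of_limsup_le le_rfl hle hbA hbB⟩

lemma Subcritical.exists_tendsto_of_nonLattice (h : Subcritical p μ m γ) (o : Convention)
    (hμ : NonLattice μ) :
    ∃ κ, Tendsto (fun x => Real.exp (γ * x) * tailLim o p μ x) atTop (𝓝 κ) := by
  have := h.prob
  have hu := h.isSubharmonic o
  refine tendsto_of_tendsto_window (tailLim_antitone o p μ)
    h.gamma_pos (h.exp_mul_tailLim_mem o) fun δ hδ => ?_
  have hv := hu.window h.integrable_id hδ.le
  have htop := eq_top_of_nonLattice hμ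
    (isClosed_asympPeriods (C := 2 * 1) (by norm_num) (abs_window_sub_le hu.meas hu.mem δ))
    ((ae_tilt_iff h.mean_pos).1 (ae_mem_asympPeriods_window h.integrable_id hu hδ.le))
  exact hv.tendsto_of_integral_sub h.integrable_id h.drift_pos hv.mem
    (ae_of_all _ fun y => tendsto_integral_sub_mul_of_periods_eq_top hv.meas hv.mem htop y)

/-- `F` is constant on `(h k, h (k + 1)]`, so only the exponential is integrated. The value that
appears is the one at the right end of the window, hence the shift from `k` to `k + 1`. -/
lemma window_lattice {F : ℝ → ℝ} {h : ℝ} (hh : 0 < h) (hγ : 0 < γ)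
    (hF : ∀ x, F (h * (⌈x / h⌉ : ℤ)) = F x) (k : ℤ) :
    window (fun x => Real.exp (γ * x) * F x) h (h * k) =
      (1 - Real.exp (-(γ * h))) / γ * (Real.exp (γ * (h * (k + 1))) * F (h * (k + 1))) := by
  have h1 : window (fun x => Real.exp (γ * x) * F x) h (h * k) =
      ∫ t in (h * k)..(h * k + h), Real.exp (γ * t) * F (h * (k + 1)) := by
    refine intervalIntegral.integral_congr_ae (ae_of_all _ fun t ht => ?_)
    rw [Set.uIoc_of_le (by linarith)] at ht
    have e : ⌈t / h⌉ = k + 1 := by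
      rw [Int.ceil_eq_iff]
      push_cast
      constructor
      · rw [add_sub_cancel_right, lt_div_iff₀ hh]
        linarith [ht.1]
      · rw [div_le_iff₀ hh]
        linarith [ht.2]
    rw [← hF t, e]
    push_cast
    rfl
  rw [h1, intervalIntegral.integral_mul_const,
    intervalIntegral.integral_comp_mul_left (fun t => Real.exp t) hγ.ne', integral_exp, smul_eq_mul]
  have e1 : γ * (h * k + h) = γ * (h * (k + 1)) := by ring
  have e2 : Real.exp (γ * (h * k)) = Real.exp (-(γ * h)) * Real.exp (γ * (h * (k + 1))) := by
    rw [← Real.exp_add]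
    congr 1
    ring
  rw [e1, e2]
  ring

lemma Subcritical.exists_tendsto_of_lattice (h : Subcritical p μ m γ) (o : Convention) {s : ℝ}
    (hμ : LatticeWithSpan μ s) :
    ∃ κ, Tendsto (fun k : ℕ => Real.exp (γ * (s * k)) * tailLim o p μ (s * k)) atTop (𝓝 κ) := by
  have := h.prob
  have hu := h.isSubharmonic o
  have hs := hμ.1
  have hγ := h.gamma_pos
  have hper := span_mem_of_latticeWithSpan hμ
    ((ae_tilt_iff h.mean_pos).1 (ae_mem_asympPeriods_window h.integrable_id hu hs.le))
  set u : ℝ → ℝ := fun x => Real.exp (γ * x) * tailLim o p μ x with hudef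
  obtain ⟨L, hL⟩ := hu.tendsto_of_integral_sub h.integrable_id h.drift_pos
    (v := fun x => window u s x / s) (C := 1)
    (fun x => by
      have := window_mem hu.mem hs.le x
      rw [one_mul] at this
      exact ⟨div_nonneg this.1 hs.le, (div_le_one hs).2 this.2⟩)
    (by
      filter_upwards [(ae_tilt_iff h.mean_pos).2 hμ.2.1] with y ⟨k, hk⟩
      refine (tendsto_integral_sub_mul_window hu.meas hu.mem hper k).congr fun x => ?_
      rw [hk]
      field_simp)
  have hpos : 0 < 1 - Real.exp (-(γ * s)) := by
    rw [sub_pos, Real.exp_lt_one_iff]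
    linarith [mul_pos hγ hs]
  have hk : Tendsto (fun k : ℕ => s * (k : ℝ)) atTop atTop :=
    tendsto_natCast_atTop_atTop.const_mul_atTop hs
  -- The constant undoes the division by `s` and the factor of `window_lattice`.
  have h1 := (hL.comp hk).const_mul (s * γ / (1 - Real.exp (-(γ * s))))
  refine ⟨_, (tendsto_add_atTop_iff_nat 1).1 (h1.congr fun k => ?_)⟩
  have h2 := window_lattice hs hγ (tailLim_ceil o p hs hμ.2.1) (k : ℤ)
  simp only [Function.comp]
  rw [Int.cast_natCast] at h2
  rw [h2]
  push_cast
  generalize 1 - Real.exp (-(γ * s)) = D at hpos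
  field_simp

end TailAsymptotics

/-! ### Behaviour at `x = c n` below and above the critical speed. -/

section Transition

variable {p : PMF ℕ} {μ : Measure ℝ} {m γ : ℝ} [IsProbabilityMeasure μ]

lemma Subcritical.tendsto_exp_mul_tailLim_sub (h : Subcritical p μ m γ) (o : Convention) {c : ℝ}
    (hc : c < ∫ y, y ∂(tilt μ m γ)) :
    Tendsto (fun n : ℕ => Real.exp (γ * (c * n)) *
      (tailLim o p μ (c * n) - tail o p μ n (c * n))) atTop (𝓝 0) := by
  have := h.prob
  refine squeeze_zero (fun n => ?_) (fun n => h.exp_mul_tailLim_sub_le o n (c * n))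
    (tendsto_walkCdf_of_lt_mean _ h.integrable_id hc)
  exact mul_nonneg (Real.exp_pos _).le (sub_nonneg.2 (tail_le_tailLim o p μ n _))

lemma Subcritical.tendsto_exp_mul_tail_zero (h : Subcritical p μ m γ) (o : Convention) {c : ℝ}
    (hc : ∫ y, y ∂(tilt μ m γ) < c) :
    Tendsto (fun n : ℕ => Real.exp (γ * (c * n)) * tail o p μ n (c * n)) atTop (𝓝 0) := by
  have := h.prob
  obtain ⟨K, hK⟩ := h.exp_mul_tail_le o
  -- An intermediate speed absorbs the constant shift `K`: eventually `c' n ≤ c n - K`.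
  obtain ⟨c', hc1, hc2⟩ := exists_between hc
  have hlim : Tendsto (fun n : ℕ => 2 * (1 - walkCdf (tilt μ m γ) n (c' * n))) atTop (𝓝 0) := by
    simpa using ((tendsto_walkCdf_of_mean_lt _ h.integrable_id hc1).const_sub 1).const_mul 2
  refine squeeze_zero' (Eventually.of_forall fun n => (h.exp_mul_tail_mem o n _).1) ?_ hlim
  have hgrow : Tendsto (fun n : ℕ => (c - c') * (n : ℝ)) atTop atTop :=
    tendsto_natCast_atTop_atTop.const_mul_atTop (sub_pos.2 hc2)
  filter_upwards [hgrow.eventually_ge_atTop K] with n hn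
  have := walkCdf_mono (tilt μ m γ) n (by linarith : c' * n ≤ c * n - K)
  linarith [hK n (c * n)]

lemma tendsto_div_zero_of_exp_mul {g F : ℕ → ℝ} {x : ℕ → ℝ} {ε : ℝ} (hε : 0 < ε)
    (hg : ∀ n, 0 ≤ g n) (hF : ∀ n, ε ≤ Real.exp (γ * x n) * F n)
    (hlim : Tendsto (fun n => Real.exp (γ * x n) * g n) atTop (𝓝 0)) :
    Tendsto (fun n => g n / F n) atTop (𝓝 0) := by
  have hFpos : ∀ n, 0 < F n := fun n =>
    pos_of_mul_pos_right (hε.trans_le (hF n)) (Real.exp_pos _).le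
  have h1 : Tendsto (fun n => Real.exp (γ * x n) * g n / ε) atTop (𝓝 0) := by
    simpa using hlim.div_const ε
  refine squeeze_zero (fun n => div_nonneg (hg n) (hFpos n).le) (fun n => ?_) h1
  rw [div_le_div_iff₀ (hFpos n) hε]
  calc g n * ε ≤ g n * (Real.exp (γ * x n) * F n) := mul_le_mul_of_nonneg_left (hF n) (hg n)
    _ = _ := by ring

end Transition

end BRW

/-! ### The theorem, assembled from the analysis of `tail` and `tailLim`. -/

theorem theorem1p2 {Ω : Type*} [MeasurableSpace Ω] (P : Measure Ω) [IsProbabilityMeasure P]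
    (p : PMF ℕ) (μ : Measure ℝ) [IsProbabilityMeasure μ]
    (N : List ℕ → Ω → ℕ) (X : List ℕ → Ω → ℝ) (hBRW : BRW.IsReproduction P p μ N X)
    (o : BRW.Convention) (m γ : ℝ)
    (hm : HasSum (fun k : ℕ => (k : ℝ) * (p k).toReal) m) (hm0 : 0 < m) (hm1 : m < 1)
    (hγ : 0 < γ)
    (hint : Integrable (fun x : ℝ => Real.exp (γ * x)) μ)
    (hexp : ∫ x : ℝ, Real.exp (γ * x) ∂μ = 1 / m)
    (hX : Integrable (fun x : ℝ => x * Real.exp (γ * x)) μ)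
    (hlog : Summable (fun k : ℕ => (k : ℝ) * Real.log k * (p k).toReal)) :
    -- the conditional probabilities below the critical speed
    (∀ c : ℝ, 0 < c → c < m * ∫ x : ℝ, x * Real.exp (γ * x) ∂μ →
      Tendsto (fun n : ℕ =>
          (cond P (BRW.eventAll o N X (c * n))).real (BRW.eventUpTo o N X n (c * n)))
        atTop (𝓝 1)) ∧
    -- the conditional probabilities above the critical speed
    (∀ c : ℝ, m * ∫ x : ℝ, x * Real.exp (γ * x) ∂μ < c →
      Tendsto (fun n : ℕ =>
          (cond P (BRW.eventAll o N X (c * n))).real (BRW.eventUpTo o N X n (c * n)))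
        atTop (𝓝 0)) ∧
    -- the sharp transition, below the critical speed, non-lattice steps
    (BRW.NonLattice μ → ∃ κ : ℝ, 0 < κ ∧ κ ≤ 1 ∧
      Tendsto (fun x : ℝ => Real.exp (γ * x) * P.real (BRW.eventAll o N X x)) atTop (𝓝 κ) ∧
      ∀ c : ℝ, 0 < c → c < m * ∫ x : ℝ, x * Real.exp (γ * x) ∂μ →
        Tendsto (fun n : ℕ =>
            Real.exp (γ * (c * n)) * P.real (BRW.eventUpTo o N X n (c * n)))
          atTop (𝓝 κ)) ∧
    -- the sharp transition, below the critical speed, lattice steps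
    (∀ h : ℝ, BRW.LatticeWithSpan μ h → ∃ κ : ℝ, 0 < κ ∧ κ ≤ 1 ∧
      Tendsto (fun k : ℕ => Real.exp (γ * (h * k)) * P.real (BRW.eventAll o N X (h * k)))
        atTop (𝓝 κ) ∧
      ∀ c : ℝ, 0 < c → c < m * ∫ x : ℝ, x * Real.exp (γ * x) ∂μ →
        Tendsto (fun n : ℕ =>
            Real.exp (γ * (h * (⌈c * n / h⌉ : ℤ))) * P.real (BRW.eventUpTo o N X n (c * n)))
          atTop (𝓝 κ)) ∧
    -- the sharp transition, above the critical speed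
    (∀ c : ℝ, m * ∫ x : ℝ, x * Real.exp (γ * x) ∂μ < c →
      Tendsto (fun n : ℕ =>
          Real.exp (γ * (c * n)) * P.real (BRW.eventUpTo o N X n (c * n)))
        atTop (𝓝 0)) := by
  have h : BRW.Subcritical p μ m γ := ⟨hm, hm0, hm1, hγ, hint, hexp, hX⟩
  have hQ := h.prob
  have hmean : ∫ y, y ∂(BRW.tilt μ m γ) = m * ∫ x : ℝ, x * Real.exp (γ * x) ∂μ :=
    BRW.integral_id_tilt hm0
  have hdrift := h.drift_pos
  rw [← hmean]
  obtain ⟨ε, hε, hlow⟩ := h.exists_le_exp_mul_tailLim hlog o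
  have hAll : ∀ x, P.real (BRW.eventAll o N X x) = BRW.tailLim o p μ x := fun x =>
    BRW.prob_eventAll hBRW o (BRW.tendsto_tail o p μ) (h.tailLim_leftCont o x)
  have hUp : ∀ n x, P.real (BRW.eventUpTo o N X n x) = BRW.tail o p μ n x :=
    BRW.prob_eventUpTo hBRW o
  -- Since `{M_n ≥ x}` is contained in `{M ≥ x}`, the conditional probability is a quotient of
  -- tails.
  have hcond : ∀ n x, (cond P (BRW.eventAll o N X x)).real (BRW.eventUpTo o N X n x) =
      BRW.tail o p μ n x / BRW.tailLim o p μ x := by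
    intro n x
    rw [measureReal_def, cond_apply (BRW.measurableSet_eventAll hBRW o x), Set.inter_eq_self_of_subset_right
      (BRW.eventUpTo_subset_eventAll o N X n x), ENNReal.toReal_mul, ENNReal.toReal_inv,
      ← measureReal_def, ← measureReal_def, hAll, hUp, inv_mul_eq_div]
  simp only [hcond, hAll, hUp]
  have hlow' : ∀ c : ℝ, 0 < c → ∀ n : ℕ,
      ε ≤ Real.exp (γ * (c * n)) * BRW.tailLim o p μ (c * n) :=
    fun c hc n => hlow _ (by positivity)
  have hgrow : ∀ c : ℝ, 0 < c → Tendsto (fun n : ℕ => c * (n : ℝ)) atTop atTop := fun c hc =>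
    tendsto_natCast_atTop_atTop.const_mul_atTop hc
  refine ⟨fun c hc0 hc => ?_, fun c hc => ?_, fun hμ => ?_, fun s hμ => ?_, fun c hc => ?_⟩
  · have h1 := BRW.tendsto_div_zero_of_exp_mul hε
      (fun n => sub_nonneg.2 (BRW.tail_le_tailLim o p μ n (c * n))) (hlow' c hc0)
      (h.tendsto_exp_mul_tailLim_sub o hc)
    have h2 := h1.const_sub 1
    rw [sub_zero] at h2
    refine h2.congr fun n => ?_
    have hpos : BRW.tailLim o p μ (c * n) ≠ 0 :=
      (pos_of_mul_pos_right (hε.trans_le (hlow' c hc0 n)) (Real.exp_pos _).le).ne'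
    rw [sub_div, div_self hpos, sub_sub_cancel]
  · exact BRW.tendsto_div_zero_of_exp_mul hε (fun n => (BRW.tail_mem o p μ n _).1)
      (hlow' c (hdrift.trans hc)) (h.tendsto_exp_mul_tail_zero o hc)
  · obtain ⟨κ, hκ⟩ := h.exists_tendsto_of_nonLattice o hμ
    refine ⟨κ, ?_, le_of_tendsto' hκ fun x => (h.exp_mul_tailLim_mem o x).2, hκ,
      fun c hc0 hc => ?_⟩
    · refine hε.trans_le (ge_of_tendsto hκ ?_)
      filter_upwards [eventually_ge_atTop 0] with x hx using hlow x hx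
    · have h1 := (hκ.comp (hgrow c hc0)).sub (h.tendsto_exp_mul_tailLim_sub o hc)
      rw [sub_zero] at h1
      refine h1.congr fun n => ?_
      simp only [Function.comp]
      ring
  · obtain ⟨κ, hκ⟩ := h.exists_tendsto_of_lattice o hμ
    have hs := hμ.1
    refine ⟨κ, ?_, le_of_tendsto' hκ fun k => (h.exp_mul_tailLim_mem o _).2, hκ,
      fun c hc0 hc => ?_⟩
    · exact hε.trans_le (ge_of_tendsto' hκ fun k => hlow _ (by positivity))
    · have hceil : Tendsto (fun n : ℕ => ⌈c * n / s⌉₊) atTop atTop :=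
        tendsto_nat_ceil_atTop.comp ((hgrow c hc0).atTop_div_const hs)
      have hcast : ∀ n : ℕ, ((⌈c * n / s⌉₊ : ℕ) : ℝ) = ((⌈c * n / s⌉ : ℤ) : ℝ) := fun n => by
        have h0 : 0 ≤ c * n / s := by positivity
        exact natCast_ceil_eq_intCast_ceil h0
      -- The tail of `M` at `c n` equals its value at the lattice point above, so this is the
      -- lattice limit along `⌈c n / s⌉`.
      have h1 : Tendsto (fun n : ℕ => Real.exp (γ * (s * (⌈c * n / s⌉ : ℤ))) *
          BRW.tailLim o p μ (c * n)) atTop (𝓝 κ) := by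
        refine (hκ.comp hceil).congr fun n => ?_
        simp only [Function.comp, hcast, BRW.tailLim_ceil o p hs hμ.2.1]
      have h2 : Tendsto (fun n : ℕ => Real.exp (γ * (s * (⌈c * n / s⌉ : ℤ))) *
          (BRW.tailLim o p μ (c * n) - BRW.tail o p μ n (c * n))) atTop (𝓝 0) := by
        -- Rounding up moves the exponent by at most `γ s`, which costs a bounded factor.
        have h3 := (h.tendsto_exp_mul_tailLim_sub o hc).const_mul (Real.exp (γ * s))
        rw [mul_zero] at h3
        refine squeeze_zero (fun n => mul_nonneg (Real.exp_pos _).le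
          (sub_nonneg.2 (BRW.tail_le_tailLim o p μ n _))) (fun n => ?_) h3
        rw [← mul_assoc (Real.exp (γ * s)), ← Real.exp_add, ← mul_add]
        refine mul_le_mul_of_nonneg_right (Real.exp_le_exp.2
          (mul_le_mul_of_nonneg_left ?_ hγ.le)) (sub_nonneg.2 (BRW.tail_le_tailLim o p μ n _))
        have h4 := mul_le_mul_of_nonneg_left (Int.ceil_lt_add_one (c * n / s)).le hs.le
        have h5 : s * (c * n / s + 1) = s + c * n := by
          field_simp
          ring
        linarith
      have h3 := h1.sub h2
      rw [sub_zero] at h3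
      exact h3.congr fun n => by ring
  · exact h.tendsto_exp_mul_tail_zero o hc
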